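/- Let $A=(a_{ij})_{i,j\in I}$ be an even symmetrizable Borcherds–Cartan matrix: an integer matrix with $a_{ii}\in\{2,0,-2,-4,\dots\}$, $a_{ij}\le 0$ for $i\ne j$, and $r_ia_{ij}=r_ja_{ji}$ for positive integers $r_i$. Let $P$ be a free abelian group, $P^\vee=\operatorname{Hom}(P,\mathbf Z)$, and let $\alpha_i\in P$ (linearly independent) and $h_i\in P^\vee$ satisfy $\langle h_i,\alpha_j\rangle=a_{ij}$; suppose that for each $i$ there is $\Lambda_i\in P$ with $\langle h_j,\Lambda_i\rangle=\delta_{ij}$ for all $j$. Call $i$ real if $a_{ii}=2$ and imaginary otherwise, and let $I^\infty$ be the set of pairs $(i,l)$ with $l\ge 1$, and $l=1$ if $i$ is real. Put $(\alpha_i,\alpha_j)=r_ia_{ij}$ (extended bilinearly to $\bigoplus_i\mathbf Z\alpha_i$), $q_i=q^{r_i}$, $q_{(i)}=q^{(\alpha_i,\alpha_i)/2}$, $[n]_i=\frac{q_i^n-q_i^{-n}}{q_i-q_i^{-1}}$, $x_i^{(n)}=x_i^n/([1]_i\cdots[n]_i)$ and $K_i=q^{r_ih_i}$. **The form.** Let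 $\mathscr F$ be the free $\mathbf Q(q)$-algebra on $f_{il}$, $(i,l)\in I^\infty$, graded by $|f_{il}|=-l\alpha_i$, with $f_{i0}=1$. Give $\mathscr F\otimes\mathscr F$ the product $(x_1\otimes x_2)(y_1\otimes y_2)=q^{-(|x_2|,|y_1|)}x_1y_1\otimes x_2y_2$ for homogeneous elements, and let $\varrho:\mathscr F\to\mathscr F\otimes\mathscr F$ be the algebra homomorphism with $\varrho(f_{il})=\sum_{m+n=l}q_{(i)}^{-mn}f_{im}\otimes f_{in}$. Let $\nu_{il}\in\mathbf Q(q)$ have power series expansions in $1+q\mathbf Z_{\ge0}[[q]]$, and let $(\ ,\ )_L$ be the symmetric bilinear form on $\mathscr F$ with $(1,1)_L=1$, $(f_{il},f_{il})_L=\nu_{il}$, $(x,y)_L=0$ if $|x|\ne|y|$, and $(x,yz)_L=(\varrho(x),y\otimes z)_L$. **The algebra $U_q(\mathfrak g)$.** Let $\widehat U$ be the $\mathbf Q(q)$-algebra generated by $q^h$ $(h\in P^\vee)$ and $e_{il},f_{il}$ $((i,l)\in I^\infty)$ with relations $$q^0=1,\quad q^hq^{h'}=q^{h+h'},\quad q^he_{jl}q^{-h}=q^{l\langle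 h,\alpha_j\rangle}e_{jl},\quad q^hf_{jl}q^{-h}=q^{-l\langle h,\alpha_j\rangle}f_{jl},$$ $$\sum_{r+s=1-la_{ij}}(-1)^re_i^{(r)}e_{jl}e_i^{(s)}=\sum_{r+s=1-la_{ij}}(-1)^rf_i^{(r)}f_{jl}f_i^{(s)}=0\quad(i\text{ real},\ (i,1)\ne(j,l)\in I^\infty),$$ $$e_{ik}e_{jl}-e_{jl}e_{ik}=f_{ik}f_{jl}-f_{jl}f_{ik}=0\quad(a_{ij}=0),$$ where $e_i=e_{i1}$, $f_i=f_{i1}$ for real $i$. Let $\widehat U^{\le0}$ be the subalgebra generated by all $f_{il}$ and $q^h$, with comultiplication $\Delta(q^h)=q^h\otimes q^h$, $\Delta(f_{il})=\sum_{m+n=l}q_{(i)}^{-mn}f_{im}K_i^n\otimes f_{in}$, and let $\widehat U^{\le0}_K$ be its subalgebra generated by all $f_{il}$ and $K_i^{\pm1}$. For $a\in\widehat U^{\le0}$, $b\in\widehat U^{\le0}_K$ let $(a,b)_L=(b,a)_L$ be the pairing given by $(xq^h,yK_\beta)_L=(x,y)_L\,q^{-\langle h,\beta\rangle}$ for $x,y$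 polynomials in the $f_{il}$, $\beta=\sum\beta_i\alpha_i$, $K_\beta=\prod K_i^{\beta_i}$. Let $\omega:\widehat U\to\widehat U$ be the algebra involution $e_{il}\leftrightarrow f_{il}$, $q^h\mapsto q^{-h}$. Then $U_q(\mathfrak g)$ is the quotient of $\widehat U$ by the relations (in Sweedler notation) $$\sum(a_{(1)},b_{(2)})_L\,\omega(b_{(1)})\,a_{(2)}=\sum(a_{(2)},b_{(1)})_L\,a_{(1)}\,\omega(b_{(2)})$$ for all $a,b\in\widehat U^{\le0}$ at least one of which lies in $\widehat U^{\le0}_K$. **Primitive generators.** For real $i$ put $\mathtt b_{i1}=f_{i1}$. For imaginary $i$ let $\mathtt b_{il}$ be an element of degree $-l\alpha_i$ of $\mathscr F$ such that $\mathtt b_{il}-f_{il}\in\mathbf Q(q)\langle f_{ik}\mid k<l\rangle$ and $(\mathtt b_{il},z)_L=0$ for all $z\in\mathbf Q(q)\langle f_{ik}\mid k<l\rangle$. Write $\mathtt b_{il}$ also for its image in $U_q(\mathfrak g)$, put $\mathtt a_{il}=\omega(\mathtt b_{il})$ (the same polynomial in the $e_{ik}$), and $\tau_{il}=(\mathtt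 b_{il},\mathtt b_{il})_L$. **Theorem.** Such elements $\mathtt b_{il}$ exist, and for any choice of them $U_q(\mathfrak g)$ is generated by $\mathtt a_{il},\mathtt b_{il}$ $((i,l)\in I^\infty)$ and $q^h$ $(h\in P^\vee)$ subject to the defining relations $$q^0=1,\quad q^hq^{h'}=q^{h+h'},\quad q^h\mathtt a_{jl}q^{-h}=q^{l\langle h,\alpha_j\rangle}\mathtt a_{jl},\quad q^h\mathtt b_{jl}q^{-h}=q^{-l\langle h,\alpha_j\rangle}\mathtt b_{jl},$$ $$\mathtt a_{il}\mathtt b_{jk}-\mathtt b_{jk}\mathtt a_{il}=\delta_{ij}\delta_{lk}\tau_{il}(K_i^l-K_i^{-l}),$$ $$\sum_{r+s=1-la_{ij}}(-1)^r\mathtt a_i^{(r)}\mathtt a_{jl}\mathtt a_i^{(s)}=\sum_{r+s=1-la_{ij}}(-1)^r\mathtt b_i^{(r)}\mathtt b_{jl}\mathtt b_i^{(s)}=0\quad(i\text{ real},\ (i,1)\ne(j,l)\in I^\infty),$$ $$\mathtt a_{ik}\mathtt a_{jl}-\mathtt a_{jl}\mathtt a_{ik}=\mathtt b_{ik}\mathtt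 b_{jl}-\mathtt b_{jl}\mathtt b_{ik}=0\quad(a_{ij}=0).$$ That is, the algebra with this presentation is isomorphic to $U_q(\mathfrak g)$ by the map that sends each generator to the element of the same name. -/

import Mathlib

open scoped TensorProduct

namespace BorcherdsBozec

noncomputable section

/-! ### The base field and Borcherds-Cartan data -/

/-- The base field `ℚ(q)`. -/
abbrev K : Type := RatFunc ℚ

/-- The indeterminate `q`. -/
abbrev q : K := RatFunc.X

/-- A Borcherds-Cartan datum over an index set `I` with weight lattice `P`:  an even symmetrizable
Borcherds-Cartan matrix `A = (a_ij)` together with symmetrizing positive integers `r_i`, simple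
roots `α_i ∈ P` and simple coroots `h_i ∈ P^∨ = Hom(P, ℤ)`. -/
structure Datum (I : Type*) (P : Type*) [AddCommGroup P] where
  /-- the Borcherds-Cartan matrix -/
  A : I → I → ℤ
  /-- the symmetrizing integers -/
  r : I → ℕ
  /-- the simple roots -/
  α : I → P
  /-- the simple coroots -/
  h : I → Module.Dual ℤ P
  diag : ∀ i, A i i = 2 ∨ (A i i ≤ 0 ∧ Even (A i i))
  offDiag : ∀ i j, i ≠ j → A i j ≤ 0
  r_pos : ∀ i, 0 < r i
  symm : ∀ i j, (r i : ℤ) * A i j = (r j : ℤ) * A j i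
  pairing : ∀ i j, h i (α j) = A i j
  linearIndependent : LinearIndependent ℤ α
  fundamental : ∀ i, ∃ Λ : P, h i Λ = 1 ∧ ∀ j, j ≠ i → h j Λ = 0

namespace Datum

variable {I : Type*} {P : Type*} [AddCommGroup P] (D : Datum I P)

/-- `i` is a real index; otherwise it is imaginary, i.e. `a_ii ≤ 0`. -/
def IsReal (i : I) : Prop := D.A i i = 2

/-- The set `I^∞ = (I^re × {1}) ∪ (I^im × ℤ_{>0})`. -/
def Iinf : Type _ := {x : I × ℕ // 0 < x.2 ∧ (D.IsReal x.1 → x.2 = 1)}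

variable {D}

/-- The index `i` of `(i,l) ∈ I^∞`. -/
def Iinf.idx (x : D.Iinf) : I := x.1.1

/-- The degree `l` of `(i,l) ∈ I^∞`. -/
def Iinf.deg (x : D.Iinf) : ℕ := x.1.2

variable (D)

/-- The element `Σ β_i α_i` of `P`, for `β` in the root lattice `⨁ ℤ α_i` (the root lattice is
modelled by its coordinates). -/
def root (β : I →₀ ℤ) : P := β.sum fun i n => n • D.α i

/-- The element `Σ β_i r_i h_i` of `P^∨`, for `β` in the root lattice: the exponent of
`K_β = ∏ K_i ^ β_i`, where `K_i = q^(r_i h_i)`. -/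
def kExp (β : I →₀ ℤ) : Module.Dual ℤ P := β.sum fun i n => (n * D.r i) • D.h i

/-- The symmetric form `(α_i, α_j) = r_i a_ij` on the root lattice. -/
def rootForm (β γ : I →₀ ℤ) : ℤ :=
  β.sum fun i m => γ.sum fun j n => m * n * (D.r i * D.A i j)

/-- `q_i = q^(r_i)`. -/
def qi (i : I) : K := q ^ (D.r i)

/-- `q_(i) = q^((α_i,α_i)/2)`; note that `a_ii` is even. -/
def qpar (i : I) : K := q ^ ((D.r i : ℤ) * (D.A i i / 2))

/-- The `q`-integer `[n]_i`. -/
def qint (i : I) (n : ℕ) : K :=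
  (D.qi i ^ n - (D.qi i)⁻¹ ^ n) / (D.qi i - (D.qi i)⁻¹)

/-- The `q`-factorial `[n]_i!`. -/
def qfact (i : I) (n : ℕ) : K := ∏ m ∈ Finset.Icc 1 n, D.qint i m

/-- The divided power `x^(n) = x^n / [n]_i!`. -/
def divPow {R : Type*} [Ring R] [Algebra K R] (i : I) (x : R) (n : ℕ) : R :=
  (D.qfact i n)⁻¹ • x ^ n

/-- `Σ_{r+s=1-l a_ij} (-1)^r x^(r) y x^(s)`, with divided powers with respect to `i`. -/
def serre {R : Type*} [Ring R] [Algebra K R] (i j : I) (l : ℕ) (x y : R) : R :=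
  ∑ p ∈ Finset.HasAntidiagonal.antidiagonal (1 - l * D.A i j).toNat,
    (-1 : K) ^ p.1 • (D.divPow i x p.1 * y * D.divPow i x p.2)

/-! ### The free algebra `F` on the `f_il`, its twisted comultiplication and the bilinear form -/

section Words

variable {X : Type*} {M : Type*} [AddCommMonoid M] [Module K M]

/-- The monomial `x_1 ⋯ x_n` in a free algebra. -/
def mon (w : List X) : FreeAlgebra K X := (w.map (FreeAlgebra.ι K)).prod

/-- The linear map on a free algebra with prescribed values on the monomials. -/
def linExt (g : List X → M) : FreeAlgebra K X →ₗ[K] M :=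
  (FreeAlgebra.basisFreeMonoid K X).constr K fun w => g w.toList

theorem basis_eq_mon (w : List X) :
    FreeAlgebra.basisFreeMonoid K X (FreeMonoid.ofList w) = mon w := by
  simp [FreeAlgebra.basisFreeMonoid, mon, FreeAlgebra.equivMonoidAlgebraFreeMonoid,
    MonoidAlgebra.lift_single, FreeMonoid.lift_apply]

theorem linExt_mon (g : List X → M) (w : List X) : linExt g (mon w) = g w := by
  rw [← basis_eq_mon, linExt, Module.Basis.constr_basis, FreeMonoid.toList_ofList]

end Words

/-- The free algebra `F = ℚ(q)⟨f_il⟩`. -/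
abbrev F : Type _ := FreeAlgebra K D.Iinf

/-- The weight of a monomial in the `f_il`, where `f_il` has weight `-l α_i`. -/
def wt (w : List D.Iinf) : I →₀ ℤ := (w.map fun x => Finsupp.single x.idx (-(x.deg : ℤ))).sum

/-- The homogeneous component of `F` of weight `β`. -/
def homog (β : I →₀ ℤ) : Submodule K D.F := Submodule.span K {x | ∃ w, D.wt w = β ∧ x = mon w}

open Classical in
/-- The generator `f_il` as an element of `F`, with `f_i0 = 1`. (The value `0` for `l > 0`,
`(i,l) ∉ I^∞` is never used.) -/
def fgen (i : I) (l : ℕ) : D.F :=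
  if hx : 0 < l ∧ (D.IsReal i → l = 1) then FreeAlgebra.ι K (⟨(i, l), hx⟩ : D.Iinf)
  else if l = 0 then 1 else 0

/-- The twisted multiplication
`(x₁ ⊗ x₂) (y₁ ⊗ y₂) = q^(-(|x₂|,|y₁|)) x₁ y₁ ⊗ x₂ y₂` on `F ⊗ F`. -/
def twistMul : (D.F ⊗[K] D.F) →ₗ[K] (D.F ⊗[K] D.F) →ₗ[K] (D.F ⊗[K] D.F) :=
  TensorProduct.lift <| linExt fun x₁ : List D.Iinf => linExt fun x₂ : List D.Iinf =>
    TensorProduct.lift <| linExt fun y₁ : List D.Iinf => linExt fun y₂ : List D.Iinf =>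
      q ^ (-D.rootForm (D.wt x₂) (D.wt y₁)) • (mon (x₁ ++ y₁) ⊗ₜ[K] mon (x₂ ++ y₂))

/-- `ϱ(f_il) = Σ_{m+n=l} q_(i)^(-mn) f_im ⊗ f_in`. -/
def rhoGen (x : D.Iinf) : D.F ⊗[K] D.F :=
  ∑ p ∈ Finset.HasAntidiagonal.antidiagonal x.deg,
    D.qpar x.idx ^ (-((p.1 * p.2 : ℕ) : ℤ)) • (D.fgen x.idx p.1 ⊗ₜ[K] D.fgen x.idx p.2)

/-- The values of `ϱ` on monomials: `ϱ` is multiplicative for the twisted multiplication. -/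
def rhoWord : List D.Iinf → D.F ⊗[K] D.F
  | [] => 1 ⊗ₜ[K] 1
  | x :: w => D.twistMul (D.rhoGen x) (rhoWord w)

/-- The comultiplication `ϱ : F → F ⊗ F`. -/
def rho : D.F →ₗ[K] D.F ⊗[K] D.F := linExt D.rhoWord

variable (ν : D.Iinf → K)

open Classical in
/-- The number `(w, f_il)_L` for a monomial `w`, with `f_i0 = 1`. It is determined by
`(1, f_il)_L = δ_{l0}` and, by the symmetry of the form and the definition of `ϱ(f_il)`, by
`(x w, f_il)_L = (x ⊗ w, ϱ(f_il))_L = Σ_{m+n=l} q_(i)^(-mn) (x, f_im)_L (w, f_in)_L`. -/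
def pairGenWord (i : I) : ℕ → List D.Iinf → K
  | l, [] => if l = 0 then 1 else 0
  | l, x :: w =>
      if x.idx = i ∧ x.deg ≤ l then
        D.qpar i ^ (-((x.deg * (l - x.deg) : ℕ) : ℤ)) * ν x * pairGenWord i (l - x.deg) w
      else 0

open Classical in
/-- The linear functional `(· , w)_L` on `F`, for a monomial `w`: `(u, 1)_L` is the constant term
of `u`, and `(u, x w)_L = (ϱ(u), x ⊗ w)_L`. -/
def pairWord : List D.Iinf → (D.F →ₗ[K] K)
  | [] => linExt fun u => if u = [] then 1 else 0
  | x :: w =>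
      LinearMap.mul' K K ∘ₗ
        TensorProduct.map (linExt (D.pairGenWord ν x.idx x.deg)) (pairWord w) ∘ₗ D.rho

/-- The bilinear form `( , )_L` on `F`: the symmetric bilinear form with `(1,1)_L = 1`,
`(f_il, f_il)_L = ν_il`, `(x, y)_L = 0` for `|x| ≠ |y|` and `(x, y z)_L = (ϱ(x), y ⊗ z)_L`. -/
def form : D.F →ₗ[K] D.F →ₗ[K] K := (linExt (D.pairWord ν)).flip

/-! ### The non-positive half: comultiplication and pairing -/

/-- The free algebra on symbols `f_il` and `q^h`. The non-positive half `Û^{≤0}` is a quotient of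
it, and its comultiplication and bilinear form are induced by those defined below; elements of
`Û^{≤0}` are represented by elements of this algebra, so that no well-definedness is needed here. -/
abbrev B : Type _ := FreeAlgebra K (D.Iinf ⊕ Module.Dual ℤ P)

/-- The symbol `q^h`. -/
def torB (h : Module.Dual ℤ P) : D.B := FreeAlgebra.ι K (Sum.inr h)

/-- The inclusion of `F`. -/
def FtoB : D.F →ₐ[K] D.B := FreeAlgebra.lift K fun x => FreeAlgebra.ι K (Sum.inl x)

/-- The comultiplication: `Δ(q^h) = q^h ⊗ q^h` and
`Δ(f_il) = Σ_{m+n=l} q_(i)^(-mn) f_im K_i^n ⊗ f_in`, where `K_i = q^(r_i h_i)`. -/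
def comul : D.B →ₐ[K] D.B ⊗[K] D.B :=
  FreeAlgebra.lift K <| Sum.elim
    (fun x => ∑ p ∈ Finset.HasAntidiagonal.antidiagonal x.deg, D.qpar x.idx ^ (-((p.1 * p.2 : ℕ) : ℤ)) •
      ((D.FtoB (D.fgen x.idx p.1) * D.torB (D.kExp (Finsupp.single x.idx (p.2 : ℤ)))) ⊗ₜ[K]
        D.FtoB (D.fgen x.idx p.2)))
    (fun h => D.torB h ⊗ₜ[K] D.torB h)

/-- Normal ordering: a word in the `f_il` and `q^h` equals `c f_{w} q^h` modulo the relations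
`q^h f_jl = q^(-l⟨h,α_j⟩) f_jl q^h`, `q^h q^h' = q^(h+h')`, `q^0 = 1`. The value is `(c, w, h)`. -/
def normalOrder : List (D.Iinf ⊕ Module.Dual ℤ P) → K × List D.Iinf × Module.Dual ℤ P
  | [] => (1, [], 0)
  | Sum.inl x :: u => ((normalOrder u).1, x :: (normalOrder u).2.1, (normalOrder u).2.2)
  | Sum.inr h :: u =>
      (q ^ (h (D.root (D.wt (normalOrder u).2.1))) * (normalOrder u).1,
        (normalOrder u).2.1, h + (normalOrder u).2.2)

open Classical in
/-- The pairing of `q^h` and `q^h'`: it is `(q^h, K_β)_L = q^(-⟨h,β⟩)`, made symmetric. It is only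
meaningful, and only used, if `q^h` or `q^h'` is one of the `K_β`; otherwise it is set to `0`. -/
def torForm (h h' : Module.Dual ℤ P) : K :=
  if H : ∃ β, h' = D.kExp β then q ^ (-(h (D.root H.choose)))
  else if H : ∃ β, h = D.kExp β then q ^ (-(h' (D.root H.choose)))
  else 0

/-- The symmetric form on the non-positive half that extends `( , )_L`:
`(x q^h, y q^h')_L = (x, y)_L (q^h, q^h')_L` for `x, y ∈ F`. -/
def formB : D.B →ₗ[K] D.B →ₗ[K] K :=
  linExt fun u => linExt fun v =>
    (D.normalOrder u).1 * (D.normalOrder v).1 *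
      D.form ν (mon (D.normalOrder u).2.1) (mon (D.normalOrder v).2.1) *
      D.torForm (D.normalOrder u).2.2 (D.normalOrder v).2.2

/-- The subalgebra generated by the `f_il` and the `K_β` (`β` in the root lattice). For `b` in this
subalgebra and arbitrary `a`, the numbers `(a, b)_L = (b, a)_L` are determined by the values
`(q^h, K_β)_L = q^(-⟨h,β⟩)`. -/
def BK : Subalgebra K D.B :=
  Algebra.adjoin K (Set.range D.FtoB ∪ Set.range fun β => D.torB (D.kExp β))

/-! ### The algebra `Û` and the quantum Borcherds-Bozec algebra -/

/-- Symbols for the generators: `pos x` for `e_il` (resp. `a_il`), `neg x` for `f_il`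
(resp. `b_il`), where `x = (i,l)`, and `tor h` for `q^h`. -/
inductive Gen : Type _
  | pos (x : D.Iinf)
  | neg (x : D.Iinf)
  | tor (h : Module.Dual ℤ P)

/-- The free algebra on the generators. -/
abbrev Free : Type _ := FreeAlgebra K D.Gen

/-- The free generator `e_il` (resp. `a_il`). -/
def fp (x : D.Iinf) : D.Free := FreeAlgebra.ι K (Gen.pos x)

/-- The free generator `f_il` (resp. `b_il`). -/
def fn (x : D.Iinf) : D.Free := FreeAlgebra.ι K (Gen.neg x)

/-- The free generator `q^h`. -/
def ft (h : Module.Dual ℤ P) : D.Free := FreeAlgebra.ι K (Gen.tor h)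

/-- The relations between the generators that do not mix positive and negative ones: torus
relations, weight relations, quantum Serre relations, and commutation for `a_ij = 0`. -/
inductive BaseRel : D.Free → D.Free → Prop
  | tor_zero : BaseRel (D.ft 0) 1
  | tor_add (h h' : Module.Dual ℤ P) : BaseRel (D.ft h * D.ft h') (D.ft (h + h'))
  | weight_pos (h : Module.Dual ℤ P) (x : D.Iinf) :
      BaseRel (D.ft h * D.fp x * D.ft (-h)) (q ^ ((x.deg : ℤ) * h (D.α x.idx)) • D.fp x)
  | weight_neg (h : Module.Dual ℤ P) (x : D.Iinf) :
      BaseRel (D.ft h * D.fn x * D.ft (-h)) (q ^ (-((x.deg : ℤ) * h (D.α x.idx))) • D.fn x)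
  | serre_pos (x y : D.Iinf) (hx : D.IsReal x.idx) (hxy : x ≠ y) :
      BaseRel (D.serre x.idx y.idx y.deg (D.fp x) (D.fp y)) 0
  | serre_neg (x y : D.Iinf) (hx : D.IsReal x.idx) (hxy : x ≠ y) :
      BaseRel (D.serre x.idx y.idx y.deg (D.fn x) (D.fn y)) 0
  | comm_pos (x y : D.Iinf) (hxy : D.A x.idx y.idx = 0) :
      BaseRel (D.fp x * D.fp y - D.fp y * D.fp x) 0
  | comm_neg (x y : D.Iinf) (hxy : D.A x.idx y.idx = 0) :
      BaseRel (D.fn x * D.fn y - D.fn y * D.fn x) 0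

/-- The algebra `Û`, generated by `e_il`, `f_il`, `q^h` with the relations `BaseRel`. -/
abbrev UHat : Type _ := RingQuot D.BaseRel

/-- The projection from the free algebra to `Û`. -/
def toUHat : D.Free →ₐ[K] D.UHat := RingQuot.mkAlgHom K D.BaseRel

/-- The map from (representatives of) `Û^{≤0}` to `Û`. -/
def piB : D.B →ₐ[K] D.UHat :=
  FreeAlgebra.lift K <| Sum.elim (fun x => D.toUHat (D.fn x)) (fun h => D.toUHat (D.ft h))

/-- The restriction to `Û^{≤0}` of the involution `ω` of `Û`: `ω(f_il) = e_il`,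
`ω(q^h) = q^(-h)`. -/
def omegaB : D.B →ₐ[K] D.UHat :=
  FreeAlgebra.lift K <| Sum.elim (fun x => D.toUHat (D.fp x)) (fun h => D.toUHat (D.ft (-h)))

/-- The linear map `(s ⊗ t) ⊗ (u ⊗ v) ↦ (s, t)_L g(u) g'(v)` to `Û`. -/
def contract (g g' : D.B →ₐ[K] D.UHat) : (D.B ⊗[K] D.B) ⊗[K] (D.B ⊗[K] D.B) →ₗ[K] D.UHat :=
  TensorProduct.lift (LinearMap.lsmul K D.UHat) ∘ₗ
    TensorProduct.map (TensorProduct.lift (D.formB ν))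
      (LinearMap.mul' K D.UHat ∘ₗ TensorProduct.map g.toLinearMap g'.toLinearMap)

/-- `Σ (a_(1), b_(2))_L ω(b_(1)) a_(2)`. -/
def drinfeldLHS (a b : D.B) : D.UHat :=
  D.contract ν D.omegaB D.piB
    ((TensorProduct.map LinearMap.id (TensorProduct.comm K D.B D.B).toLinearMap)
      (TensorProduct.tensorTensorTensorComm K D.B D.B D.B D.B
        (D.comul a ⊗ₜ[K] TensorProduct.comm K D.B D.B (D.comul b))))

/-- `Σ (a_(2), b_(1))_L a_(1) ω(b_(2))`. -/
def drinfeldRHS (a b : D.B) : D.UHat :=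
  D.contract ν D.piB D.omegaB
    (TensorProduct.tensorTensorTensorComm K D.B D.B D.B D.B
      (TensorProduct.comm K D.B D.B (D.comul a) ⊗ₜ[K] D.comul b))

/-- The relations of the Drinfeld double, for all `a, b` in the non-positive half for which the
pairings are defined. -/
inductive DrinfeldRel : D.UHat → D.UHat → Prop
  | rel (a b : D.B) (hab : a ∈ D.BK ∨ b ∈ D.BK) :
      DrinfeldRel (D.drinfeldLHS ν a b) (D.drinfeldRHS ν a b)

/-- The quantum Borcherds-Bozec algebra `U_q(𝔤)`. -/
abbrev U : Type _ := RingQuot (D.DrinfeldRel ν)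

/-- The projection from the free algebra on `e_il`, `f_il`, `q^h` to `U_q(𝔤)`. -/
def toU : D.Free →ₐ[K] D.U ν := (RingQuot.mkAlgHom K (D.DrinfeldRel ν)).comp D.toUHat

/-- The algebra map `F → U_q(𝔤)`, `f_il ↦ f_il`. -/
def negU : D.F →ₐ[K] D.U ν := FreeAlgebra.lift K fun x => D.toU ν (D.fn x)

/-- The algebra map `F → U_q(𝔤)`, `f_il ↦ e_il`, i.e. `f_il ↦ f_il` followed by `ω`. -/
def posU : D.F →ₐ[K] D.U ν := FreeAlgebra.lift K fun x => D.toU ν (D.fp x)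

/-- The image of `q^h` in `U_q(𝔤)`. -/
def torU (h : Module.Dual ℤ P) : D.U ν := D.toU ν (D.ft h)

/-! ### Primitive generators and the presentation by them -/

/-- The subalgebra `ℚ(q)⟨f_ik | k < l⟩` of `F`. -/
def lower (x : D.Iinf) : Subalgebra K D.F :=
  Algebra.adjoin K {z | ∃ y : D.Iinf, y.idx = x.idx ∧ y.deg < x.deg ∧ z = FreeAlgebra.ι K y}

/-- `b` is a family of (representatives in `F` of) primitive generators `b_il`: for real `i`,
`b_i1 = f_i1`; for imaginary `i`, `b_il` has weight `-l α_i`, differs from `f_il` by an element of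
`ℚ(q)⟨f_ik | k < l⟩`, and is orthogonal to `ℚ(q)⟨f_ik | k < l⟩`. -/
structure IsPrimitive (b : D.Iinf → D.F) : Prop where
  real : ∀ x, D.IsReal x.idx → b x = FreeAlgebra.ι K x
  weight : ∀ x, ¬ D.IsReal x.idx → b x ∈ D.homog (Finsupp.single x.idx (-(x.deg : ℤ)))
  leading : ∀ x, ¬ D.IsReal x.idx → b x - FreeAlgebra.ι K x ∈ D.lower x
  orthogonal : ∀ x, ¬ D.IsReal x.idx → ∀ z ∈ D.lower x, D.form ν (b x) z = 0

open Classical in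
/-- The relations of the presentation by primitive generators: `BaseRel` for `a_il`, `b_il`, `q^h`
and `a_il b_jk - b_jk a_il = δ_ij δ_lk τ_il (K_i^l - K_i^(-l))`. -/
inductive PrimRel (τ : D.Iinf → K) : D.Free → D.Free → Prop
  | base (u v : D.Free) (huv : D.BaseRel u v) : PrimRel τ u v
  | bracket (x y : D.Iinf) :
      PrimRel τ (D.fp x * D.fn y - D.fn y * D.fp x)
        (if x = y then
          τ x • (D.ft (D.kExp (Finsupp.single x.idx (x.deg : ℤ))) -
            D.ft (D.kExp (Finsupp.single x.idx (-(x.deg : ℤ)))))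
        else 0)

/-- The algebra presented by the generators `a_il`, `b_il`, `q^h` and the relations `PrimRel`. -/
abbrev PrimAlg (τ : D.Iinf → K) : Type _ := RingQuot (D.PrimRel τ)

/-- The projection from the free algebra on `a_il`, `b_il`, `q^h` to the presented algebra. -/
def toPrimAlg (τ : D.Iinf → K) : D.Free →ₐ[K] D.PrimAlg τ := RingQuot.mkAlgHom K (D.PrimRel τ)

end Datum

/-- `c ∈ 1 + q ℤ_{≥0}[[q]]`: the Laurent expansion of `c` at `q = 0` is a power series with
nonnegative integer coefficients and constant term `1`. -/
def OnePlusNat (c : K) : Prop :=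
  ∃ φ : PowerSeries ℕ, PowerSeries.constantCoeff φ = 1 ∧
    (c : LaurentSeries ℚ) = ((φ.map (Nat.castRingHom ℚ) : PowerSeries ℚ) : LaurentSeries ℚ)

end

end BorcherdsBozec

/-!
# Presentation of a quantum Borcherds-Bozec algebra by primitive generators

**Bialgebras.** For a torus `T` acting on the root lattice let `H(T)` be the semidirect product of
the free algebra `F` on the `f_il` with the group algebra of `T`. Normally ordered monomials are a
basis of it, and it is a bialgebra whose comultiplication restricts to the twisted comultiplication
`ϱ` of `F`. Two tori matter: `P^∨`, whose `H` covers the non-positive half of `Û`, and the root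
lattice, whose `H` covers the subalgebra generated by the `f_il` and `K_β`. The pairing `( , )_L` is
an algebra homomorphism `Torus.pair` from the second `H` to the convolution algebra of functionals
on the first. `Torus.pair_mul` gives multiplicativity in the other argument as well; from this
follow the symmetry of the form on `F` (`form_comm`) and the identification with the pairing defined
by normal ordering (`formB_eq_pair_and`).

**The Drinfeld relations.** Both sides of the relations of the Drinfeld double are, for fixed `b`,
elements of a convolution algebra of the form `γ(b) * ι` and `ι * γ'(b)`, with algebra maps `γ`,
`γ'`; hence the relations for all `b` follow from those for generators. If `F` has generators `p`
that are primitive, `Δ(p) = p ⊗ 1 + K ⊗ p`, then `a ↦ Σ (a_(1), p)_L a_(2)` and `a ↦ Σ a_(1) (a_(2),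
p)_L` are skew derivations, so it suffices to check `a = p'` as well
(`DoubleRel.doubleL_eq_doubleR`). There the relation is the bracket `[a_il, b_jk] = (b_jk, b_il)_L
(K_i^l - K_i^{-l})` (`Torus.bracket_of_double`). The involution exchanges the two sides of the
relations and covers the case in which `a`, rather than `b`, lies in the smaller subalgebra
(`drinfeld_eq_of_double`).

**Existence of primitive generators** (`exists_canonical`). Real `f_i` are primitive. If `a_ii < 0`,
the words in the `f_il` are orthonormal at `q = 0` (`hasValue_form`); hence the form is
nondegenerate on them, `f_il` can be made orthogonal to all other words of its weight, and by
nondegeneracy on `F ⊗ F` the result is primitive. If `a_ii = 0`, then `q_(i) = 1` and the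
noncommutative power sums `Ψ_l`, defined by `l f_il = Σ Ψ_k f_{i,l-k}`, are primitive, and `(Ψ_l,
f_il)_L` takes the value `1` at `q = 0`.

**Uniqueness** (`map_primitive_eq`). Any elements `b` as in the theorem differ from these generators
by elements of the radical of the form (`form_sub_eq_zero`). For `a_ii < 0` the radical is zero. For
`a_ii = 0` it may not be, but the relations `f_ik f_il = f_il f_ik` make the algebra of the `f_il` a
quotient of a polynomial ring in the primitive generators, where the skew derivations become nonzero
multiples of the partial derivatives; since the radical is stable under them, its image is zero
(`map_eq_zero_of_radical`). So in all algebras in question any choice `b` has the same image as `p`.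

**Change of generators.** The passage from `f` to `b` is triangular, hence invertible
(`Triangular.exists_inverse`), and it preserves the Serre relations: with `m = -l a_ij` such a
relation says that a product of `m + 1` commuting twisted commutators with `f_i` kills `f_jl`, and
by the Leibniz rule products of elements with this property have it for the sum of the `m`
(`serreIter_mul_eq_zero`, `HalfRel.change`). Substitution of `b` and of the inverse change thus
defines homomorphisms in both directions between the presented algebra and `U_q(𝔤)` (`exists_toU`,
`exists_ofU`), which are inverse to each other.
-/

namespace BorcherdsBozec

noncomputable section

namespace Datum

/-! ### Quantum Serre relations as products of commuting operators -/

section Serre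

variable {I : Type*} {P : Type*} [AddCommGroup P] (D : Datum I P)

theorem q_ne_zero : q ≠ 0 := RatFunc.X_ne_zero

theorem q_pow_ne_one {n : ℕ} (hn : 0 < n) : q ^ n ≠ 1 := by
  intro h
  have h1 : algebraMap (Polynomial ℚ) K (Polynomial.X ^ n) = algebraMap (Polynomial ℚ) K 1 := by
    simpa [RatFunc.algebraMap_X] using h
  have h2 := RatFunc.algebraMap_injective ℚ h1
  have h3 := congrArg Polynomial.natDegree h2
  simp at h3
  omega

theorem qi_ne_zero (i : I) : D.qi i ≠ 0 := pow_ne_zero _ q_ne_zero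

theorem qi_pow_sub_ne_zero (i : I) {n : ℕ} (hn : 0 < n) : D.qi i ^ n - (D.qi i)⁻¹ ^ n ≠ 0 := by
  intro h
  have h0 := pow_ne_zero n (D.qi_ne_zero i)
  rw [inv_pow, sub_eq_zero] at h
  replace h : D.qi i ^ n * D.qi i ^ n = 1 := by
    nth_rewrite 2 [h]; exact mul_inv_cancel₀ h0
  rw [← pow_add, qi, ← pow_mul] at h
  exact q_pow_ne_one (Nat.mul_pos (D.r_pos i) (by omega)) h

theorem qint_ne_zero (i : I) {n : ℕ} (hn : 0 < n) : D.qint i n ≠ 0 :=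
  div_ne_zero (D.qi_pow_sub_ne_zero i hn) (by simpa using D.qi_pow_sub_ne_zero i one_pos)

theorem qint_zero (i : I) : D.qint i 0 = 0 := by simp [qint]

theorem qfact_zero (i : I) : D.qfact i 0 = 1 := by simp [qfact]

theorem qfact_succ (i : I) (n : ℕ) : D.qfact i (n + 1) = D.qint i (n + 1) * D.qfact i n := by
  rw [qfact, Finset.prod_Icc_succ_top (by omega), mul_comm, qfact]

theorem qfact_ne_zero (i : I) (n : ℕ) : D.qfact i n ≠ 0 :=
  Finset.prod_ne_zero_iff.2 fun _ hm => D.qint_ne_zero i (by simp at hm; omega)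

variable {R : Type*} [Ring R] [Algebra K R]

theorem mul_divPow (i : I) (x : R) (n : ℕ) :
    x * D.divPow i x n = D.qint i (n + 1) • D.divPow i x (n + 1) := by
  have := D.qint_ne_zero i (Nat.succ_pos n)
  rw [divPow, divPow, smul_smul, qfact_succ, mul_inv, ← mul_assoc, mul_inv_cancel₀ this, one_mul,
    mul_smul_comm, pow_succ']

theorem divPow_mul (i : I) (x : R) (n : ℕ) :
    D.divPow i x n * x = D.qint i (n + 1) • D.divPow i x (n + 1) := by
  have := D.qint_ne_zero i (Nat.succ_pos n)
  rw [divPow, divPow, smul_smul, qfact_succ, mul_inv, ← mul_assoc, mul_inv_cancel₀ this, one_mul,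
    smul_mul_assoc, pow_succ]

/-- The iterated twisted commutator `∏_{k < n} (L_x - t ^ (2k - m) R_x)` applied to `y`, where `L_x`
and `R_x` are left and right multiplication by `x`. -/
def serreIter (t : K) (m : ℤ) (x y : R) : ℕ → R
  | 0 => y
  | n + 1 => x * serreIter t m x y n - t ^ (2 * (n : ℤ) - m) • (serreIter t m x y n * x)

/-- The coefficient of `x^(r) y x^(s)`, `r + s = n`, in the iterated twisted commutator. -/
def serreCoeff (t : K) (m n s : ℤ) : K := (-1) ^ s * t ^ (s * (n - 1 - m))

/-- The recursion of the `q`-binomial coefficients, for the coefficients of the iterated twisted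
commutator. -/
theorem serreCoeff_rec (i : I) (m : ℤ) {n r s : ℕ} (h : r + s = n + 1) :
    serreCoeff (D.qi i) m n s * D.qint i r -
      D.qi i ^ (2 * (n : ℤ) - m) * (serreCoeff (D.qi i) m n (s - 1) * D.qint i s) =
      D.qint i (n + 1) * serreCoeff (D.qi i) m (n + 1) s := by
  have ht := D.qi_ne_zero i
  have hd : D.qi i - (D.qi i)⁻¹ ≠ 0 := by simpa using D.qi_pow_sub_ne_zero i one_pos
  have hr : (r : ℤ) = n + 1 - s := by omega
  rw [← h]
  simp only [serreCoeff, qint]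
  set t := D.qi i
  have e1 : t ^ ((s : ℤ) * (n - 1 - m)) = t ^ ((s : ℤ) * (n - m)) * (t⁻¹) ^ s := by
    rw [inv_pow, ← zpow_natCast t s, ← zpow_neg, ← zpow_add₀ ht]; congr 1; ring
  have e2 : t ^ (2 * (n : ℤ) - m) * t ^ (((s : ℤ) - 1) * (n - 1 - m)) =
      t ^ ((s : ℤ) * (n - m)) * t ^ r := by
    rw [← zpow_natCast t r, ← zpow_add₀ ht, ← zpow_add₀ ht, hr]; congr 1; ring
  have e3 : ((-1 : K)) ^ ((s : ℤ) - 1) = - (-1) ^ (s : ℤ) := by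
    rw [zpow_sub_one₀ (by norm_num)]; norm_num
  have e4 : t ^ ((s : ℤ) * ((n : ℤ) + 1 - 1 - m)) = t ^ ((s : ℤ) * (n - m)) := by
    congr 1; ring
  rw [e1, e3, e4, mul_div_assoc', mul_div_assoc']
  rw [show t ^ (2 * (n : ℤ) - m) * (-(-1) ^ (s : ℤ) * t ^ (((s : ℤ) - 1) * (n - 1 - m)) *
      (t ^ s - t⁻¹ ^ s) / (t - t⁻¹)) = (t ^ (2 * (n : ℤ) - m) * t ^ (((s : ℤ) - 1) * (n - 1 - m))) *
      (-(-1) ^ (s : ℤ)  * (t ^ s - t⁻¹ ^ s) / (t - t⁻¹)) by ring, e2]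
  have e5 : t ^ s * t⁻¹ ^ s = 1 := by rw [← mul_pow, mul_inv_cancel₀ ht, one_pow]
  rw [pow_add, pow_add]
  generalize t ^ ((s : ℤ) * (n - m)) = u
  generalize (-1 : K) ^ (s : ℤ) = v
  field_simp
  ring

/-- The `q`-binomial theorem for the commuting operators `L_x` and `R_x`. -/
theorem serreIter_eq_sum (i : I) (m : ℤ) (x y : R) (n : ℕ) :
    serreIter (D.qi i) m x y n = D.qfact i n • ∑ p ∈ Finset.HasAntidiagonal.antidiagonal n,
      serreCoeff (D.qi i) m n p.2 • (D.divPow i x p.1 * y * D.divPow i x p.2) := by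
  induction n with
  | zero => simp [serreIter, serreCoeff, divPow, qfact_zero]
  | succ n ih =>
    rw [serreIter, ih, mul_smul_comm, smul_mul_assoc, smul_comm _ (D.qfact i n), ← smul_sub,
      qfact_succ, mul_comm (D.qint i (n + 1)), mul_smul]
    congr 1
    rw [Finset.mul_sum, Finset.sum_mul]
    have h1 : ∑ p ∈ Finset.HasAntidiagonal.antidiagonal n,
        x * serreCoeff (D.qi i) m n p.2 • (D.divPow i x p.1 * y * D.divPow i x p.2) =
        ∑ p ∈ Finset.HasAntidiagonal.antidiagonal (n + 1),
          (serreCoeff (D.qi i) m n p.2 * D.qint i p.1) •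
            (D.divPow i x p.1 * y * D.divPow i x p.2) := by
      rw [Finset.Nat.sum_antidiagonal_succ]
      simp only [qint_zero, mul_zero, zero_smul, zero_add]
      refine Finset.sum_congr rfl fun p _ => ?_
      rw [mul_smul_comm, ← mul_assoc, ← mul_assoc, mul_divPow, smul_mul_assoc, smul_mul_assoc,
        smul_smul]
    have h2 : ∑ p ∈ Finset.HasAntidiagonal.antidiagonal n,
        serreCoeff (D.qi i) m n p.2 • (D.divPow i x p.1 * y * D.divPow i x p.2) * x =
        ∑ p ∈ Finset.HasAntidiagonal.antidiagonal (n + 1),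
          (serreCoeff (D.qi i) m n (p.2 - 1) * D.qint i p.2) •
            (D.divPow i x p.1 * y * D.divPow i x p.2) := by
      rw [Finset.Nat.sum_antidiagonal_succ']
      simp only [qint_zero, mul_zero, zero_smul, zero_add]
      refine Finset.sum_congr rfl fun p _ => ?_
      rw [smul_mul_assoc, mul_assoc, divPow_mul, mul_smul_comm, smul_smul]
      simp
    rw [h1, h2, Finset.smul_sum, Finset.smul_sum, ← Finset.sum_sub_distrib]
    refine Finset.sum_congr rfl fun p hp => ?_
    rw [smul_smul, smul_smul, ← sub_smul,
      D.serreCoeff_rec i m (Finset.HasAntidiagonal.mem_antidiagonal.1 hp)]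
    push_cast
    rfl

/-- With `m = -l a_ij`, the quantum Serre relation says that the `m + 1` commuting operators
`L_x - t ^ (2k - m) R_x`, `0 ≤ k ≤ m`, have product zero on `y`. -/
theorem serre_eq_zero_iff (i j : I) (l m : ℕ) (hm : (m : ℤ) = -(l * D.A i j)) (x y : R) :
    D.serre i j l x y = 0 ↔ serreIter (D.qi i) m x y (m + 1) = 0 := by
  have h1 : (1 - l * D.A i j).toNat = m + 1 := by omega
  have h2 : D.serre i j l x y = (-1 : K) ^ (m + 1) •
      ∑ p ∈ Finset.HasAntidiagonal.antidiagonal (m + 1),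
      serreCoeff (D.qi i) m (m + 1 : ℕ) p.2 • (D.divPow i x p.1 * y * D.divPow i x p.2) := by
    rw [serre, h1, Finset.smul_sum]
    refine Finset.sum_congr rfl fun p hp => ?_
    rw [smul_smul]
    congr 1
    have : p.1 + p.2 = m + 1 := Finset.HasAntidiagonal.mem_antidiagonal.1 hp
    simp only [serreCoeff, ← this, pow_add, zpow_natCast]
    have h3 : ((p.1 + p.2 : ℕ) : ℤ) - 1 - m = 0 := by omega
    rw [h3, mul_zero, zpow_zero, mul_one, mul_assoc, ← mul_pow]
    norm_num
  rw [h2, serreIter_eq_sum, smul_eq_zero_iff_right (pow_ne_zero _ (by norm_num)),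
    smul_eq_zero_iff_right (D.qfact_ne_zero i _)]

theorem serreIter_add (t : K) (m : ℤ) (x y z : R) (n : ℕ) :
    serreIter t m x (y + z) n = serreIter t m x y n + serreIter t m x z n := by
  induction n with
  | zero => rfl
  | succ n ih => simp only [serreIter, ih, mul_add, add_mul, smul_add]; abel

theorem serreIter_smul (t : K) (m : ℤ) (c : K) (x y : R) (n : ℕ) :
    serreIter t m x (c • y) n = c • serreIter t m x y n := by
  induction n with
  | zero => rfl
  | succ n ih =>
    simp only [serreIter, ih, mul_smul_comm, smul_mul_assoc, smul_sub, smul_comm c]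

theorem serreIter_zero (t : K) (m : ℤ) (x : R) (n : ℕ) : serreIter t m x 0 n = 0 := by
  simpa using serreIter_smul t m 0 x 0 n

theorem serreIter_eq_zero_of_le {t : K} {m : ℤ} {x y : R} {n n' : ℕ} (h : n ≤ n')
    (h0 : serreIter t m x y n = 0) : serreIter t m x y n' = 0 := by
  induction n', h using Nat.le_induction with
  | base => exact h0
  | succ k _ ih => simp [serreIter, ih]

/-- The `n`-th iterated twisted commutator of `x` with a product is a combination of products of
iterated twisted commutators. This follows from the Leibniz rule
`[x, y z]_{ab} = [x, y]_a z + a y [x, z]_b`, where `[x, y]_a = x y - a y x`. -/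
theorem serreIter_mul_mem {t : K} (ht : t ≠ 0) (m m' : ℤ) (x y z : R) (n : ℕ) :
    serreIter t (m + m') x (y * z) n ∈ Submodule.span K
      {u | ∃ a b, a + b = n ∧ u = serreIter t m x y a * serreIter t m' x z b} := by
  induction n with
  | zero => exact Submodule.subset_span ⟨0, 0, rfl, rfl⟩
  | succ n ih =>
    rw [serreIter]
    revert ih
    generalize serreIter t (m + m') x (y * z) n = v
    intro ih
    induction ih using Submodule.span_induction with
    | zero => simp
    | add u v _ _ hu hv =>
      rw [mul_add, add_mul, smul_add, add_sub_add_comm]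
      exact Submodule.add_mem _ hu hv
    | smul c u _ hu =>
      rw [mul_smul_comm, smul_mul_assoc, smul_comm, ← smul_sub]
      exact Submodule.smul_mem _ _ hu
    | mem u hu =>
      obtain ⟨a, b, hab, rfl⟩ := hu
      -- Leibniz rule; the twists match because `2n - (m + m') = (2a - m) + (2b - m')`
      have key : x * (serreIter t m x y a * serreIter t m' x z b) -
          t ^ (2 * (n : ℤ) - (m + m')) • (serreIter t m x y a * serreIter t m' x z b * x) =
          serreIter t m x y (a + 1) * serreIter t m' x z b +
          t ^ (2 * (a : ℤ) - m) • (serreIter t m x y a * serreIter t m' x z (b + 1)) := by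
        have e : t ^ (2 * (n : ℤ) - (m + m')) =
            t ^ (2 * (a : ℤ) - m) * t ^ (2 * (b : ℤ) - m') := by
          rw [← zpow_add₀ ht, ← hab]; congr 1; push_cast; ring
        simp only [serreIter, e, sub_mul, mul_sub, smul_sub, smul_mul_assoc, mul_smul_comm,
          mul_smul, mul_assoc]
        abel
      rw [key]
      exact Submodule.add_mem _ (Submodule.subset_span ⟨a + 1, b, by omega, rfl⟩)
        (Submodule.smul_mem _ _ (Submodule.subset_span ⟨a, b + 1, by omega, rfl⟩))

/-- The solutions `y` of the Serre relations of order `m + 1` and `z` of order `m' + 1` have a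
product that solves the Serre relation of order `m + m' + 1`. -/
theorem serreIter_mul_eq_zero {t : K} (ht : t ≠ 0) {m m' : ℕ} {x y z : R}
    (hy : serreIter t m x y (m + 1) = 0) (hz : serreIter t m' x z (m' + 1) = 0) :
    serreIter t ((m + m' : ℕ) : ℤ) x (y * z) (m + m' + 1) = 0 := by
  have h := serreIter_mul_mem ht m m' x y z (m + m' + 1)
  rw [← Submodule.mem_bot K]
  push_cast
  refine Submodule.span_le.2 ?_ h
  rintro _ ⟨a, b, hab, rfl⟩
  -- as `a + b = m + m' + 1`, either `a > m` or `b > m'`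
  rcases Nat.lt_or_ge m a with ha | ha
  · simp [serreIter_eq_zero_of_le ha hy]
  · simp [serreIter_eq_zero_of_le (show m' + 1 ≤ b by omega) hz]

end Serre

/-! ### Weights of words and change of generators -/

section Words

variable {I : Type*} {P : Type*} [AddCommGroup P] (D : Datum I P)

theorem mon_nil {X : Type*} : mon ([] : List X) = 1 := rfl

theorem mon_cons {X : Type*} (x : X) (w : List X) : mon (x :: w) = FreeAlgebra.ι K x * mon w := by
  simp [mon]

theorem mon_append {X : Type*} (u w : List X) : mon (u ++ w) = mon u * mon w := by
  simp [mon]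

theorem mon_singleton {X : Type*} (x : X) : mon [x] = FreeAlgebra.ι K x := by simp [mon]

/-- A linear map out of a free algebra is determined by its values on monomials. -/
theorem linearMap_ext_mon {X M : Type*} [AddCommMonoid M] [Module K M]
    {f g : FreeAlgebra K X →ₗ[K] M} (h : ∀ w, f (mon w) = g (mon w)) : f = g := by
  refine (FreeAlgebra.basisFreeMonoid K X).ext fun w => ?_
  rw [← FreeMonoid.ofList_toList w, basis_eq_mon]
  exact h _

theorem mon_induction {X : Type*} {p : FreeAlgebra K X → Prop} (h0 : p 0)
    (hadd : ∀ a b, p a → p b → p (a + b)) (hsmul : ∀ (c : K) a, p a → p (c • a))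
    (hmon : ∀ w, p (mon w)) (a : FreeAlgebra K X) : p a := by
  have : a ∈ Submodule.span K (Set.range (FreeAlgebra.basisFreeMonoid K X)) := by
    rw [Module.Basis.span_eq]; trivial
  induction this using Submodule.span_induction with
  | zero => exact h0
  | add a b _ _ ha hb => exact hadd a b ha hb
  | smul c a _ ha => exact hsmul c a ha
  | mem a ha =>
    obtain ⟨w, rfl⟩ := ha
    rw [← FreeMonoid.ofList_toList w, basis_eq_mon]
    exact hmon _

theorem lift_mon {X R : Type*} [Ring R] [Algebra K R] (n : X → R) (w : List X) :
    FreeAlgebra.lift K n (mon w) = (w.map n).prod := by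
  simp [mon, map_list_prod, Function.comp_def]

theorem wt_nil : D.wt [] = 0 := rfl

theorem wt_cons (x : D.Iinf) (w : List D.Iinf) :
    D.wt (x :: w) = Finsupp.single x.idx (-(x.deg : ℤ)) + D.wt w := by simp [wt]

theorem wt_append (u w : List D.Iinf) : D.wt (u ++ w) = D.wt u + D.wt w := by simp [wt]

theorem Iinf.deg_pos {D : Datum I P} (x : D.Iinf) : 0 < x.deg := x.2.1

theorem Iinf.deg_of_real {D : Datum I P} (x : D.Iinf) (h : D.IsReal x.idx) : x.deg = 1 := x.2.2 h

theorem Iinf.ext {D : Datum I P} {x y : D.Iinf} (h : x.idx = y.idx) (h' : x.deg = y.deg) :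
    x = y := Subtype.ext (Prod.ext h h')

/-- The total degree of a word. -/
def wdeg {D : Datum I P} (w : List D.Iinf) : ℕ := (w.map Iinf.deg).sum

theorem wdeg_cons {D : Datum I P} (x : D.Iinf) (w : List D.Iinf) :
    wdeg (x :: w) = x.deg + wdeg w := by simp [wdeg]

theorem wt_apply_nonpos (w : List D.Iinf) (j : I) : D.wt w j ≤ 0 := by
  classical
  induction w with
  | nil => simp [wt_nil]
  | cons x w ih =>
    rw [wt_cons, Finsupp.add_apply, Finsupp.single_apply]
    split_ifs <;> omega

theorem wt_apply_neg {w : List D.Iinf} {x : D.Iinf} (hx : x ∈ w) : D.wt w x.idx < 0 := by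
  classical
  induction w with
  | nil => simp at hx
  | cons y w ih =>
    rw [wt_cons, Finsupp.add_apply, Finsupp.single_apply]
    rcases List.mem_cons.1 hx with rfl | h
    · have := D.wt_apply_nonpos w x.idx
      have := x.deg_pos
      simp; omega
    · have := ih h
      split_ifs <;> omega

theorem wt_eq_single {w : List D.Iinf} {i : I} (h : ∀ x ∈ w, x.idx = i) :
    D.wt w = Finsupp.single i (-(wdeg w : ℤ)) := by
  induction w with
  | nil => simp [wt_nil, wdeg]
  | cons x w ih =>
    rw [wt_cons, wdeg_cons, ih fun y hy => h y (List.mem_cons_of_mem _ hy),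
      h x List.mem_cons_self, ← Finsupp.single_add]
    congr 1; push_cast; ring

theorem idx_of_wt_eq_single {w : List D.Iinf} {i : I} {c : ℤ} (h : D.wt w = Finsupp.single i c) :
    ∀ x ∈ w, x.idx = i := by
  classical
  intro x hx
  by_contra hne
  have := D.wt_apply_neg hx
  rw [h, Finsupp.single_apply, if_neg (Ne.symm hne)] at this
  exact lt_irrefl _ this

theorem wdeg_of_wt_eq_single {w : List D.Iinf} {i : I} {l : ℕ}
    (h : D.wt w = Finsupp.single i (-(l : ℤ))) : wdeg w = l := by
  have := D.wt_eq_single (D.idx_of_wt_eq_single h)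
  rw [h] at this
  have := Finsupp.single_injective i this
  omega

variable {R : Type*} [Ring R] [Algebra K R]

/-- The quantum Serre relations and the commutation relations for one half of the generators. -/
structure HalfRel (n : D.Iinf → R) : Prop where
  serre : ∀ x y : D.Iinf, D.IsReal x.idx → x ≠ y →
    D.serre x.idx y.idx y.deg (n x) (n y) = 0
  comm : ∀ x y : D.Iinf, D.A x.idx y.idx = 0 → n x * n y = n y * n x

variable {D}

/-- The Serre relation between `x` and the letters `f_jl` passes to words in these letters, with `l`
replaced by the total degree of the word. -/
theorem HalfRel.serreIter_word {n : D.Iinf → R} (hn : D.HalfRel n) {x : D.Iinf}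
    (hx : D.IsReal x.idx) {j : I} (hj : x.idx ≠ j) {w : List D.Iinf} (hw : ∀ y ∈ w, y.idx = j)
    {m : ℕ} (hm : (m : ℤ) = -(wdeg w * D.A x.idx j)) :
    serreIter (D.qi x.idx) m (n x) (w.map n).prod (m + 1) = 0 := by
  induction w generalizing m with
  | nil =>
    have : m = 0 := by simpa [wdeg] using hm
    subst this
    simp [serreIter]
  | cons y w ih =>
    have hyj : y.idx = j := hw y List.mem_cons_self
    have hA := D.offDiag _ _ hj
    obtain ⟨c, hc⟩ := Int.eq_ofNat_of_zero_le (neg_nonneg.2 hA)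
    have hc' : D.A x.idx j = -c := by omega
    have hm' : m = y.deg * c + wdeg w * c := by
      rw [wdeg_cons, hc'] at hm
      have : (m : ℤ) = ((y.deg * c + wdeg w * c : ℕ) : ℤ) := by rw [hm]; push_cast; ring
      exact_mod_cast this
    have h1 := (D.serre_eq_zero_iff x.idx y.idx y.deg (y.deg * c)
      (by rw [hyj, hc']; push_cast; ring) (n x) (n y)).1
      (hn.serre x y hx (fun h => hj (by rw [h, hyj])))
    have h2 := ih (fun z hz => hw z (List.mem_cons_of_mem _ hz)) (m := wdeg w * c)
      (by rw [hc']; push_cast; ring)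
    rw [hm', List.map_cons, List.prod_cons]
    exact serreIter_mul_eq_zero (D.qi_ne_zero _) h1 h2

/-- To prove a linear property of the homogeneous elements of weight `β` it suffices to prove it for
the monomials. -/
theorem homog_induction {β : I →₀ ℤ} {p : D.F → Prop} (h0 : p 0)
    (hadd : ∀ a b, p a → p b → p (a + b)) (hsmul : ∀ (c : K) a, p a → p (c • a))
    (hmon : ∀ w, D.wt w = β → p (mon w)) {a : D.F} (ha : a ∈ D.homog β) : p a := by
  induction ha using Submodule.span_induction with
  | zero => exact h0
  | add a b _ _ ha hb => exact hadd a b ha hb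
  | smul c a _ ha => exact hsmul c a ha
  | mem a ha => obtain ⟨w, hw, rfl⟩ := ha; exact hmon w hw

theorem mon_mem_homog {β : I →₀ ℤ} {w : List D.Iinf} (h : D.wt w = β) : mon w ∈ D.homog β :=
  Submodule.subset_span ⟨w, h, rfl⟩

/-- A homogeneous change of generators which fixes the real ones preserves the Serre and
commutation relations. -/
theorem HalfRel.change {n : D.Iinf → R} (hn : D.HalfRel n) {g : D.Iinf → D.F}
    (hreal : ∀ x, D.IsReal x.idx → g x = FreeAlgebra.ι K x)
    (hg : ∀ x, g x ∈ D.homog (Finsupp.single x.idx (-(x.deg : ℤ)))) :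
    D.HalfRel fun x => FreeAlgebra.lift K n (g x) where
  serre x y hx hxy := by
    have hne : x.idx ≠ y.idx := fun h => hxy
      (Iinf.ext h (by rw [x.deg_of_real hx, y.deg_of_real (h ▸ hx)]))
    obtain ⟨m, hm⟩ := Int.eq_ofNat_of_zero_le
      (show 0 ≤ -(y.deg * D.A x.idx y.idx) by
        have := mul_nonneg (Int.natCast_nonneg y.deg) (neg_nonneg.2 (D.offDiag _ _ hne))
        linarith)
    rw [D.serre_eq_zero_iff _ _ _ m hm.symm, hreal x hx, FreeAlgebra.lift_ι_apply]
    refine homog_induction (p := fun z => serreIter (D.qi x.idx) m (n x)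
      (FreeAlgebra.lift K n z) (m + 1) = 0) ?_ ?_ ?_ ?_ (hg y)
    · simp [serreIter_zero]
    · intro a b ha hb; simp [serreIter_add, ha, hb]
    · intro c a ha; simp [serreIter_smul, ha]
    · intro w hw
      rw [lift_mon]
      -- a word of weight `-l α_j` has letters with index `j` and total degree `l`
      exact hn.serreIter_word hx hne (D.idx_of_wt_eq_single hw)
        (by rw [D.wdeg_of_wt_eq_single hw, hm])
  comm x y hxy := by
    refine homog_induction (p := fun z => Commute (FreeAlgebra.lift K n z)
      (FreeAlgebra.lift K n (g y))) ?_ ?_ ?_ ?_ (hg x)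
    · simp
    · intro a b ha hb; rw [map_add]; exact ha.add_left hb
    · intro c a ha; rw [map_smul]; exact ha.smul_left c
    · intro u hu
      refine homog_induction (p := fun z => Commute (FreeAlgebra.lift K n (mon u))
        (FreeAlgebra.lift K n z)) ?_ ?_ ?_ ?_ (hg y)
      · simp
      · intro a b ha hb; rw [map_add]; exact ha.add_right hb
      · intro c a ha; rw [map_smul]; exact ha.smul_right c
      · intro w hw
        rw [lift_mon, lift_mon]
        refine Commute.list_prod_left _ _ fun a ha => Commute.list_prod_right _ _ fun b hb => ?_
        obtain ⟨a, ha', rfl⟩ := List.mem_map.1 ha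
        obtain ⟨b, hb', rfl⟩ := List.mem_map.1 hb
        refine hn.comm a b ?_
        rw [D.idx_of_wt_eq_single hu a ha', D.idx_of_wt_eq_single hw b hb', hxy]

end Words

/-! ### The bialgebra generated by the `f_il` and a torus -/

section Torus

variable {I : Type*} {P : Type*} [AddCommGroup P] (D : Datum I P)

theorem rootForm_add_left (β β' γ : I →₀ ℤ) :
    D.rootForm (β + β') γ = D.rootForm β γ + D.rootForm β' γ := by
  classical
  rw [rootForm, Finsupp.sum_add_index']
  · rfl
  · intro i; simp [Finsupp.sum]
  · intro i m m'; simp only [Finsupp.sum, ← Finset.sum_add_distrib]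
    exact Finset.sum_congr rfl fun j _ => by ring

theorem rootForm_add_right (β γ γ' : I →₀ ℤ) :
    D.rootForm β (γ + γ') = D.rootForm β γ + D.rootForm β γ' := by
  classical
  simp only [rootForm, Finsupp.sum, ← Finset.sum_add_distrib]
  refine Finset.sum_congr rfl fun i _ => ?_
  exact Finsupp.sum_add_index' (h := fun j n => β i * n * (D.r i * D.A i j)) (by simp)
    (by intro j n n'; ring)

theorem rootForm_single (i j : I) (m n : ℤ) :
    D.rootForm (Finsupp.single i m) (Finsupp.single j n) = m * n * (D.r i * D.A i j) := by
  simp [rootForm]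

/-- The symmetric form on the root lattice, as a biadditive map. -/
def rootFormHom : (I →₀ ℤ) →+ (I →₀ ℤ) →+ ℤ :=
  AddMonoidHom.mk' (fun β => AddMonoidHom.mk' (D.rootForm β) (D.rootForm_add_right β))
    fun β β' => AddMonoidHom.ext fun γ => D.rootForm_add_left β β' γ

theorem rootFormHom_apply (β γ : I →₀ ℤ) : D.rootFormHom β γ = D.rootForm β γ := rfl

theorem rootForm_comm (β γ : I →₀ ℤ) : D.rootForm β γ = D.rootForm γ β := by
  suffices D.rootFormHom = D.rootFormHom.flip from DFunLike.congr_fun (DFunLike.congr_fun this β) γ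
  ext i j
  simp [rootFormHom_apply, rootForm_single, D.symm i j]

/-- The simple root sum `Σ β_i α_i` as an additive map. -/
def rootHom : (I →₀ ℤ) →+ P := Finsupp.liftAddHom fun i => (zmultiplesHom P) (D.α i)

theorem rootHom_apply (β : I →₀ ℤ) : D.rootHom β = D.root β := rfl

/-- The coroot sum `Σ β_i r_i h_i` as an additive map. -/
def kExpHom : (I →₀ ℤ) →+ Module.Dual ℤ P :=
  Finsupp.liftAddHom fun i => (zmultiplesHom (Module.Dual ℤ P)) ((D.r i : ℤ) • D.h i)

theorem kExpHom_apply (β : I →₀ ℤ) : D.kExpHom β = D.kExp β := by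
  rw [kExpHom, kExp, Finsupp.liftAddHom_apply]
  exact Finset.sum_congr rfl fun i _ => by simp [mul_smul]

theorem root_single (i : I) (n : ℤ) : D.root (Finsupp.single i n) = n • D.α i := by simp [root]

/-- A torus acting on the free algebra `F`: an abelian group `T` of exponents, its pairing `ev` with
the root lattice, and the exponents `k β` of the elements `K_β`. The two cases that matter are
`T = P^∨` and the root lattice itself. -/
structure Torus (T : Type*) [AddCommGroup T] where
  /-- the pairing of exponents with the root lattice -/
  ev : T →+ (I →₀ ℤ) →+ ℤ
  /-- the exponent of `K_β` -/
  k : (I →₀ ℤ) →+ T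
  ev_k : ∀ β γ, ev (k β) γ = D.rootForm β γ

/-- The torus with exponents in `P^∨`. -/
def coTorus : D.Torus (Module.Dual ℤ P) where
  ev := AddMonoidHom.mk' (fun h => h.toAddMonoidHom.comp D.rootHom) fun _ _ => rfl
  k := D.kExpHom
  ev_k β γ := by
    suffices (AddMonoidHom.mk' (fun h : Module.Dual ℤ P => h.toAddMonoidHom.comp D.rootHom)
      fun _ _ => rfl).comp D.kExpHom = D.rootFormHom from
      DFunLike.congr_fun (DFunLike.congr_fun this β) γ
    ext i j
    have h : D.kExpHom (Finsupp.single i 1) (D.rootHom (Finsupp.single j 1)) =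
        D.r i * D.A i j := by
      simp [rootHom_apply, kExpHom_apply, root_single, kExp, D.pairing]
    change D.kExpHom (Finsupp.single i 1) (D.rootHom (Finsupp.single j 1)) =
      D.rootForm (Finsupp.single i 1) (Finsupp.single j 1)
    rw [h, rootForm_single]; ring

theorem coTorus_ev (h : Module.Dual ℤ P) (β : I →₀ ℤ) : D.coTorus.ev h β = h (D.root β) := rfl

theorem coTorus_k (β : I →₀ ℤ) : D.coTorus.k β = D.kExp β := D.kExpHom_apply β

/-- The torus of the elements `K_β`, with exponents in the root lattice. -/
def rootTorus : D.Torus (I →₀ ℤ) where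
  ev := D.rootFormHom
  k := AddMonoidHom.id _
  ev_k _ _ := rfl

variable {D}

namespace Torus

variable {T : Type*} [AddCommGroup T] (τ : D.Torus T)

/-- The relations that make the free algebra on the `f_il` and the torus elements a semidirect
product of the free algebra `F` and the group algebra of `T`. -/
inductive Rel : FreeAlgebra K (D.Iinf ⊕ T) → FreeAlgebra K (D.Iinf ⊕ T) → Prop
  | tor_zero : Rel (FreeAlgebra.ι K (Sum.inr 0)) 1
  | tor_add (h h' : T) : Rel (FreeAlgebra.ι K (Sum.inr (h + h')))
      (FreeAlgebra.ι K (Sum.inr h) * FreeAlgebra.ι K (Sum.inr h'))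
  | weight (h : T) (x : D.Iinf) :
      Rel (FreeAlgebra.ι K (Sum.inr h) * FreeAlgebra.ι K (Sum.inl x))
        (q ^ (τ.ev h (D.wt [x])) • (FreeAlgebra.ι K (Sum.inl x) * FreeAlgebra.ι K (Sum.inr h)))

/-- The semidirect product of the free algebra `F` and the group algebra of the torus. -/
def H : Type _ := RingQuot τ.Rel

instance : Ring τ.H := inferInstanceAs (Ring (RingQuot τ.Rel))

instance : Algebra K τ.H := inferInstanceAs (Algebra K (RingQuot τ.Rel))

/-- The projection from the free algebra. -/
def proj : FreeAlgebra K (D.Iinf ⊕ T) →ₐ[K] τ.H := RingQuot.mkAlgHom K τ.Rel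

/-- The generator `f_il`. -/
def f (x : D.Iinf) : τ.H := τ.proj (FreeAlgebra.ι K (Sum.inl x))

/-- The torus element with exponent `h`. -/
def t (h : T) : τ.H := τ.proj (FreeAlgebra.ι K (Sum.inr h))

/-- The algebra map `F → H`. -/
def incl : D.F →ₐ[K] τ.H := FreeAlgebra.lift K τ.f

variable {τ} in
theorem proj_rel {a b : FreeAlgebra K (D.Iinf ⊕ T)} (h : τ.Rel a b) : τ.proj a = τ.proj b :=
  RingQuot.mkAlgHom_rel K h

theorem incl_ι (x : D.Iinf) : τ.incl (FreeAlgebra.ι K x) = τ.f x := FreeAlgebra.lift_ι_apply _ _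

theorem t_zero : τ.t 0 = 1 := by
  rw [t, proj_rel Rel.tor_zero, map_one]

theorem t_add (h h' : T) : τ.t (h + h') = τ.t h * τ.t h' := by
  rw [t, proj_rel (Rel.tor_add h h'), map_mul]; rfl

theorem t_mul_f (h : T) (x : D.Iinf) :
    τ.t h * τ.f x = q ^ (τ.ev h (D.wt [x])) • (τ.f x * τ.t h) := by
  rw [t, f, ← map_mul, proj_rel (Rel.weight h x), map_smul, map_mul]

section Lift

variable {R : Type*} [Ring R] [Algebra K R]

/-- The universal property of `H`. -/
def lift (n : D.Iinf → R) (s : T → R) (h0 : s 0 = 1) (hadd : ∀ h h', s (h + h') = s h * s h')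
    (hw : ∀ h x, s h * n x = q ^ (τ.ev h (D.wt [x])) • (n x * s h)) : τ.H →ₐ[K] R :=
  RingQuot.liftAlgHom K ⟨FreeAlgebra.lift K (Sum.elim n s), by
    intro a b hab
    cases hab with
    | tor_zero => simp [h0]
    | tor_add h h' => simp [hadd]
    | weight h x => simp [hw]⟩

variable {τ}

theorem lift_proj {n : D.Iinf → R} {s : T → R} (h0 hadd hw) (a : FreeAlgebra K (D.Iinf ⊕ T)) :
    τ.lift n s h0 hadd hw (τ.proj a) = FreeAlgebra.lift K (Sum.elim n s) a :=
  RingQuot.liftAlgHom_mkAlgHom_apply K _ _ _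

theorem lift_f {n : D.Iinf → R} {s : T → R} (h0 hadd hw) (x : D.Iinf) :
    τ.lift n s h0 hadd hw (τ.f x) = n x := by
  simp [f, lift_proj]

theorem lift_t {n : D.Iinf → R} {s : T → R} (h0 hadd hw) (h : T) :
    τ.lift n s h0 hadd hw (τ.t h) = s h := by
  simp [t, lift_proj]

theorem algHom_ext {φ ψ : τ.H →ₐ[K] R} (hf : ∀ x, φ (τ.f x) = ψ (τ.f x))
    (ht : ∀ h, φ (τ.t h) = ψ (τ.t h)) : φ = ψ := by
  refine RingQuot.ringQuot_ext' K φ ψ (FreeAlgebra.hom_ext (funext fun x => ?_))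
  cases x with
  | inl x => exact hf x
  | inr h => exact ht h

end Lift

theorem proj_surjective : Function.Surjective τ.proj := RingQuot.mkAlgHom_surjective K τ.Rel

theorem H_induction {p : τ.H → Prop} (hc : ∀ c : K, p (algebraMap K τ.H c))
    (hf : ∀ x, p (τ.f x)) (ht : ∀ h, p (τ.t h)) (hmul : ∀ a b, p a → p b → p (a * b))
    (hadd : ∀ a b, p a → p b → p (a + b)) (a : τ.H) : p a := by
  obtain ⟨a, rfl⟩ := τ.proj_surjective a
  induction a using FreeAlgebra.induction with
  | grade0 c => rw [AlgHom.commutes]; exact hc c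
  | grade1 x =>
    cases x with
    | inl x => exact hf x
    | inr h => exact ht h
  | mul a b ha hb => rw [map_mul]; exact hmul _ _ ha hb
  | add a b ha hb => rw [map_add]; exact hadd _ _ ha hb

theorem t_mul_incl_mon (h : T) (w : List D.Iinf) :
    τ.t h * τ.incl (mon w) = q ^ (τ.ev h (D.wt w)) • (τ.incl (mon w) * τ.t h) := by
  induction w with
  | nil => simp [mon_nil, wt_nil]
  | cons x w ih =>
    have e : D.wt (x :: w) = D.wt [x] + D.wt w := by simp [wt_cons, wt_nil]
    rw [mon_cons, map_mul, incl_ι, ← mul_assoc, t_mul_f, smul_mul_assoc, mul_assoc, ih,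
      mul_smul_comm, smul_smul, ← zpow_add₀ q_ne_zero, e, map_add, mul_assoc]

/-- Torus elements commute with homogeneous elements of `F` up to a power of `q`. -/
theorem t_mul_incl (h : T) {β : I →₀ ℤ} {z : D.F} (hz : z ∈ D.homog β) :
    τ.t h * τ.incl z = q ^ (τ.ev h β) • (τ.incl z * τ.t h) := by
  refine homog_induction (p := fun z => τ.t h * τ.incl z = q ^ (τ.ev h β) • (τ.incl z * τ.t h))
    ?_ ?_ ?_ ?_ hz
  · simp
  · intro a b ha hb; rw [map_add, mul_add, ha, hb, add_mul, smul_add]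
  · intro c a ha; rw [map_smul, mul_smul_comm, ha, smul_mul_assoc, smul_comm]
  · intro w hw; rw [t_mul_incl_mon, hw]

/-- The normally ordered monomial `f_w q^h`. -/
def bas (w : List D.Iinf) (h : T) : τ.H := τ.incl (mon w) * τ.t h

theorem bas_nil_zero : τ.bas [] 0 = 1 := by simp [bas, mon_nil, t_zero]

theorem f_mul_bas (x : D.Iinf) (w : List D.Iinf) (h : T) :
    τ.f x * τ.bas w h = τ.bas (x :: w) h := by
  rw [bas, bas, mon_cons, map_mul, incl_ι, mul_assoc]

theorem t_mul_bas (h' : T) (w : List D.Iinf) (h : T) :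
    τ.t h' * τ.bas w h = q ^ (τ.ev h' (D.wt w)) • τ.bas w (h' + h) := by
  rw [bas, bas, ← mul_assoc, t_mul_incl_mon, smul_mul_assoc, mul_assoc, ← t_add]

/-- The normally ordered monomials span `H`. -/
theorem span_bas : Submodule.span K (Set.range fun p : List D.Iinf × T => τ.bas p.1 p.2) = ⊤ := by
  rw [eq_top_iff]
  intro a _
  suffices ∀ a : τ.H, ∀ z ∈ Submodule.span K (Set.range fun p : List D.Iinf × T => τ.bas p.1 p.2),
      a * z ∈ Submodule.span K (Set.range fun p : List D.Iinf × T => τ.bas p.1 p.2) by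
    simpa using this a 1 (Submodule.subset_span ⟨([], 0), τ.bas_nil_zero⟩)
  intro a
  induction a using τ.H_induction with
  | hc c =>
    intro z hz
    rw [← Algebra.smul_def]; exact Submodule.smul_mem _ _ hz
  | hf x =>
    intro z hz
    induction hz using Submodule.span_induction with
    | zero => simp
    | add a b _ _ ha hb => rw [mul_add]; exact add_mem ha hb
    | smul c a _ ha => rw [mul_smul_comm]; exact Submodule.smul_mem _ _ ha
    | mem a ha =>
      obtain ⟨p, rfl⟩ := ha
      exact Submodule.subset_span ⟨(x :: p.1, p.2), (τ.f_mul_bas _ _ _).symm⟩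
  | ht h =>
    intro z hz
    induction hz using Submodule.span_induction with
    | zero => simp
    | add a b _ _ ha hb => rw [mul_add]; exact add_mem ha hb
    | smul c a _ ha => rw [mul_smul_comm]; exact Submodule.smul_mem _ _ ha
    | mem a ha =>
      obtain ⟨p, rfl⟩ := ha
      dsimp only
      rw [t_mul_bas]
      exact Submodule.smul_mem _ _ (Submodule.subset_span ⟨(p.1, h + p.2), rfl⟩)
  | hmul a b ha hb => intro z hz; rw [mul_assoc]; exact ha _ (hb _ hz)
  | hadd a b ha hb => intro z hz; rw [add_mul]; exact add_mem (ha _ hz) (hb _ hz)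

variable {τ} in
theorem linearMap_ext_bas {M : Type*} [AddCommMonoid M] [Module K M] {φ ψ : τ.H →ₗ[K] M}
    (h : ∀ w s, φ (τ.bas w s) = ψ (τ.bas w s)) : φ = ψ := by
  refine LinearMap.ext_on_range τ.span_bas ?_
  rintro ⟨w, s⟩
  exact h w s

/-- The space with basis the normally ordered monomials. -/
abbrev NormalForms (D : Datum I P) (T : Type*) : Type _ := (List D.Iinf × T) →₀ K

/-- The action of `f_il` on normal forms. -/
def actF {T : Type*} (x : D.Iinf) : Module.End K (NormalForms D T) :=
  Finsupp.linearCombination K fun p => Finsupp.single (x :: p.1, p.2) 1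

/-- The action of the torus on normal forms. -/
def actT (h : T) : Module.End K (NormalForms D T) :=
  Finsupp.linearCombination K fun p =>
    Finsupp.single (p.1, h + p.2) (q ^ (τ.ev h (D.wt p.1)))

theorem actF_single {T : Type*} (x : D.Iinf) (p : List D.Iinf × T) (c : K) :
    actF x (Finsupp.single p c) = Finsupp.single (x :: p.1, p.2) c := by
  simp [actF]

theorem actT_single (h : T) (p : List D.Iinf × T) (c : K) :
    τ.actT h (Finsupp.single p c) =
      Finsupp.single (p.1, h + p.2) (c * q ^ (τ.ev h (D.wt p.1))) := by
  simp [actT]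

/-- The left regular representation of `H`, in the basis of normally ordered monomials. -/
def rep : τ.H →ₐ[K] Module.End K (NormalForms D T) :=
  τ.lift actF τ.actT
    (by
      refine Finsupp.lhom_ext fun p c => ?_
      rw [actT_single]; simp)
    (by
      intro h h'
      refine Finsupp.lhom_ext fun p c => ?_
      rw [Module.End.mul_apply, actT_single, actT_single, actT_single, map_add,
        AddMonoidHom.add_apply, zpow_add₀ q_ne_zero, add_assoc]
      congr 1; ring)
    (by
      intro h x
      refine Finsupp.lhom_ext fun p c => ?_
      have e : D.wt (x :: p.1) = D.wt [x] + D.wt p.1 := by simp [wt_cons, wt_nil]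
      rw [Module.End.mul_apply, LinearMap.smul_apply, Module.End.mul_apply, actT_single,
        actF_single, actF_single, actT_single, Finsupp.smul_single, e, map_add,
        zpow_add₀ q_ne_zero, smul_eq_mul]
      congr 1; ring)

/-- The left regular representation shows that the normally ordered monomials are linearly
independent. -/
theorem rep_bas (w : List D.Iinf) (h : T) :
    τ.rep (τ.bas w h) (Finsupp.single ([], 0) 1) = Finsupp.single (w, h) 1 := by
  induction w with
  | nil =>
    rw [bas, mon_nil, map_one, one_mul, rep, lift_t, actT_single]
    simp [wt_nil]
  | cons x w ih =>
    rw [← f_mul_bas, map_mul, Module.End.mul_apply, ih, rep, lift_f, actF_single]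

/-- The linear functional on `H` with prescribed values on the normally ordered monomials. -/
def functional (g : List D.Iinf → K) : τ.H →ₗ[K] K :=
  Finsupp.linearCombination K (fun p : List D.Iinf × T => g p.1) ∘ₗ
    (LinearMap.applyₗ (Finsupp.single ([], 0) 1 : NormalForms D T)) ∘ₗ τ.rep.toLinearMap

theorem functional_bas (g : List D.Iinf → K) (w : List D.Iinf) (h : T) :
    τ.functional g (τ.bas w h) = g w := by
  simp [functional, rep_bas]

end Torus

end Torus

/-! ### The comultiplication -/

section Bialgebra

variable {I : Type*} {P : Type*} [AddCommGroup P] {D : Datum I P}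

theorem sum_antidiagonal_assoc {M : Type*} [AddCommMonoid M] (l : ℕ) (F : ℕ → ℕ → ℕ → M) :
    ∑ p ∈ Finset.HasAntidiagonal.antidiagonal l,
      ∑ r ∈ Finset.HasAntidiagonal.antidiagonal p.1, F r.1 r.2 p.2 =
    ∑ p ∈ Finset.HasAntidiagonal.antidiagonal l,
      ∑ r ∈ Finset.HasAntidiagonal.antidiagonal p.2, F p.1 r.1 r.2 := by
  rw [Finset.sum_sigma', Finset.sum_sigma']
  refine Finset.sum_bij' (fun x _ => ⟨(x.2.1, x.2.2 + x.1.2), (x.2.2, x.1.2)⟩)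
    (fun x _ => ⟨(x.1.1 + x.2.1, x.2.2), (x.1.1, x.2.1)⟩) ?_ ?_ ?_ ?_ ?_
  · rintro ⟨⟨a, b⟩, ⟨c, d⟩⟩ h
    simp only [Finset.mem_sigma, Finset.HasAntidiagonal.mem_antidiagonal] at h ⊢
    exact ⟨by omega, trivial⟩
  · rintro ⟨⟨a, b⟩, ⟨c, d⟩⟩ h
    simp only [Finset.mem_sigma, Finset.HasAntidiagonal.mem_antidiagonal] at h ⊢
    exact ⟨by omega, trivial⟩
  · rintro ⟨⟨a, b⟩, ⟨c, d⟩⟩ h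
    simp only [Finset.mem_sigma, Finset.HasAntidiagonal.mem_antidiagonal] at h ⊢
    obtain ⟨-, rfl⟩ := h
    rfl
  · rintro ⟨⟨a, b⟩, ⟨c, d⟩⟩ h
    simp only [Finset.mem_sigma, Finset.HasAntidiagonal.mem_antidiagonal] at h ⊢
    obtain ⟨-, rfl⟩ := h
    rfl
  · intros; rfl

/-- The element `(i,l)` of `I^∞`. -/
def Iinf.of {i : I} {l : ℕ} (h : 0 < l ∧ (D.IsReal i → l = 1)) : D.Iinf := ⟨(i, l), h⟩

theorem Iinf.idx_of {i : I} {l : ℕ} (h : 0 < l ∧ (D.IsReal i → l = 1)) : (Iinf.of h).idx = i := rfl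

theorem Iinf.deg_of {i : I} {l : ℕ} (h : 0 < l ∧ (D.IsReal i → l = 1)) : (Iinf.of h).deg = l := rfl

theorem fgen_zero (i : I) : D.fgen i 0 = 1 := by simp [fgen]

theorem fgen_of_valid {i : I} {l : ℕ} (h : 0 < l ∧ (D.IsReal i → l = 1)) :
    D.fgen i l = FreeAlgebra.ι K (Iinf.of h) := dif_pos h

/-- The elements `f_il` with `(i, l) ∉ I^∞` and `l ≠ 0` are zero by convention. -/
theorem fgen_of_not_valid {i : I} {l : ℕ} (hl : l ≠ 0) (h : ¬ (0 < l ∧ (D.IsReal i → l = 1))) :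
    D.fgen i l = 0 := by rw [fgen, dif_neg h, if_neg hl]

theorem fgen_self (x : D.Iinf) : D.fgen x.idx x.deg = FreeAlgebra.ι K x := fgen_of_valid x.2

/-- If `(i, l) ∈ I^∞` and `0 < m ≤ l`, then `(i, m) ∈ I^∞`. -/
theorem Iinf.valid_of_le (x : D.Iinf) {m : ℕ} (hm : m ≠ 0) (h : m ≤ x.deg) :
    0 < m ∧ (D.IsReal x.idx → m = 1) := by
  refine ⟨Nat.pos_of_ne_zero hm, fun hr => ?_⟩
  have := x.deg_of_real hr
  omega

theorem fgen_mem_homog (i : I) (l : ℕ) : D.fgen i l ∈ D.homog (Finsupp.single i (-(l : ℤ))) := by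
  by_cases h : 0 < l ∧ (D.IsReal i → l = 1)
  · rw [fgen_of_valid h, ← mon_singleton]
    exact mon_mem_homog (by simp [wt_cons, wt_nil, Iinf.idx_of, Iinf.deg_of])
  · by_cases hl : l = 0
    · subst hl
      rw [fgen_zero, ← mon_nil]
      exact mon_mem_homog (by simp [wt_nil])
    · rw [fgen_of_not_valid hl h]; exact zero_mem _

theorem qpar_ne_zero (i : I) : D.qpar i ≠ 0 := zpow_ne_zero _ q_ne_zero

namespace Torus

variable {T : Type*} [AddCommGroup T] (τ : D.Torus T)

/-- The exponent of `K_i ^ n`. -/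
def kpow (i : I) (n : ℕ) : T := τ.k (Finsupp.single i (n : ℤ))

theorem kpow_zero (i : I) : τ.kpow i 0 = 0 := by simp [kpow]

theorem kpow_add (i : I) (m n : ℕ) : τ.kpow i (m + n) = τ.kpow i m + τ.kpow i n := by
  simp [kpow, Finsupp.single_add]

/-- `Σ_{m+n=l} q_(i)^(-mn) f_im K_i^n ⊗ f_in`. -/
def comulGen (i : I) (l : ℕ) : τ.H ⊗[K] τ.H :=
  ∑ p ∈ Finset.HasAntidiagonal.antidiagonal l, D.qpar i ^ (-((p.1 * p.2 : ℕ) : ℤ)) •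
    ((τ.incl (D.fgen i p.1) * τ.t (τ.kpow i p.2)) ⊗ₜ[K] τ.incl (D.fgen i p.2))

theorem t_mul_fgen (h : T) (i : I) (l : ℕ) :
    τ.t h * τ.incl (D.fgen i l) =
      q ^ (τ.ev h (Finsupp.single i (-(l : ℤ)))) • (τ.incl (D.fgen i l) * τ.t h) :=
  τ.t_mul_incl h (fgen_mem_homog i l)

theorem t_mul_t_comm (h h' : T) : τ.t h * τ.t h' = τ.t h' * τ.t h := by
  rw [← t_add, ← t_add, add_comm]

/-- The comultiplication of `H`. -/
def comulHom : τ.H →ₐ[K] τ.H ⊗[K] τ.H :=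
  τ.lift (fun x => τ.comulGen x.idx x.deg) (fun h => τ.t h ⊗ₜ[K] τ.t h)
    (by rw [t_zero]; rfl)
    (by intro h h'; rw [t_add, Algebra.TensorProduct.tmul_mul_tmul])
    (by
      intro h x
      rw [comulGen, Finset.mul_sum, Finset.sum_mul, Finset.smul_sum]
      refine Finset.sum_congr rfl fun p hp => ?_
      have hp' : p.1 + p.2 = x.deg := Finset.HasAntidiagonal.mem_antidiagonal.1 hp
      have e : D.wt [x] = Finsupp.single x.idx (-(p.1 : ℤ)) + Finsupp.single x.idx (-(p.2 : ℤ)) := by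
        rw [wt_cons, wt_nil, add_zero, ← hp', ← Finsupp.single_add]; congr 1; push_cast; ring
      rw [mul_smul_comm, smul_mul_assoc, Algebra.TensorProduct.tmul_mul_tmul,
        Algebra.TensorProduct.tmul_mul_tmul, ← mul_assoc, t_mul_fgen, t_mul_fgen, smul_mul_assoc,
        mul_assoc, τ.t_mul_t_comm, ← mul_assoc, TensorProduct.smul_tmul_smul, e, map_add,
        zpow_add₀ q_ne_zero, smul_comm])

theorem comulHom_f (x : D.Iinf) : τ.comulHom (τ.f x) = τ.comulGen x.idx x.deg := lift_f _ _ _ _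

theorem comulHom_t (h : T) : τ.comulHom (τ.t h) = τ.t h ⊗ₜ[K] τ.t h := lift_t _ _ _ _

/-- The formula for the comultiplication holds for `f_im`, `m ≤ l`, with `(i, l) ∈ I^∞`; it fails
for a real index and `m ≥ 2`, where `f_im = 0` by convention. -/
theorem comulHom_fgen (x : D.Iinf) {m : ℕ} (hm : m ≤ x.deg) :
    τ.comulHom (τ.incl (D.fgen x.idx m)) = τ.comulGen x.idx m := by
  by_cases h : m = 0
  · subst h
    simp [fgen_zero, comulGen, kpow_zero, t_zero, Algebra.TensorProduct.one_def]
  · rw [fgen_of_valid (x.valid_of_le h hm), incl_ι, comulHom_f]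
    rfl

/-- The counit of `H`. -/
def counitHom : τ.H →ₐ[K] K :=
  τ.lift (fun _ => 0) (fun _ => 1) rfl (by simp) (by simp)

theorem counitHom_f (x : D.Iinf) : τ.counitHom (τ.f x) = 0 := lift_f _ _ _ _

theorem counitHom_t (h : T) : τ.counitHom (τ.t h) = 1 := lift_t _ _ _ _

theorem counitHom_fgen (i : I) (m : ℕ) :
    τ.counitHom (τ.incl (D.fgen i m)) = if m = 0 then 1 else 0 := by
  split_ifs with h
  · rw [h, fgen_zero, map_one, map_one]
  · by_cases hv : 0 < m ∧ (D.IsReal i → m = 1)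
    · rw [fgen_of_valid hv, incl_ι, counitHom_f]
    · rw [fgen_of_not_valid h hv, map_zero, map_zero]

/-- Coassociativity. On `f_il` both sides are
`Σ_{a+b+c=l} q_(i)^(-ab-ac-bc) f_ia K_i^(b+c) ⊗ f_ib K_i^c ⊗ f_ic`. -/
theorem comulHom_coassoc :
    (Algebra.TensorProduct.assoc K K K τ.H τ.H τ.H).toAlgHom.comp
      ((Algebra.TensorProduct.map τ.comulHom (.id K τ.H)).comp τ.comulHom) =
    (Algebra.TensorProduct.map (.id K τ.H) τ.comulHom).comp τ.comulHom := by
  refine algHom_ext (fun x => ?_) fun h => ?_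
  · have hl : ((Algebra.TensorProduct.map τ.comulHom (.id K τ.H)).comp τ.comulHom) (τ.f x) =
        ∑ p ∈ Finset.HasAntidiagonal.antidiagonal x.deg,
          ∑ r ∈ Finset.HasAntidiagonal.antidiagonal p.1,
          (D.qpar x.idx ^ (-((r.1 * r.2 + r.1 * p.2 + r.2 * p.2 : ℕ) : ℤ))) •
            ((τ.incl (D.fgen x.idx r.1) * τ.t (τ.kpow x.idx (r.2 + p.2))) ⊗ₜ[K]
              (τ.incl (D.fgen x.idx r.2) * τ.t (τ.kpow x.idx p.2)) ⊗ₜ[K]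
                τ.incl (D.fgen x.idx p.2)) := by
      rw [AlgHom.comp_apply, comulHom_f, comulGen, map_sum]
      refine Finset.sum_congr rfl fun p hp => ?_
      have hp' : p.1 + p.2 = x.deg := Finset.HasAntidiagonal.mem_antidiagonal.1 hp
      rw [map_smul, Algebra.TensorProduct.map_tmul, map_mul, comulHom_fgen _ _ (by omega),
        comulHom_t, comulGen, Finset.sum_mul, TensorProduct.sum_tmul, Finset.smul_sum]
      refine Finset.sum_congr rfl fun r hr => ?_
      have hr' : r.1 + r.2 = p.1 := Finset.HasAntidiagonal.mem_antidiagonal.1 hr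
      rw [smul_mul_assoc, Algebra.TensorProduct.tmul_mul_tmul, ← TensorProduct.smul_tmul',
        smul_smul, ← zpow_add₀ (qpar_ne_zero _), mul_assoc, ← t_add, ← kpow_add]
      congr 2
      rw [← hr']; push_cast; ring
    have hr : ((Algebra.TensorProduct.map (.id K τ.H) τ.comulHom).comp τ.comulHom) (τ.f x) =
        ∑ p ∈ Finset.HasAntidiagonal.antidiagonal x.deg,
          ∑ r ∈ Finset.HasAntidiagonal.antidiagonal p.2,
          (D.qpar x.idx ^ (-((p.1 * r.1 + p.1 * r.2 + r.1 * r.2 : ℕ) : ℤ))) •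
            ((τ.incl (D.fgen x.idx p.1) * τ.t (τ.kpow x.idx (r.1 + r.2))) ⊗ₜ[K]
              ((τ.incl (D.fgen x.idx r.1) * τ.t (τ.kpow x.idx r.2)) ⊗ₜ[K]
                τ.incl (D.fgen x.idx r.2))) := by
      rw [AlgHom.comp_apply, comulHom_f, comulGen, map_sum]
      refine Finset.sum_congr rfl fun p hp => ?_
      have hp' : p.1 + p.2 = x.deg := Finset.HasAntidiagonal.mem_antidiagonal.1 hp
      rw [map_smul, Algebra.TensorProduct.map_tmul, comulHom_fgen _ _ (by omega),
        comulGen, TensorProduct.tmul_sum, Finset.smul_sum]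
      refine Finset.sum_congr rfl fun r hr => ?_
      have hr' : r.1 + r.2 = p.2 := Finset.HasAntidiagonal.mem_antidiagonal.1 hr
      rw [TensorProduct.tmul_smul, smul_smul, ← zpow_add₀ (qpar_ne_zero _), ← hr']
      congr 2
      push_cast; ring
    rw [hr, AlgHom.comp_apply, hl, map_sum]
    rw [← sum_antidiagonal_assoc x.deg (fun a b c =>
      (D.qpar x.idx ^ (-((a * b + a * c + b * c : ℕ) : ℤ))) •
            ((τ.incl (D.fgen x.idx a) * τ.t (τ.kpow x.idx (b + c))) ⊗ₜ[K]
              ((τ.incl (D.fgen x.idx b) * τ.t (τ.kpow x.idx c)) ⊗ₜ[K]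
                τ.incl (D.fgen x.idx c))))]
    refine Finset.sum_congr rfl fun p _ => ?_
    rw [map_sum]
    refine Finset.sum_congr rfl fun r _ => ?_
    rw [map_smul]
    rfl
  · simp [comulHom_t]

/-- The bialgebra structure of `H`. -/
instance : Bialgebra K τ.H := Bialgebra.ofAlgHom τ.comulHom τ.counitHom τ.comulHom_coassoc
  (by
    refine algHom_ext (fun x => ?_) fun h => ?_
    · rw [AlgHom.comp_apply, comulHom_f, comulGen, map_sum,
        Finset.sum_eq_single (0, x.deg)]
      · simp [counitHom_t, fgen_self, incl_ι, fgen_zero]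
      · intro p hp hne
        have hp' : p.1 + p.2 = x.deg := Finset.HasAntidiagonal.mem_antidiagonal.1 hp
        have h0 : p.1 ≠ 0 := fun h0 => hne (Prod.ext h0 (by dsimp only; omega))
        simp [counitHom_fgen, h0]
      · simp
    · simp [comulHom_t, counitHom_t])
  (by
    refine algHom_ext (fun x => ?_) fun h => ?_
    · rw [AlgHom.comp_apply, comulHom_f, comulGen, map_sum,
        Finset.sum_eq_single (x.deg, 0)]
      · simp [kpow_zero, t_zero, fgen_self, incl_ι, fgen_zero]
      · intro p hp hne
        have hp' : p.1 + p.2 = x.deg := Finset.HasAntidiagonal.mem_antidiagonal.1 hp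
        have h0 : p.2 ≠ 0 := fun h0 => hne (Prod.ext (by dsimp only; omega) h0)
        simp [counitHom_fgen, h0]
      · simp
    · simp [comulHom_t, counitHom_t])

theorem comul_eq (a : τ.H) : Coalgebra.comul (R := K) a = τ.comulHom a := rfl

theorem counit_eq (a : τ.H) : Coalgebra.counit (R := K) a = τ.counitHom a := rfl

end Torus

end Bialgebra

/-! ### The Hopf pairing -/

section Pairing

variable {I : Type*} {P : Type*} [AddCommGroup P] {D : Datum I P}

theorem sum_antidiagonal_shift {M : Type*} [AddCommMonoid M] (d l : ℕ) (G : ℕ → ℕ → M) :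
    ∑ p ∈ Finset.HasAntidiagonal.antidiagonal (d + l), (if d ≤ p.1 then G (p.1 - d) p.2 else 0) =
      ∑ p ∈ Finset.HasAntidiagonal.antidiagonal l, G p.1 p.2 := by
  rw [← Finset.sum_filter]
  refine Finset.sum_bij' (fun p _ => (p.1 - d, p.2)) (fun p _ => (p.1 + d, p.2)) ?_ ?_ ?_ ?_ ?_
  · intro p hp
    simp only [Finset.mem_filter, Finset.HasAntidiagonal.mem_antidiagonal] at hp ⊢
    omega
  · intro p hp
    simp only [Finset.mem_filter, Finset.HasAntidiagonal.mem_antidiagonal] at hp ⊢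
    omega
  · intro p hp
    simp only [Finset.mem_filter] at hp
    exact Prod.ext (Nat.sub_add_cancel hp.2) rfl
  · intro p hp
    exact Prod.ext (Nat.add_sub_cancel _ _) rfl
  · intros; rfl

variable (ν : D.Iinf → K)

theorem pairGenWord_zero (i : I) (w : List D.Iinf) :
    D.pairGenWord ν i 0 w = if w = [] then 1 else 0 := by
  cases w with
  | nil => simp [pairGenWord]
  | cons x w =>
    have := x.deg_pos
    rw [pairGenWord, if_neg (by omega), if_neg (by simp)]

theorem pairGenWord_nil (i : I) (l : ℕ) :
    D.pairGenWord ν i l [] = if l = 0 then 1 else 0 := by rw [pairGenWord]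

open Classical in
theorem pairGenWord_cons (i : I) (l : ℕ) (x : D.Iinf) (w : List D.Iinf) :
    D.pairGenWord ν i l (x :: w) = if x.idx = i ∧ x.deg ≤ l then
      D.qpar i ^ (-((x.deg * (l - x.deg) : ℕ) : ℤ)) * ν x * D.pairGenWord ν i (l - x.deg) w
      else 0 := by rw [pairGenWord]

/-- A word pairs to zero with `f_il` unless it has the weight of `f_il`. -/
theorem pairGenWord_eq_zero {i : I} {l : ℕ} {w : List D.Iinf}
    (h : D.wt w ≠ Finsupp.single i (-(l : ℤ))) : D.pairGenWord ν i l w = 0 := by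
  induction w generalizing l with
  | nil =>
    rw [pairGenWord_nil, if_neg]
    rintro rfl
    exact h (by simp [wt_nil])
  | cons x w ih =>
    rw [pairGenWord_cons]
    split_ifs with hx
    · rw [ih, mul_zero]
      intro h'
      apply h
      rw [wt_cons, h', hx.1, ← Finsupp.single_add]
      congr 1
      have := hx.2
      push_cast [this]
      ring
    · rfl

namespace Torus

variable {T : Type*} [AddCommGroup T] (τ : D.Torus T)

/-- The functional `(· , f_il)_L` on `H`. -/
def phi (i : I) (l : ℕ) : τ.H →ₗ[K] K := τ.functional (D.pairGenWord ν i l)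

/-- The character `(· , K_γ)_L` of `H`. -/
def chi (γ : I →₀ ℤ) : τ.H →ₐ[K] K :=
  τ.lift (fun _ => 0) (fun h => q ^ (-(τ.ev h γ))) (by simp)
    (fun h h' => by
      rw [map_add, AddMonoidHom.add_apply, neg_add, zpow_add₀ q_ne_zero])
    (by simp)

theorem chi_f (γ : I →₀ ℤ) (x : D.Iinf) : τ.chi γ (τ.f x) = 0 := lift_f _ _ _ _

theorem chi_t (γ : I →₀ ℤ) (h : T) : τ.chi γ (τ.t h) = q ^ (-(τ.ev h γ)) := lift_t _ _ _ _

theorem chi_fgen (γ : I →₀ ℤ) (i : I) (m : ℕ) :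
    τ.chi γ (τ.incl (D.fgen i m)) = if m = 0 then 1 else 0 := by
  split_ifs with h
  · rw [h, fgen_zero, map_one, map_one]
  · by_cases hv : 0 < m ∧ (D.IsReal i → m = 1)
    · rw [fgen_of_valid hv, incl_ι, chi_f]
    · rw [fgen_of_not_valid h hv, map_zero, map_zero]

/-- The automorphism `a ↦ Σ (a_(1), K_γ)_L a_(2)`. -/
def lam (γ : I →₀ ℤ) : τ.H →ₐ[K] τ.H :=
  (Algebra.TensorProduct.lid K τ.H).toAlgHom.comp
    ((Algebra.TensorProduct.map (τ.chi γ) (.id K τ.H)).comp τ.comulHom)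

/-- The automorphism `a ↦ Σ a_(1) (a_(2), K_γ)_L`. -/
def kap (γ : I →₀ ℤ) : τ.H →ₐ[K] τ.H :=
  (Algebra.TensorProduct.rid K K τ.H).toAlgHom.comp
    ((Algebra.TensorProduct.map (.id K τ.H) (τ.chi γ)).comp τ.comulHom)

theorem lam_f (γ : I →₀ ℤ) (x : D.Iinf) :
    τ.lam γ (τ.f x) = q ^ (D.rootForm γ (D.wt [x])) • τ.f x := by
  rw [lam, AlgHom.comp_apply, AlgHom.comp_apply, comulHom_f, comulGen, map_sum, map_sum,
    Finset.sum_eq_single (0, x.deg)]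
  · have e : -(τ.ev (τ.kpow x.idx x.deg) γ) = D.rootForm γ (D.wt [x]) := by
      rw [kpow, ev_k, rootForm_comm, ← rootFormHom_apply, ← rootFormHom_apply, ← map_neg,
        ← Finsupp.single_neg, wt_cons, wt_nil, add_zero]
    simp [chi_t, fgen_self, incl_ι, fgen_zero, e]
  · intro p hp hne
    have hp' : p.1 + p.2 = x.deg := Finset.HasAntidiagonal.mem_antidiagonal.1 hp
    have h0 : p.1 ≠ 0 := fun h0 => hne (Prod.ext h0 (by dsimp only; omega))
    simp [chi_fgen, h0]
  · simp

theorem lam_t (γ : I →₀ ℤ) (h : T) : τ.lam γ (τ.t h) = q ^ (-(τ.ev h γ)) • τ.t h := by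
  simp [lam, comulHom_t, chi_t]

theorem kap_f (γ : I →₀ ℤ) (x : D.Iinf) : τ.kap γ (τ.f x) = τ.f x := by
  rw [kap, AlgHom.comp_apply, AlgHom.comp_apply, comulHom_f, comulGen, map_sum, map_sum,
    Finset.sum_eq_single (x.deg, 0)]
  · simp [kpow_zero, t_zero, fgen_self, incl_ι, fgen_zero]
  · intro p hp hne
    have hp' : p.1 + p.2 = x.deg := Finset.HasAntidiagonal.mem_antidiagonal.1 hp
    have h0 : p.2 ≠ 0 := fun h0 => hne (Prod.ext (by dsimp only; omega) h0)
    simp [chi_fgen, h0]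
  · simp

theorem kap_t (γ : I →₀ ℤ) (h : T) : τ.kap γ (τ.t h) = q ^ (-(τ.ev h γ)) • τ.t h := by
  simp [kap, comulHom_t, chi_t]

theorem kap_incl (γ : I →₀ ℤ) (z : D.F) : τ.kap γ (τ.incl z) = τ.incl z := by
  suffices (τ.kap γ).comp τ.incl = τ.incl from DFunLike.congr_fun this z
  refine FreeAlgebra.hom_ext (funext fun x => ?_)
  simp [incl_ι, kap_f]

theorem lam_incl_mon (γ : I →₀ ℤ) (w : List D.Iinf) :
    τ.lam γ (τ.incl (mon w)) = q ^ (D.rootForm γ (D.wt w)) • τ.incl (mon w) := by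
  induction w with
  | nil => simp [mon_nil, wt_nil, ← rootFormHom_apply]
  | cons x w ih =>
    have e : D.wt (x :: w) = D.wt [x] + D.wt w := by simp [wt_cons, wt_nil]
    rw [mon_cons, map_mul, map_mul, ih, incl_ι, lam_f, smul_mul_smul_comm,
      ← zpow_add₀ q_ne_zero, e, rootForm_add_right]

theorem lam_bas (γ : I →₀ ℤ) (w : List D.Iinf) (h : T) :
    τ.lam γ (τ.bas w h) = q ^ (D.rootForm γ (D.wt w) - τ.ev h γ) • τ.bas w h := by
  rw [bas, map_mul, lam_incl_mon, lam_t, smul_mul_smul_comm, ← zpow_add₀ q_ne_zero,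
    sub_eq_add_neg]

theorem kap_bas (γ : I →₀ ℤ) (w : List D.Iinf) (h : T) :
    τ.kap γ (τ.bas w h) = q ^ (-(τ.ev h γ)) • τ.bas w h := by
  rw [bas, map_mul, kap_incl, kap_t, mul_smul_comm]

open WithConv

/-- Convolution with the character of `K_γ` from the left is the pullback along `lam γ`. -/
theorem chi_convMul (γ : I →₀ ℤ) (g : WithConv (τ.H →ₗ[K] K)) (a : τ.H) :
    (toConv (τ.chi γ).toLinearMap * g) a = g (τ.lam γ a) := by
  rw [LinearMap.convMul_apply, comul_eq, lam, AlgHom.comp_apply, AlgHom.comp_apply]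
  generalize τ.comulHom a = s
  induction s using TensorProduct.induction_on with
  | zero => simp
  | add s s' hs hs' => simp only [map_add, hs, hs']
  | tmul a b => simp

/-- Convolution with the character of `K_γ` from the right is the pullback along `kap γ`. -/
theorem convMul_chi (γ : I →₀ ℤ) (g : WithConv (τ.H →ₗ[K] K)) (a : τ.H) :
    (g * toConv (τ.chi γ).toLinearMap) a = g (τ.kap γ a) := by
  rw [LinearMap.convMul_apply, comul_eq, kap, AlgHom.comp_apply, AlgHom.comp_apply]
  generalize τ.comulHom a = s
  induction s using TensorProduct.induction_on with
  | zero => simp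
  | add s s' hs hs' => simp only [map_add, hs, hs']
  | tmul a b => simp [mul_comm]

theorem conv_ext_bas {g g' : WithConv (τ.H →ₗ[K] K)}
    (h : ∀ w s, g (τ.bas w s) = g' (τ.bas w s)) : g = g' :=
  WithConv.ext (linearMap_ext_bas h)

/-- The pairing `( , )_L` between `H` for an arbitrary torus and `H` for the root lattice, as an
algebra map to the convolution algebra: `pair b a` is `(a, b)_L`. Multiplicativity in `b` is the
rule `(a, b b')_L = (Δ(a), b ⊗ b')_L`, so only the relations of `H` have to be checked. -/
def pair : D.rootTorus.H →ₐ[K] WithConv (τ.H →ₗ[K] K) :=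
  D.rootTorus.lift (fun x => toConv (τ.phi ν x.idx x.deg)) (fun γ => toConv (τ.chi γ).toLinearMap)
    (by
      refine WithConv.ext (LinearMap.ext fun a => ?_)
      have : τ.chi 0 = τ.counitHom :=
        algHom_ext (fun x => by rw [chi_f, counitHom_f]) (fun h => by
          rw [chi_t, counitHom_t]; simp)
      rw [this]; rfl)
    (by
      intro γ γ'
      refine WithConv.ext (LinearMap.ext fun a => ?_)
      rw [chi_convMul]
      change τ.chi (γ + γ') a = ((τ.chi γ').comp (τ.lam γ)) a
      congr 1
      refine algHom_ext (fun x => ?_) (fun h => ?_)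
      · simp [chi_f, lam_f]
      · simp only [AlgHom.comp_apply, lam_t, map_smul, chi_t, map_add]
        rw [smul_eq_mul, ← zpow_add₀ q_ne_zero]
        congr 1; ring)
    (by
      intro γ x
      refine τ.conv_ext_bas fun w s => ?_
      rw [chi_convMul, ofConv_smul, LinearMap.smul_apply, convMul_chi, lam_bas, kap_bas, map_smul,
        map_smul, smul_smul, ← zpow_add₀ q_ne_zero]
      by_cases hw : D.wt w = D.wt [x]
      · rw [hw]; rfl
      · have : τ.phi ν x.idx x.deg (τ.bas w s) = 0 := by
          rw [phi, functional_bas, pairGenWord_eq_zero]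
          intro h'; exact hw (by rw [h', wt_cons, wt_nil, add_zero])
        simp [this])

theorem pair_f (x : D.Iinf) : τ.pair ν (D.rootTorus.f x) = toConv (τ.phi ν x.idx x.deg) :=
  lift_f _ _ _ _

theorem pair_t (γ : I →₀ ℤ) : τ.pair ν (D.rootTorus.t γ) = toConv (τ.chi γ).toLinearMap :=
  lift_t _ _ _ _

theorem phi_zero (i : I) : τ.phi ν i 0 = τ.counitHom.toLinearMap := by
  refine linearMap_ext_bas fun w s => ?_
  rw [phi, functional_bas, pairGenWord_zero]
  cases w with
  | nil => simp [bas, mon_nil, counitHom_t]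
  | cons x w => simp [bas, mon_cons, incl_ι, counitHom_f]

/-- The pairing with `f_im`, also for `f_i0 = 1`. -/
theorem pair_fgen (x : D.Iinf) {m : ℕ} (hm : m ≤ x.deg) :
    τ.pair ν (D.rootTorus.incl (D.fgen x.idx m)) = toConv (τ.phi ν x.idx m) := by
  by_cases h : m = 0
  · subst h
    rw [fgen_zero, map_one, map_one, phi_zero]
    rfl
  · rw [fgen_of_valid (x.valid_of_le h hm), incl_ι, pair_f]
    rfl

open Classical in
theorem phi_f_mul (i : I) (l : ℕ) (x : D.Iinf) (a : τ.H) :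
    τ.phi ν i l (τ.f x * a) = if x.idx = i ∧ x.deg ≤ l then
      D.qpar i ^ (-((x.deg * (l - x.deg) : ℕ) : ℤ)) * ν x * τ.phi ν i (l - x.deg) a else 0 := by
  suffices h : τ.phi ν i l ∘ₗ LinearMap.mulLeft K (τ.f x) = (if x.idx = i ∧ x.deg ≤ l then
      D.qpar i ^ (-((x.deg * (l - x.deg) : ℕ) : ℤ)) * ν x else 0) • τ.phi ν i (l - x.deg) by
    have := DFunLike.congr_fun h a
    rw [LinearMap.comp_apply, LinearMap.mulLeft_apply] at this
    rw [this]
    split_ifs <;> simp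
  refine linearMap_ext_bas fun w s => ?_
  rw [LinearMap.comp_apply, LinearMap.mulLeft_apply, LinearMap.smul_apply, f_mul_bas, phi, phi,
    functional_bas, functional_bas, pairGenWord_cons]
  split_ifs <;> simp

theorem phi_t_mul (i : I) (l : ℕ) (h : T) (a : τ.H) :
    τ.phi ν i l (τ.t h * a) = q ^ (τ.ev h (Finsupp.single i (-(l : ℤ)))) * τ.phi ν i l a := by
  suffices h : τ.phi ν i l ∘ₗ LinearMap.mulLeft K (τ.t h) =
      (q ^ (τ.ev h (Finsupp.single i (-(l : ℤ))))) • τ.phi ν i l from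
    DFunLike.congr_fun h a
  refine linearMap_ext_bas fun w s => ?_
  rw [LinearMap.comp_apply, LinearMap.mulLeft_apply, LinearMap.smul_apply, t_mul_bas, map_smul,
    phi, functional_bas, functional_bas]
  by_cases hw : D.wt w = Finsupp.single i (-(l : ℤ))
  · rw [hw]
  · simp [pairGenWord_eq_zero ν hw]

/-- Multiplicativity of the pairing in the first argument, for the generators `f_il` in the second
argument. -/
theorem phi_mul (i : I) (l : ℕ) (a a' : τ.H) :
    τ.phi ν i l (a * a') = ∑ p ∈ Finset.HasAntidiagonal.antidiagonal l,
      D.qpar i ^ (-((p.1 * p.2 : ℕ) : ℤ)) *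
        (τ.phi ν i p.1 (τ.kap (Finsupp.single i (p.2 : ℤ)) a) * τ.phi ν i p.2 a') := by
  classical
  suffices h : ∀ w s, τ.phi ν i l (τ.bas w s * a') =
      ∑ p ∈ Finset.HasAntidiagonal.antidiagonal l, D.qpar i ^ (-((p.1 * p.2 : ℕ) : ℤ)) *
        (τ.phi ν i p.1 (τ.kap (Finsupp.single i (p.2 : ℤ)) (τ.bas w s)) * τ.phi ν i p.2 a') by
    have h' : τ.phi ν i l ∘ₗ LinearMap.mulRight K a' =
        ∑ p ∈ Finset.HasAntidiagonal.antidiagonal l, (D.qpar i ^ (-((p.1 * p.2 : ℕ) : ℤ)) *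
          τ.phi ν i p.2 a') •
          (τ.phi ν i p.1 ∘ₗ (τ.kap (Finsupp.single i (p.2 : ℤ))).toLinearMap) := by
      refine linearMap_ext_bas fun w s => ?_
      rw [LinearMap.comp_apply, LinearMap.mulRight_apply, h, LinearMap.sum_apply]
      refine Finset.sum_congr rfl fun p _ => ?_
      simp only [LinearMap.smul_apply, LinearMap.comp_apply, smul_eq_mul, AlgHom.toLinearMap_apply]
      ring
    have h2 := DFunLike.congr_fun h' a
    rw [LinearMap.comp_apply, LinearMap.mulRight_apply, LinearMap.sum_apply] at h2
    rw [h2]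
    refine Finset.sum_congr rfl fun p _ => ?_
    simp only [LinearMap.smul_apply, LinearMap.comp_apply, smul_eq_mul, AlgHom.toLinearMap_apply]
    ring
  intro w s
  induction w generalizing l with
  | nil =>
    rw [bas, mon_nil, map_one, one_mul, phi_t_mul, Finset.sum_eq_single (0, l)]
    · simp [phi_zero, kap_t, counitHom_t]
    · intro p hp hne
      have hp' : p.1 + p.2 = l := Finset.HasAntidiagonal.mem_antidiagonal.1 hp
      have h0 : p.1 ≠ 0 := fun h0 => hne (Prod.ext h0 (by dsimp only; omega))
      have : τ.phi ν i p.1 (τ.t s) = 0 := by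
        rw [← mul_one (τ.t s), phi_t_mul, ← bas_nil_zero, phi, functional_bas, pairGenWord_nil,
          if_neg h0, mul_zero]
      simp [kap_t, this]
    · simp
  | cons x w ih =>
    rw [← f_mul_bas, mul_assoc, phi_f_mul]
    simp only [map_mul, kap_f, phi_f_mul]
    by_cases hi : x.idx = i
    · simp only [hi, true_and]
      split_ifs with hd
      · obtain ⟨l', rfl⟩ := Nat.exists_eq_add_of_le hd
        rw [ih, Nat.add_sub_cancel_left, Finset.mul_sum]
        refine (sum_antidiagonal_shift x.deg l' fun m n =>
          D.qpar i ^ (-((x.deg * l' : ℕ) : ℤ)) * ν x * (D.qpar i ^ (-((m * n : ℕ) : ℤ)) *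
            (τ.phi ν i m (τ.kap (Finsupp.single i (n : ℤ)) (τ.bas w s)) *
              τ.phi ν i n a'))).symm.trans (Finset.sum_congr rfl fun p hp => ?_)
        have hp' : p.1 + p.2 = x.deg + l' := Finset.HasAntidiagonal.mem_antidiagonal.1 hp
        split_ifs with hp1
        · obtain ⟨m, hm⟩ := Nat.exists_eq_add_of_le hp1
          have hl' : l' = m + p.2 := by omega
          rw [hm, Nat.add_sub_cancel_left, hl']
          have e : D.qpar i ^ (-((x.deg * (m + p.2) : ℕ) : ℤ)) *
              D.qpar i ^ (-((m * p.2 : ℕ) : ℤ)) =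
              D.qpar i ^ (-(((x.deg + m) * p.2 : ℕ) : ℤ)) *
              D.qpar i ^ (-((x.deg * m : ℕ) : ℤ)) := by
            rw [← zpow_add₀ (qpar_ne_zero _), ← zpow_add₀ (qpar_ne_zero _)]
            congr 1; push_cast; ring
          linear_combination (ν x * ((τ.phi ν i m) ((τ.kap fun₀ | i => (p.2 : ℤ)) (τ.bas w s)) *
            (τ.phi ν i p.2) a')) * e
        · ring
      · symm
        refine Finset.sum_eq_zero fun p hp => ?_
        have hp' : p.1 + p.2 = l := Finset.HasAntidiagonal.mem_antidiagonal.1 hp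
        rw [if_neg (by omega)]; ring
    · simp [hi]

/-- The pullback of functionals along the multiplication of `H`. -/
def pullMul : WithConv (τ.H →ₗ[K] K) →ₐ[K] WithConv (τ.H ⊗[K] τ.H →ₗ[K] K) :=
  AlgHom.ofLinearMap
    { toFun := fun g => toConv (g.ofConv ∘ₗ LinearMap.mul' K τ.H)
      map_add' := fun _ _ => rfl
      map_smul' := fun _ _ => rfl }
    (WithConv.ext (by
      ext a b
      change τ.counitHom (a * b) = Coalgebra.counit (R := K) (a ⊗ₜ[K] b)
      rw [map_mul]
      exact mul_comm _ _))
    (fun g g' => WithConv.ext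
      (LinearMap.convMul_comp_coalgHom_distrib g g' (Bialgebra.mulCoalgHom K τ.H)))

theorem pullMul_apply (g : WithConv (τ.H →ₗ[K] K)) (a b : τ.H) :
    τ.pullMul g (a ⊗ₜ[K] b) = g (a * b) := rfl

/-- The linear map `b ⊗ b' ↦ (a ⊗ a' ↦ (a, b)_L (a', b')_L)`. -/
def pairTensorLin : D.rootTorus.H ⊗[K] D.rootTorus.H →ₗ[K] WithConv (τ.H ⊗[K] τ.H →ₗ[K] K) :=
  TensorProduct.lift (LinearMap.mk₂ K
    (fun b b' => toConv (LinearMap.mul' K K ∘ₗ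
      TensorProduct.map (τ.pair ν b).ofConv (τ.pair ν b').ofConv))
    (fun b c b' => by
      refine WithConv.ext (TensorProduct.ext' fun x y => ?_); simp [add_mul])
    (fun c b b' => by
      refine WithConv.ext (TensorProduct.ext' fun x y => ?_); simp [mul_assoc])
    (fun b c b' => by
      refine WithConv.ext (TensorProduct.ext' fun x y => ?_); simp [mul_add])
    (fun c b b' => by
      refine WithConv.ext (TensorProduct.ext' fun x y => ?_); simp [mul_left_comm]))

theorem pairTensorLin_apply (b b' : D.rootTorus.H) (a a' : τ.H) :
    τ.pairTensorLin ν (b ⊗ₜ[K] b') (a ⊗ₜ[K] a') = τ.pair ν b a * τ.pair ν b' a' := rfl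

/-- The map of `pairTensorLin` is multiplicative. -/
def pairTensor : D.rootTorus.H ⊗[K] D.rootTorus.H →ₐ[K] WithConv (τ.H ⊗[K] τ.H →ₗ[K] K) :=
  Algebra.TensorProduct.algHomOfLinearMapTensorProduct (τ.pairTensorLin ν)
    (fun b c b' c' => by
      have h := TensorProduct.map_convMul_map (f := τ.pair ν b) (h := τ.pair ν c)
        (g := τ.pair ν b') (k := τ.pair ν c')
      have h' := LinearMap.algHom_comp_convMul_distrib (Algebra.TensorProduct.lmul' K (S := K))
        (toConv (TensorProduct.map (τ.pair ν b).ofConv (τ.pair ν b').ofConv))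
        (toConv (TensorProduct.map (τ.pair ν c).ofConv (τ.pair ν c').ofConv))
      rw [h, ← map_mul, ← map_mul] at h'
      exact WithConv.ext h')
    (WithConv.ext (TensorProduct.ext' fun x y => by
      rw [pairTensorLin_apply, map_one]
      exact mul_comm _ _))

theorem pairTensor_tmul (b b' : D.rootTorus.H) (a a' : τ.H) :
    τ.pairTensor ν (b ⊗ₜ[K] b') (a ⊗ₜ[K] a') = τ.pair ν b a * τ.pair ν b' a' := rfl

/-- Multiplicativity of the pairing in the first argument: `(a a', b) = (a ⊗ a', Δ(b))`. -/
theorem pair_mul (b : D.rootTorus.H) (a a' : τ.H) :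
    τ.pair ν b (a * a') = τ.pairTensor ν (D.rootTorus.comulHom b) (a ⊗ₜ[K] a') := by
  suffices h : τ.pullMul.comp (τ.pair ν) = (τ.pairTensor ν).comp D.rootTorus.comulHom by
    rw [← pullMul_apply, ← AlgHom.comp_apply, h, AlgHom.comp_apply]
  refine algHom_ext (fun x => ?_) (fun γ => ?_)
  · refine WithConv.ext (TensorProduct.ext' fun a a' => ?_)
    rw [AlgHom.comp_apply, pullMul_apply, pair_f, AlgHom.comp_apply, comulHom_f, comulGen, map_sum,
      ofConv_sum, LinearMap.sum_apply]
    refine (τ.phi_mul ν _ _ _ _).trans (Finset.sum_congr rfl fun p hp => ?_)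
    have hp' : p.1 + p.2 = x.deg := Finset.HasAntidiagonal.mem_antidiagonal.1 hp
    rw [map_smul, ofConv_smul, LinearMap.smul_apply, pairTensor_tmul, map_mul,
      pair_fgen _ _ x (by omega), pair_fgen _ _ x (by omega), pair_t, convMul_chi]
    rfl
  · refine WithConv.ext (TensorProduct.ext' fun a a' => ?_)
    rw [AlgHom.comp_apply, pullMul_apply, pair_t, AlgHom.comp_apply, comulHom_t, pairTensor_tmul,
      pair_t]
    exact map_mul (τ.chi γ) a a'

end Torus

end Pairing

/-! ### The bilinear form on `F` -/

section Form

variable {I : Type*} {P : Type*} [AddCommGroup P] {D : Datum I P}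

open WithConv

theorem twistMul_mon (x₁ x₂ y₁ y₂ : List D.Iinf) :
    D.twistMul (mon x₁ ⊗ₜ[K] mon x₂) (mon y₁ ⊗ₜ[K] mon y₂) =
      q ^ (-D.rootForm (D.wt x₂) (D.wt y₁)) • (mon (x₁ ++ y₁) ⊗ₜ[K] mon (x₂ ++ y₂)) := by
  rw [twistMul, TensorProduct.lift.tmul, linExt_mon, linExt_mon, TensorProduct.lift.tmul,
    linExt_mon, linExt_mon]

/-- A linear map out of `F ⊗ F` is determined by its values on pairs of monomials. -/
theorem linearMap_ext_mon_tmul {X Y M : Type*} [AddCommMonoid M] [Module K M]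
    {f g : FreeAlgebra K X ⊗[K] FreeAlgebra K Y →ₗ[K] M}
    (h : ∀ u v, f (mon u ⊗ₜ[K] mon v) = g (mon u ⊗ₜ[K] mon v)) : f = g :=
  TensorProduct.ext (linearMap_ext_mon fun u => linearMap_ext_mon fun v => h u v)

theorem rootForm_neg_left (β γ : I →₀ ℤ) : D.rootForm (-β) γ = -D.rootForm β γ := by
  rw [← rootFormHom_apply, ← rootFormHom_apply, map_neg, AddMonoidHom.neg_apply]

theorem rho_mon (w : List D.Iinf) : D.rho (mon w) = D.rhoWord w := by rw [rho, linExt_mon]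

/-- `f_il` is zero or a monomial of weight `-l α_i`. -/
theorem exists_mon_of_fgen (i : I) (l : ℕ) :
    D.fgen i l = 0 ∨ ∃ w, D.fgen i l = mon w ∧ D.wt w = Finsupp.single i (-(l : ℤ)) := by
  by_cases h : 0 < l ∧ (D.IsReal i → l = 1)
  · right
    refine ⟨[Iinf.of h], by rw [fgen_of_valid h, mon_singleton], ?_⟩
    simp [wt_cons, wt_nil, Iinf.idx_of, Iinf.deg_of]
  · by_cases hl : l = 0
    · right
      subst hl
      exact ⟨[], by rw [fgen_zero, mon_nil], by simp [wt_nil]⟩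
    · exact Or.inl (fgen_of_not_valid hl h)

namespace Torus

variable {T : Type*} [AddCommGroup T] (τ : D.Torus T)

/-- The map `u ⊗ v ↦ u K_{-|v|} ⊗ v`, which turns the twisted multiplication of `F ⊗ F` into the
multiplication of `H ⊗ H`. -/
def untwist : D.F ⊗[K] D.F →ₗ[K] τ.H ⊗[K] τ.H :=
  TensorProduct.lift (linExt fun u => linExt fun v =>
    (τ.incl (mon u) * τ.t (τ.k (-(D.wt v)))) ⊗ₜ[K] τ.incl (mon v))

theorem untwist_mon (u v : List D.Iinf) : τ.untwist (mon u ⊗ₜ[K] mon v) =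
    (τ.incl (mon u) * τ.t (τ.k (-(D.wt v)))) ⊗ₜ[K] τ.incl (mon v) := by
  rw [untwist, TensorProduct.lift.tmul, linExt_mon, linExt_mon]

/-- The factors `K_{-|v|}` produce the powers of `q` in the twisted multiplication. -/
theorem untwist_twistMul (s s' : D.F ⊗[K] D.F) :
    τ.untwist (D.twistMul s s') = τ.untwist s * τ.untwist s' := by
  suffices h : D.twistMul.compr₂ τ.untwist =
      (LinearMap.mul K (τ.H ⊗[K] τ.H)).compl₁₂ τ.untwist τ.untwist from
    DFunLike.congr_fun (DFunLike.congr_fun h s) s'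
  refine linearMap_ext_mon_tmul fun x₁ x₂ => linearMap_ext_mon_tmul fun y₁ y₂ => ?_
  rw [LinearMap.compr₂_apply, LinearMap.compl₁₂_apply, LinearMap.mul_apply', twistMul_mon,
    map_smul, untwist_mon, untwist_mon, untwist_mon, Algebra.TensorProduct.tmul_mul_tmul,
    mul_assoc (τ.incl (mon x₁)), ← mul_assoc (τ.t _), t_mul_incl_mon, ev_k, smul_mul_assoc,
    mul_smul_comm, ← TensorProduct.smul_tmul', rootForm_neg_left, wt_append, neg_add, map_add, t_add,
    mon_append, mon_append, map_mul,
    map_mul, mul_assoc (τ.incl (mon y₁)), ← mul_assoc (τ.incl (mon x₁))]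

theorem untwist_fgen (i : I) (m n : ℕ) : τ.untwist (D.fgen i m ⊗ₜ[K] D.fgen i n) =
    (τ.incl (D.fgen i m) * τ.t (τ.kpow i n)) ⊗ₜ[K] τ.incl (D.fgen i n) := by
  rcases exists_mon_of_fgen (D := D) i n with h | ⟨v, hv, hw⟩
  · simp [h]
  rcases exists_mon_of_fgen (D := D) i m with h | ⟨u, hu, -⟩
  · simp [h]
  rw [hu, hv, untwist_mon, hw, ← Finsupp.single_neg, neg_neg, kpow]

theorem untwist_rhoGen (x : D.Iinf) : τ.untwist (D.rhoGen x) = τ.comulGen x.idx x.deg := by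
  rw [rhoGen, map_sum, comulGen]
  exact Finset.sum_congr rfl fun p _ => by rw [map_smul, untwist_fgen]

/-- The comultiplication of `H` restricts to the twisted comultiplication of `F`. -/
theorem comulHom_incl (z : D.F) : τ.comulHom (τ.incl z) = τ.untwist (D.rho z) := by
  suffices h : τ.comulHom.toLinearMap ∘ₗ τ.incl.toLinearMap = τ.untwist ∘ₗ D.rho from
    DFunLike.congr_fun h z
  refine linearMap_ext_mon fun w => ?_
  rw [LinearMap.comp_apply, LinearMap.comp_apply, rho_mon]
  induction w with
  | nil =>
    rw [rhoWord, ← mon_nil, untwist_mon]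
    simp [mon_nil, wt_nil, t_zero, Algebra.TensorProduct.one_def]
  | cons x w ih =>
    rw [rhoWord, untwist_twistMul, ← ih, untwist_rhoGen, mon_cons]
    simp [incl_ι, comulHom_f]

variable (ν : D.Iinf → K)

theorem form_mon_right (z : D.F) (w : List D.Iinf) : D.form ν z (mon w) = D.pairWord ν w z := by
  rw [form, LinearMap.flip_apply, linExt_mon]

theorem pair_incl_mon (w u : List D.Iinf) (h : T) :
    τ.pair ν (D.rootTorus.incl (mon w)) (τ.bas u h) = D.pairWord ν w (mon u) := by
  induction w generalizing u h with
  | nil =>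
    rw [mon_nil, map_one, map_one, pairWord, linExt_mon]
    change τ.counitHom (τ.bas u h) = _
    cases u with
    | nil => simp [bas, mon_nil, counitHom_t]
    | cons x w => simp [bas, mon_cons, incl_ι, counitHom_f]
  | cons x w ih =>
    rw [mon_cons, map_mul, map_mul, incl_ι, pair_f, LinearMap.convMul_apply, comul_eq, bas,
      map_mul, comulHom_incl, comulHom_t, pairWord, LinearMap.comp_apply, LinearMap.comp_apply]
    congr 1
    generalize D.rho (mon u) = s
    suffices e : TensorProduct.map (τ.phi ν x.idx x.deg) (τ.pair ν (D.rootTorus.incl (mon w))).ofConv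
        ∘ₗ LinearMap.mulRight K (τ.t h ⊗ₜ[K] τ.t h) ∘ₗ τ.untwist =
        TensorProduct.map (linExt (D.pairGenWord ν x.idx x.deg)) (D.pairWord ν w) from
      DFunLike.congr_fun e s
    refine linearMap_ext_mon_tmul fun a b => ?_
    rw [LinearMap.comp_apply, LinearMap.comp_apply, untwist_mon, LinearMap.mulRight_apply,
      Algebra.TensorProduct.tmul_mul_tmul, TensorProduct.map_tmul, TensorProduct.map_tmul,
      mul_assoc, ← t_add]
    change (τ.phi ν x.idx x.deg) (τ.bas a _) ⊗ₜ[K] τ.pair ν (D.rootTorus.incl (mon w))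
      (τ.bas b h) = _
    rw [ih, phi, functional_bas, linExt_mon]

/-- The pairing restricts to the form on `F`. -/
theorem pair_incl (z y : D.F) (h : T) :
    τ.pair ν (D.rootTorus.incl y) (τ.incl z * τ.t h) = D.form ν z y := by
  let L : D.F →ₗ[K] D.F →ₗ[K] K :=
    LinearMap.mk₂ K (fun y z => τ.pair ν (D.rootTorus.incl y) (τ.incl z * τ.t h))
      (by intros; simp) (by intros; simp) (by intros; simp [add_mul]) (by intros; simp)
  suffices e : L = (D.form ν).flip from DFunLike.congr_fun (DFunLike.congr_fun e y) z
  refine linearMap_ext_mon fun w => linearMap_ext_mon fun u => ?_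
  rw [LinearMap.flip_apply, form_mon_right, ← τ.pair_incl_mon ν w u h]
  rfl

theorem pair_incl' (z y : D.F) : τ.pair ν (D.rootTorus.incl y) (τ.incl z) = D.form ν z y := by
  have := τ.pair_incl ν z y 0
  rwa [t_zero, mul_one] at this

/-- The pairing of normally ordered monomials: `(x q^h, y K_β)_L = (x, y)_L q^(-⟨h, β⟩)`. -/
theorem pair_bas (w u : List D.Iinf) (β : I →₀ ℤ) (h : T) :
    τ.pair ν (D.rootTorus.bas w β) (τ.bas u h) =
      D.form ν (mon u) (mon w) * q ^ (-(τ.ev h β)) := by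
  rw [bas, map_mul, pair_t, convMul_chi, kap_bas, map_smul, bas, pair_incl, smul_eq_mul, mul_comm]

end Torus

open Torus

variable (ν : D.Iinf → K)

/-- The form is multiplicative in the second argument: `(z, y y')_L = (ϱ(z), y ⊗ y')_L`. -/
theorem form_mul_right (z y y' : D.F) : D.form ν z (y * y') =
    LinearMap.mul' K K (TensorProduct.map ((D.form ν).flip y) ((D.form ν).flip y') (D.rho z)) := by
  rw [← D.rootTorus.pair_incl', map_mul, map_mul, LinearMap.convMul_apply, comul_eq, comulHom_incl]
  congr 1
  generalize D.rho z = s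
  suffices e : TensorProduct.map (D.rootTorus.pair ν (D.rootTorus.incl y)).ofConv
      (D.rootTorus.pair ν (D.rootTorus.incl y')).ofConv ∘ₗ D.rootTorus.untwist =
      TensorProduct.map ((D.form ν).flip y) ((D.form ν).flip y') from DFunLike.congr_fun e s
  refine linearMap_ext_mon_tmul fun a b => ?_
  rw [LinearMap.comp_apply, untwist_mon, TensorProduct.map_tmul, TensorProduct.map_tmul]
  exact congrArg₂ _ (D.rootTorus.pair_incl ν _ _ _) (D.rootTorus.pair_incl' ν _ _)

/-- The form is multiplicative in the first argument: `(z z', y)_L = (z ⊗ z', ϱ(y))_L`. -/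
theorem form_mul_left (z z' y : D.F) : D.form ν (z * z') y =
    LinearMap.mul' K K (TensorProduct.map (D.form ν z) (D.form ν z') (D.rho y)) := by
  rw [← D.rootTorus.pair_incl', map_mul, pair_mul, comulHom_incl]
  generalize D.rho y = s
  let L : WithConv (D.rootTorus.H ⊗[K] D.rootTorus.H →ₗ[K] K) →ₗ[K] K :=
    { toFun := fun g => g (D.rootTorus.incl z ⊗ₜ[K] D.rootTorus.incl z')
      map_add' := fun _ _ => rfl
      map_smul' := fun _ _ => rfl }
  suffices e : L ∘ₗ (D.rootTorus.pairTensor ν).toLinearMap ∘ₗ D.rootTorus.untwist =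
      LinearMap.mul' K K ∘ₗ TensorProduct.map (D.form ν z) (D.form ν z') from
    DFunLike.congr_fun e s
  refine linearMap_ext_mon_tmul fun a b => ?_
  rw [LinearMap.comp_apply, LinearMap.comp_apply, LinearMap.comp_apply, untwist_mon,
    TensorProduct.map_tmul, LinearMap.mul'_apply]
  change D.rootTorus.pair ν (D.rootTorus.incl (mon a) * D.rootTorus.t _) (D.rootTorus.incl z) *
    D.rootTorus.pair ν (D.rootTorus.incl (mon b)) (D.rootTorus.incl z') = _
  rw [map_mul, pair_t, convMul_chi, kap_incl, pair_incl', pair_incl']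

theorem form_one_right (w : List D.Iinf) : D.form ν (mon w) 1 = if w = [] then 1 else 0 := by
  rw [← mon_nil, form_mon_right, pairWord, linExt_mon]

theorem form_one_left (w : List D.Iinf) : D.form ν 1 (mon w) = if w = [] then 1 else 0 := by
  rw [← D.rootTorus.pair_incl', map_one]
  have h1 : D.rootTorus.pair ν (D.rootTorus.incl (mon w)) 1 =
      D.rootTorus.counitHom (D.rootTorus.incl (mon w)) := by
    induction w with
    | nil =>
      rw [mon_nil, map_one D.rootTorus.incl, map_one (D.rootTorus.pair ν)]
      rfl
    | cons x w ih =>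
      rw [mon_cons, map_mul, map_mul, map_mul, LinearMap.convMul_apply, comul_eq, map_one,
        Algebra.TensorProduct.one_def, TensorProduct.map_tmul, LinearMap.mul'_apply, ih, incl_ι,
        counitHom_f, zero_mul, pair_f]
      change D.rootTorus.phi ν x.idx x.deg 1 * _ = 0
      rw [← bas_nil_zero, phi, functional_bas, pairGenWord_nil,
        if_neg (by have := x.deg_pos; omega), zero_mul]
  rw [h1]
  cases w with
  | nil => simp [mon_nil]
  | cons x w => simp [mon_cons, incl_ι, counitHom_f]

theorem form_ι_right {x : D.Iinf} (w : List D.Iinf) :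
    D.form ν (mon w) (FreeAlgebra.ι K x) = D.pairGenWord ν x.idx x.deg w := by
  rw [← D.rootTorus.pair_incl', incl_ι, pair_f]
  have : D.rootTorus.incl (mon w) = D.rootTorus.bas w 0 := by rw [bas, t_zero, mul_one]
  rw [this]
  exact D.rootTorus.functional_bas _ _ _

end Form

/-! ### Symmetry and orthogonality of the form -/

section FormSymm

variable {I : Type*} {P : Type*} [AddCommGroup P] {D : Datum I P} (ν : D.Iinf → K)

theorem twistMul_one (s : D.F ⊗[K] D.F) : D.twistMul s (1 ⊗ₜ[K] 1) = s := by
  suffices h : D.twistMul.flip (1 ⊗ₜ[K] 1) = LinearMap.id from DFunLike.congr_fun h s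
  refine linearMap_ext_mon_tmul fun u v => ?_
  rw [LinearMap.flip_apply, ← mon_nil, twistMul_mon, wt_nil, List.append_nil, List.append_nil,
    ← rootFormHom_apply, map_zero]
  simp

theorem rho_ι (x : D.Iinf) : D.rho (FreeAlgebra.ι K x) = D.rhoGen x := by
  rw [← mon_singleton, rho_mon, rhoWord, rhoWord, twistMul_one]

theorem form_ι_ι (x y : D.Iinf) [Decidable (x = y)] :
    D.form ν (FreeAlgebra.ι K x) (FreeAlgebra.ι K y) = if x = y then ν x else 0 := by
  rw [← mon_singleton x, form_ι_right, pairGenWord_cons, pairGenWord_nil]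
  by_cases h : x = y
  · subst h; simp
  · rw [if_neg h]
    split_ifs with h1 h2
    · exact absurd (Iinf.ext h1.1 (by omega)) h
    · simp
    · rfl

theorem form_ι_fgen_comm (x : D.Iinf) (i : I) (m : ℕ) :
    D.form ν (FreeAlgebra.ι K x) (D.fgen i m) = D.form ν (D.fgen i m) (FreeAlgebra.ι K x) := by
  classical
  by_cases h : 0 < m ∧ (D.IsReal i → m = 1)
  · rw [fgen_of_valid h, form_ι_ι, form_ι_ι]
    by_cases hx : x = Iinf.of h
    · rw [if_pos hx, if_pos hx.symm, hx]
    · rw [if_neg hx, if_neg (Ne.symm hx)]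
  · by_cases hm : m = 0
    · subst hm
      rw [fgen_zero, ← mon_singleton, form_one_left, form_one_right]
    · rw [fgen_of_not_valid hm h]; simp

/-- Symmetry of the form, if one argument is a generator: both sides obey the same recursion in the
length of the word. -/
theorem form_mon_fgen_comm (u : List D.Iinf) (i : I) (m : ℕ) :
    D.form ν (mon u) (D.fgen i m) = D.form ν (D.fgen i m) (mon u) := by
  induction u generalizing i m with
  | nil =>
    rcases exists_mon_of_fgen (D := D) i m with h | ⟨w, hw, -⟩
    · simp [h]
    · rw [hw, mon_nil, form_one_left, form_one_right]
  | cons y u ih =>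
    by_cases h : 0 < m ∧ (D.IsReal i → m = 1)
    · rw [fgen_of_valid h, mon_cons, form_mul_left, form_mul_right, rho_ι, rhoGen]
      simp only [map_sum, map_smul, TensorProduct.map_tmul, LinearMap.mul'_apply,
        LinearMap.flip_apply, ih, form_ι_fgen_comm]
    · by_cases hm : m = 0
      · subst hm
        rw [fgen_zero, form_one_left, form_one_right]
      · rw [fgen_of_not_valid hm h]; simp

/-- The form on `F` is symmetric. -/
theorem form_comm (z y : D.F) : D.form ν z y = D.form ν y z := by
  suffices h : ∀ w, (D.form ν).flip (mon w) = D.form ν (mon w) by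
    have : (D.form ν).flip = D.form ν := linearMap_ext_mon h
    rw [← this, LinearMap.flip_apply, this]
  intro w
  induction w with
  | nil =>
    refine linearMap_ext_mon fun u => ?_
    rw [LinearMap.flip_apply, mon_nil, form_one_left, form_one_right]
  | cons x w ih =>
    have hx : (D.form ν).flip (FreeAlgebra.ι K x) = D.form ν (FreeAlgebra.ι K x) := by
      refine linearMap_ext_mon fun u => ?_
      rw [LinearMap.flip_apply, ← fgen_self, form_mon_fgen_comm]
    refine LinearMap.ext fun u => ?_
    rw [mon_cons, form_mul_left, ← ih, ← hx, LinearMap.flip_apply, form_mul_right]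

/-- The span of the `u ⊗ v` with `|u| + |v| = β`. -/
def homogTensor (β : I →₀ ℤ) : Submodule K (D.F ⊗[K] D.F) :=
  Submodule.span K {s | ∃ u v, D.wt u + D.wt v = β ∧ s = mon u ⊗ₜ[K] mon v}

theorem twistMul_mem {β γ : I →₀ ℤ} {s s' : D.F ⊗[K] D.F} (hs : s ∈ homogTensor (D := D) β)
    (hs' : s' ∈ homogTensor (D := D) γ) : D.twistMul s s' ∈ homogTensor (D := D) (β + γ) := by
  have h := Submodule.apply_mem_map₂ D.twistMul hs hs'
  rw [homogTensor, homogTensor, Submodule.map₂_span_span] at h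
  refine Submodule.span_le.2 ?_ h
  rintro _ ⟨_, ⟨u, v, huv, rfl⟩, _, ⟨u', v', huv', rfl⟩, rfl⟩
  beta_reduce
  rw [twistMul_mon]
  refine Submodule.smul_mem _ _ (Submodule.subset_span ⟨_, _, ?_, rfl⟩)
  rw [wt_append, wt_append, ← huv, ← huv']
  abel

theorem rhoGen_mem (x : D.Iinf) : D.rhoGen x ∈ homogTensor (D := D) (D.wt [x]) := by
  refine Submodule.sum_mem _ fun p hp => Submodule.smul_mem _ _ ?_
  have hp' : p.1 + p.2 = x.deg := Finset.HasAntidiagonal.mem_antidiagonal.1 hp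
  rcases exists_mon_of_fgen (D := D) x.idx p.1 with h | ⟨u, hu, hu'⟩
  · simp [h]
  rcases exists_mon_of_fgen (D := D) x.idx p.2 with h | ⟨v, hv, hv'⟩
  · simp [h]
  rw [hu, hv]
  refine Submodule.subset_span ⟨u, v, ?_, rfl⟩
  rw [hu', hv', wt_cons, wt_nil, add_zero, ← Finsupp.single_add, ← hp']
  congr 1; push_cast; ring

theorem rhoWord_mem (w : List D.Iinf) : D.rhoWord w ∈ homogTensor (D := D) (D.wt w) := by
  induction w with
  | nil => exact Submodule.subset_span ⟨[], [], by simp [wt_nil], rfl⟩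
  | cons x w ih =>
    have e : D.wt (x :: w) = D.wt [x] + D.wt w := by simp [wt_cons, wt_nil]
    rw [rhoWord, e]
    exact twistMul_mem (rhoGen_mem x) ih

/-- The twisted comultiplication preserves weights. -/
theorem rho_mem {β : I →₀ ℤ} {z : D.F} (hz : z ∈ D.homog β) :
    D.rho z ∈ homogTensor (D := D) β := by
  refine homog_induction (p := fun z => D.rho z ∈ homogTensor (D := D) β) ?_ ?_ ?_ ?_ hz
  · simp
  · intro a b ha hb; rw [map_add]; exact add_mem ha hb
  · intro c a ha; rw [map_smul]; exact Submodule.smul_mem _ _ ha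
  · intro w hw; rw [rho_mon, ← hw]; exact rhoWord_mem w

/-- Monomials of different weights are orthogonal. -/
theorem form_mon_eq_zero {u w : List D.Iinf} (h : D.wt u ≠ D.wt w) :
    D.form ν (mon u) (mon w) = 0 := by
  induction w generalizing u with
  | nil =>
    rw [mon_nil, form_one_right, if_neg]
    rintro rfl
    exact h rfl
  | cons x w ih =>
    rw [mon_cons, form_mul_right, rho_mon]
    have hmem := rhoWord_mem (D := D) u
    revert hmem
    generalize D.rhoWord u = s
    intro hmem
    induction hmem using Submodule.span_induction with
    | zero => simp
    | add s s' _ _ hs hs' => rw [map_add, map_add, hs, hs', add_zero]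
    | smul c s _ hs => rw [map_smul, map_smul, hs, smul_zero]
    | mem s hs =>
      obtain ⟨a, b, hab, rfl⟩ := hs
      rw [TensorProduct.map_tmul, LinearMap.mul'_apply, LinearMap.flip_apply,
        LinearMap.flip_apply]
      by_cases hb : D.wt b = D.wt w
      · rw [form_ι_right, pairGenWord_eq_zero, zero_mul]
        intro ha
        apply h
        rw [← hab, hb, ha, wt_cons]
      · rw [ih hb, mul_zero]

theorem form_homog_eq_zero {β γ : I →₀ ℤ} (h : β ≠ γ) {z y : D.F} (hz : z ∈ D.homog β)
    (hy : y ∈ D.homog γ) : D.form ν z y = 0 := by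
  refine homog_induction (p := fun z => D.form ν z y = 0) ?_ ?_ ?_ ?_ hz
  · simp
  · intro a b ha hb; rw [map_add, LinearMap.add_apply, ha, hb, add_zero]
  · intro c a ha; rw [map_smul, LinearMap.smul_apply, ha, smul_zero]
  · intro u hu
    refine homog_induction (p := fun y => D.form ν (mon u) y = 0) ?_ ?_ ?_ ?_ hy
    · simp
    · intro a b ha hb; rw [map_add, ha, hb, add_zero]
    · intro c a ha; rw [map_smul, ha, smul_zero]
    · intro w hw; exact form_mon_eq_zero ν (by rw [hu, hw]; exact h)

end FormSymm

/-! ### Comparison with the pairing of the non-positive half -/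

section Compare

variable {I : Type*} {P : Type*} [AddCommGroup P] (D : Datum I P) (ν : D.Iinf → K)

/-- The exponents of the `K_β` determine `β`: the fundamental weights separate the coroots. -/
theorem kExp_injective : Function.Injective D.kExp := by
  classical
  intro β γ h
  ext i
  obtain ⟨Λ, h1, h0⟩ := D.fundamental i
  have key : ∀ β : I →₀ ℤ, D.kExp β Λ = β i * D.r i := by
    intro β
    rw [kExp, Finsupp.sum, LinearMap.sum_apply, Finset.sum_eq_single i]
    · simp [h1]
    · intro j _ hj; simp [h0 j hj]
    · intro hi; simp [Finsupp.notMem_support_iff.1 hi]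
  have h2 := key β
  rw [h, key γ] at h2
  have hr : (D.r i : ℤ) ≠ 0 := by have := D.r_pos i; omega
  exact (mul_right_cancel₀ hr h2).symm

theorem kExp_root (β γ : I →₀ ℤ) : D.kExp β (D.root γ) = D.rootForm β γ := by
  rw [← D.coTorus.ev_k, coTorus_ev, coTorus_k]

theorem torForm_kExp (h : Module.Dual ℤ P) (β : I →₀ ℤ) :
    D.torForm h (D.kExp β) = q ^ (-(h (D.root β))) := by
  have H : ∃ γ, D.kExp β = D.kExp γ := ⟨β, rfl⟩
  have hc := D.kExp_injective H.choose_spec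
  rw [torForm, dif_pos H, ← hc]

theorem torForm_kExp_left (h : Module.Dual ℤ P) (β : I →₀ ℤ) :
    D.torForm (D.kExp β) h = q ^ (-(h (D.root β))) := by
  by_cases H : ∃ γ, h = D.kExp γ
  · obtain ⟨γ, rfl⟩ := H
    rw [torForm_kExp, kExp_root, kExp_root, rootForm_comm]
  · have H' : ∃ γ, D.kExp β = D.kExp γ := ⟨β, rfl⟩
    have hc := D.kExp_injective H'.choose_spec
    rw [torForm, dif_neg H, dif_pos H', ← hc]

/-- The free algebra on the `f_il` and the `K_β`. -/
abbrev B₂ : Type _ := FreeAlgebra K (D.Iinf ⊕ (I →₀ ℤ))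

/-- The map `K_β ↦ q^(Σ β_i r_i h_i)`. -/
def B₂toB : D.B₂ →ₐ[K] D.B :=
  FreeAlgebra.lift K fun x => FreeAlgebra.ι K (Sum.map id D.kExp x)

theorem B₂toB_mon (v : List (D.Iinf ⊕ (I →₀ ℤ))) :
    D.B₂toB (mon v) = mon (v.map (Sum.map id D.kExp)) := by
  rw [B₂toB, lift_mon, mon, List.map_map]; rfl

/-- Normal ordering of a word in the `f_il` and `q^h` computes its image in `H`. -/
theorem proj_mon_eq_bas (u : List (D.Iinf ⊕ Module.Dual ℤ P)) :
    D.coTorus.proj (mon u) =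
      (D.normalOrder u).1 • D.coTorus.bas (D.normalOrder u).2.1 (D.normalOrder u).2.2 := by
  induction u with
  | nil => rw [mon_nil, map_one, normalOrder, Torus.bas_nil_zero, one_smul]
  | cons x u ih =>
    cases x with
    | inl x =>
      rw [mon_cons, map_mul, ih, normalOrder, mul_smul_comm, ← Torus.f_mul_bas]; rfl
    | inr h =>
      rw [mon_cons, map_mul, ih, normalOrder, mul_smul_comm]
      change _ • (D.coTorus.t h * _) = _
      rw [Torus.t_mul_bas, smul_smul, coTorus_ev, mul_comm]

/-- Normal ordering of a word in the `f_il` and `K_β` has torus part some `K_β` and computes the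
image of the word in `H`. -/
theorem normalOrder_B₂ (v : List (D.Iinf ⊕ (I →₀ ℤ))) : ∃ β : I →₀ ℤ,
    (D.normalOrder (v.map (Sum.map id D.kExp))).2.2 = D.kExp β ∧
    D.rootTorus.proj (mon v) = (D.normalOrder (v.map (Sum.map id D.kExp))).1 •
      D.rootTorus.bas (D.normalOrder (v.map (Sum.map id D.kExp))).2.1 β := by
  induction v with
  | nil =>
    refine ⟨0, by rw [List.map_nil, normalOrder, ← coTorus_k, map_zero], ?_⟩
    rw [mon_nil, map_one, List.map_nil, normalOrder, Torus.bas_nil_zero, one_smul]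
  | cons x v ih =>
    obtain ⟨β, h1, h2⟩ := ih
    cases x with
    | inl x =>
      refine ⟨β, h1, ?_⟩
      rw [mon_cons, map_mul, h2, List.map_cons, Sum.map_inl, normalOrder, mul_smul_comm,
        ← Torus.f_mul_bas]; rfl
    | inr γ =>
      refine ⟨γ + β, ?_, ?_⟩
      · rw [List.map_cons, Sum.map_inr, normalOrder]
        dsimp only
        rw [h1, ← coTorus_k, ← coTorus_k, ← coTorus_k, map_add]
      · rw [mon_cons, map_mul, h2, List.map_cons, Sum.map_inr, normalOrder, mul_smul_comm]
        change _ • (D.rootTorus.t γ * _) = _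
        rw [Torus.t_mul_bas, smul_smul, kExp_root, mul_comm]; rfl

theorem formB_mon (u v : List (D.Iinf ⊕ Module.Dual ℤ P)) : D.formB ν (mon u) (mon v) =
    (D.normalOrder u).1 * (D.normalOrder v).1 *
      D.form ν (mon (D.normalOrder u).2.1) (mon (D.normalOrder v).2.1) *
      D.torForm (D.normalOrder u).2.2 (D.normalOrder v).2.2 := by
  rw [formB, linExt_mon, linExt_mon]

/-- The pairing of the non-positive half, given by normal ordering, is the Hopf pairing of the
bialgebras `H`, in both orders of its arguments. -/
theorem formB_eq_pair_and (a : D.B) (b : D.B₂) :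
    D.formB ν a (D.B₂toB b) = D.coTorus.pair ν (D.rootTorus.proj b) (D.coTorus.proj a) ∧
    D.formB ν (D.B₂toB b) a = D.coTorus.pair ν (D.rootTorus.proj b) (D.coTorus.proj a) := by
  let L : D.B₂ →ₗ[K] D.B →ₗ[K] K :=
    LinearMap.mk₂ K (fun b a => D.coTorus.pair ν (D.rootTorus.proj b) (D.coTorus.proj a))
      (by intros; simp) (by intros; simp) (by intros; simp) (by intros; simp)
  have hL : ∀ v u, L (mon v) (mon u) = D.formB ν (mon u) (D.B₂toB (mon v)) ∧
      L (mon v) (mon u) = D.formB ν (D.B₂toB (mon v)) (mon u) := by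
    intro v u
    obtain ⟨β, h1, h2⟩ := D.normalOrder_B₂ v
    rw [B₂toB_mon, formB_mon, formB_mon, h1, torForm_kExp, torForm_kExp_left]
    change D.coTorus.pair ν (D.rootTorus.proj (mon v)) (D.coTorus.proj (mon u)) = _ ∧
      D.coTorus.pair ν (D.rootTorus.proj (mon v)) (D.coTorus.proj (mon u)) = _
    rw [proj_mon_eq_bas, h2, map_smul, map_smul, WithConv.ofConv_smul, LinearMap.smul_apply,
      Torus.pair_bas, coTorus_ev, smul_eq_mul, smul_eq_mul]
    refine ⟨by ring, ?_⟩
    rw [form_comm]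
    ring
  have e1 : L = (D.formB ν).flip ∘ₗ D.B₂toB.toLinearMap :=
    linearMap_ext_mon fun v => linearMap_ext_mon fun u => (hL v u).1
  have e2 : L = D.formB ν ∘ₗ D.B₂toB.toLinearMap :=
    linearMap_ext_mon fun v => linearMap_ext_mon fun u => (hL v u).2
  exact ⟨(DFunLike.congr_fun (DFunLike.congr_fun e1 b) a).symm,
    (DFunLike.congr_fun (DFunLike.congr_fun e2 b) a).symm⟩

/-- The subalgebra generated by the `f_il` and `K_β` is the image of the free algebra on them. -/
theorem BK_le_range : D.BK ≤ D.B₂toB.range := by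
  refine Algebra.adjoin_le ?_
  rintro _ (⟨z, rfl⟩ | ⟨β, rfl⟩)
  · refine ⟨FreeAlgebra.lift K (fun x => FreeAlgebra.ι K (Sum.inl x)) z, ?_⟩
    suffices D.B₂toB.comp (FreeAlgebra.lift K (fun x => FreeAlgebra.ι K (Sum.inl x))) = D.FtoB from
      DFunLike.congr_fun this z
    refine FreeAlgebra.hom_ext (funext fun x => ?_)
    simp [B₂toB, FtoB]
  · refine ⟨FreeAlgebra.ι K (Sum.inr β), ?_⟩
    simp [B₂toB, torB]

end Compare

/-! ### The relations of the Drinfeld double -/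

section Double

variable {I : Type*} {P : Type*} [AddCommGroup P] {D : Datum I P} (ν : D.Iinf → K)
variable {T : Type*} [AddCommGroup T] (τ : D.Torus T)

open WithConv

namespace Torus

/-- `z` is primitive: `Δ(z) = z ⊗ 1 + K_γ ⊗ z`, where `z` has weight `-γ`. -/
def IsPrim (γ : I →₀ ℤ) (z : D.F) : Prop :=
  τ.comulHom (τ.incl z) = τ.incl z ⊗ₜ[K] 1 + τ.t (τ.k γ) ⊗ₜ[K] τ.incl z

/-- The linear map `c ⊗ d ↦ g(c) d`. -/
def leftSlice (g : τ.H →ₗ[K] K) : τ.H ⊗[K] τ.H →ₗ[K] τ.H :=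
  (TensorProduct.lid K τ.H).toLinearMap ∘ₗ TensorProduct.map g LinearMap.id

/-- The linear map `c ⊗ d ↦ g(d) c`. -/
def rightSlice (g : τ.H →ₗ[K] K) : τ.H ⊗[K] τ.H →ₗ[K] τ.H :=
  (TensorProduct.rid K τ.H).toLinearMap ∘ₗ TensorProduct.map LinearMap.id g

theorem leftSlice_tmul (g : τ.H →ₗ[K] K) (c d : τ.H) : τ.leftSlice g (c ⊗ₜ[K] d) = g c • d := by
  simp [leftSlice]

theorem rightSlice_tmul (g : τ.H →ₗ[K] K) (c d : τ.H) : τ.rightSlice g (c ⊗ₜ[K] d) = g d • c := by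
  simp [rightSlice]

theorem leftSlice_counit (a : τ.H) : τ.leftSlice τ.counitHom.toLinearMap (τ.comulHom a) = a := by
  have := congrArg (TensorProduct.lid K τ.H) (Coalgebra.rTensor_counit_comul (R := K) a)
  exact this.trans ((TensorProduct.lid_tmul _ _).trans (one_smul K a))

theorem rightSlice_counit (a : τ.H) : τ.rightSlice τ.counitHom.toLinearMap (τ.comulHom a) = a := by
  have := congrArg (TensorProduct.rid K τ.H) (Coalgebra.lTensor_counit_comul (R := K) a)
  exact this.trans ((TensorProduct.rid_tmul _ _).trans (one_smul K a))

theorem leftSlice_chi (γ : I →₀ ℤ) (a : τ.H) :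
    τ.leftSlice (τ.chi γ).toLinearMap (τ.comulHom a) = τ.lam γ a := rfl

theorem rightSlice_chi (γ : I →₀ ℤ) (a : τ.H) :
    τ.rightSlice (τ.chi γ).toLinearMap (τ.comulHom a) = τ.kap γ a := rfl

/-- The functional `(· , z)_L` on `H`. -/
def pairF (z : D.F) : τ.H →ₗ[K] K := (τ.pair ν (D.rootTorus.incl z)).ofConv

theorem pairF_incl (z y : D.F) : τ.pairF ν z (τ.incl y) = D.form ν y z := τ.pair_incl' ν y z

theorem pairF_t {γ : I →₀ ℤ} (hγ : γ ≠ 0) {z : D.F} (hz : z ∈ D.homog γ) (h : T) :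
    τ.pairF ν z (τ.t h) = 0 := by
  have := τ.pair_incl ν 1 z h
  rw [map_one, one_mul] at this
  rw [pairF, this]
  exact form_homog_eq_zero ν hγ.symm (mon_nil ▸ mon_mem_homog rfl) hz

/-- For primitive `z` the functional `(·, z)_L` is a skew derivation with values in `K`. -/
theorem pairF_mul {γ : I →₀ ℤ} {z : D.F} (hz : D.rootTorus.IsPrim γ z) (a a' : τ.H) :
    τ.pairF ν z (a * a') =
      τ.pairF ν z a * τ.counitHom a' + τ.chi γ a * τ.pairF ν z a' := by
  rw [pairF, pair_mul, hz, map_add, ofConv_add, LinearMap.add_apply, pairTensor_tmul,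
    pairTensor_tmul, pair_t, map_one]
  rfl

theorem leftSlice_mul {γ : I →₀ ℤ} {z : D.F} (hz : D.rootTorus.IsPrim γ z) (s s' : τ.H ⊗[K] τ.H) :
    τ.leftSlice (τ.pairF ν z) (s * s') =
      τ.leftSlice (τ.pairF ν z) s * τ.leftSlice τ.counitHom.toLinearMap s' +
      τ.leftSlice (τ.chi γ).toLinearMap s * τ.leftSlice (τ.pairF ν z) s' := by
  induction s using TensorProduct.induction_on with
  | zero => simp
  | add s t hs ht => rw [add_mul, map_add, hs, ht, map_add, map_add, add_mul, add_mul]; abel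
  | tmul c d =>
    induction s' using TensorProduct.induction_on with
    | zero => simp
    | add s t hs ht => rw [mul_add, map_add, hs, ht, map_add, map_add, mul_add, mul_add]; abel
    | tmul c' d' =>
      simp only [Algebra.TensorProduct.tmul_mul_tmul, leftSlice_tmul, τ.pairF_mul ν hz,
        smul_mul_smul_comm, add_smul, AlgHom.toLinearMap_apply]

theorem rightSlice_mul {γ : I →₀ ℤ} {z : D.F} (hz : D.rootTorus.IsPrim γ z)
    (s s' : τ.H ⊗[K] τ.H) :
    τ.rightSlice (τ.pairF ν z) (s * s') =
      τ.rightSlice (τ.pairF ν z) s * τ.rightSlice τ.counitHom.toLinearMap s' +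
      τ.rightSlice (τ.chi γ).toLinearMap s * τ.rightSlice (τ.pairF ν z) s' := by
  induction s using TensorProduct.induction_on with
  | zero => simp
  | add s t hs ht => rw [add_mul, map_add, hs, ht, map_add, map_add, add_mul, add_mul]; abel
  | tmul c d =>
    induction s' using TensorProduct.induction_on with
    | zero => simp
    | add s t hs ht => rw [mul_add, map_add, hs, ht, map_add, map_add, mul_add, mul_add]; abel
    | tmul c' d' =>
      simp only [Algebra.TensorProduct.tmul_mul_tmul, rightSlice_tmul, τ.pairF_mul ν hz,
        smul_mul_smul_comm, add_smul, AlgHom.toLinearMap_apply]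

/-- The skew derivation `a ↦ Σ (a_(1), z)_L a_(2)`. -/
def derivL (z : D.F) (a : τ.H) : τ.H := τ.leftSlice (τ.pairF ν z) (τ.comulHom a)

/-- The skew derivation `a ↦ Σ a_(1) (a_(2), z)_L`. -/
def derivR (z : D.F) (a : τ.H) : τ.H := τ.rightSlice (τ.pairF ν z) (τ.comulHom a)

theorem derivL_mul {γ : I →₀ ℤ} {z : D.F} (hz : D.rootTorus.IsPrim γ z) (a a' : τ.H) :
    τ.derivL ν z (a * a') = τ.derivL ν z a * a' + τ.lam γ a * τ.derivL ν z a' := by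
  rw [derivL, map_mul, τ.leftSlice_mul ν hz, leftSlice_counit, leftSlice_chi]; rfl

theorem derivR_mul {γ : I →₀ ℤ} {z : D.F} (hz : D.rootTorus.IsPrim γ z) (a a' : τ.H) :
    τ.derivR ν z (a * a') = τ.derivR ν z a * a' + τ.kap γ a * τ.derivR ν z a' := by
  rw [derivR, map_mul, τ.rightSlice_mul ν hz, rightSlice_counit, rightSlice_chi]; rfl

theorem derivL_add (z : D.F) (a a' : τ.H) :
    τ.derivL ν z (a + a') = τ.derivL ν z a + τ.derivL ν z a' := by
  rw [derivL, map_add, map_add]; rfl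

theorem derivR_add (z : D.F) (a a' : τ.H) :
    τ.derivR ν z (a + a') = τ.derivR ν z a + τ.derivR ν z a' := by
  rw [derivR, map_add, map_add]; rfl

theorem derivL_t {γ : I →₀ ℤ} (hγ : γ ≠ 0) {z : D.F} (hz : z ∈ D.homog γ) (h : T) :
    τ.derivL ν z (τ.t h) = 0 := by
  rw [derivL, comulHom_t, leftSlice_tmul, τ.pairF_t ν hγ hz, zero_smul]

theorem derivR_t {γ : I →₀ ℤ} (hγ : γ ≠ 0) {z : D.F} (hz : z ∈ D.homog γ) (h : T) :
    τ.derivR ν z (τ.t h) = 0 := by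
  rw [derivR, comulHom_t, rightSlice_tmul, τ.pairF_t ν hγ hz, zero_smul]

theorem derivL_algebraMap {γ : I →₀ ℤ} (hγ : γ ≠ 0) {z : D.F} (hz : z ∈ D.homog γ) (c : K) :
    τ.derivL ν z (algebraMap K τ.H c) = 0 := by
  rw [Algebra.algebraMap_eq_smul_one, ← t_zero, derivL, map_smul, map_smul, ← derivL,
    τ.derivL_t ν hγ hz, smul_zero]

theorem derivR_algebraMap {γ : I →₀ ℤ} (hγ : γ ≠ 0) {z : D.F} (hz : z ∈ D.homog γ) (c : K) :
    τ.derivR ν z (algebraMap K τ.H c) = 0 := by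
  rw [Algebra.algebraMap_eq_smul_one, ← t_zero, derivR, map_smul, map_smul, ← derivR,
    τ.derivR_t ν hγ hz, smul_zero]

/-- On primitive elements the skew derivations are given by the form on `F`. -/
theorem derivL_prim {γ γ' : I →₀ ℤ} (hγ : γ ≠ 0) {z y : D.F} (hz : z ∈ D.homog γ)
    (hy : τ.IsPrim γ' y) : τ.derivL ν z (τ.incl y) = D.form ν y z • 1 := by
  rw [derivL, hy, map_add, leftSlice_tmul, leftSlice_tmul, τ.pairF_t ν hγ hz, zero_smul, add_zero,
    pairF_incl]

theorem derivR_prim {γ γ' : I →₀ ℤ} (hγ : γ ≠ 0) {z y : D.F} (hz : z ∈ D.homog γ)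
    (hy : τ.IsPrim γ' y) :
    τ.derivR ν z (τ.incl y) = D.form ν y z • τ.t (τ.k γ') := by
  rw [derivR, hy, map_add, rightSlice_tmul, rightSlice_tmul, ← t_zero, τ.pairF_t ν hγ hz,
    zero_smul, zero_add, pairF_incl]

section Convolution

variable {A : Type*} [Ring A] [Algebra K A]

/-- The functions `a ↦ ε(a) x`, for `x` in an algebra. -/
def constHom : A →ₐ[K] WithConv (τ.H →ₗ[K] A) :=
  AlgHom.ofLinearMap
    { toFun := fun x => toConv (LinearMap.toSpanSingleton K A x ∘ₗ τ.counitHom.toLinearMap)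
      map_add' := fun x y => WithConv.ext (LinearMap.ext fun a => by simp)
      map_smul' := fun c x => WithConv.ext (LinearMap.ext fun a => by
        simp [smul_smul, mul_comm]) }
    (WithConv.ext (LinearMap.ext fun a => by
      simp [counit_eq, Algebra.algebraMap_eq_smul_one]))
    (fun x y => WithConv.ext (LinearMap.ext fun a => by
      rw [LinearMap.convMul_apply, comul_eq]
      conv_lhs => rw [← τ.leftSlice_counit a]
      generalize τ.comulHom a = s
      induction s using TensorProduct.induction_on with
      | zero => simp
      | add s s' hs hs' => simp only [map_add, hs, hs']
      | tmul c d => simp [leftSlice_tmul, smul_smul, mul_comm]))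

theorem constHom_apply (x : A) (a : τ.H) : τ.constHom x a = τ.counitHom a • x := rfl

theorem constHom_mul_apply (x : A) (g : WithConv (τ.H →ₗ[K] A)) (a : τ.H) :
    (τ.constHom x * g) a = x * g a := by
  rw [LinearMap.convMul_apply, comul_eq]
  conv_rhs => rw [← τ.leftSlice_counit a]
  generalize τ.comulHom a = s
  induction s using TensorProduct.induction_on with
  | zero => simp
  | add s s' hs hs' => simp only [map_add, hs, hs', mul_add]
  | tmul c d => simp [leftSlice_tmul, constHom_apply]

theorem mul_constHom_apply (x : A) (g : WithConv (τ.H →ₗ[K] A)) (a : τ.H) :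
    (g * τ.constHom x) a = g a * x := by
  rw [LinearMap.convMul_apply, comul_eq]
  conv_rhs => rw [← τ.rightSlice_counit a]
  generalize τ.comulHom a = s
  induction s using TensorProduct.induction_on with
  | zero => simp
  | add s s' hs hs' => simp only [map_add, hs, hs', add_mul]
  | tmul c d => simp [rightSlice_tmul, constHom_apply]

variable (A) in
/-- Functionals, as functions with values in an algebra. -/
def scalHom : WithConv (τ.H →ₗ[K] K) →ₐ[K] WithConv (τ.H →ₗ[K] A) :=
  AlgHom.ofLinearMap
    { toFun := fun g => toConv (Algebra.linearMap K A ∘ₗ g.ofConv)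
      map_add' := fun x y => WithConv.ext (LinearMap.ext fun a => by simp)
      map_smul' := fun c x => WithConv.ext (LinearMap.ext fun a => by
        change algebraMap K A (c • x.ofConv a) = c • algebraMap K A (x.ofConv a)
        rw [smul_eq_mul, map_mul, ← Algebra.smul_def]) }
    (WithConv.ext (LinearMap.ext fun a => by simp))
    (fun g g' => WithConv.ext (LinearMap.algHom_comp_convMul_distrib (Algebra.ofId K A) g g'))

theorem scalHom_apply (g : WithConv (τ.H →ₗ[K] K)) (a : τ.H) :
    τ.scalHom A g a = algebraMap K A (g a) := rfl

theorem constHom_commute_scalHom (x : A) (g : WithConv (τ.H →ₗ[K] K)) :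
    Commute (τ.constHom x) (τ.scalHom A g) :=
  WithConv.ext (LinearMap.ext fun a => by
    rw [constHom_mul_apply, mul_constHom_apply, scalHom_apply, Algebra.commutes])

variable (ι : τ.H →ₐ[K] A) (ω : D.rootTorus.H →ₐ[K] A)

theorem scalHom_mul_apply (g : WithConv (τ.H →ₗ[K] K)) (a : τ.H) :
    (τ.scalHom A g * toConv ι.toLinearMap) a = ι (τ.leftSlice g.ofConv (τ.comulHom a)) := by
  rw [LinearMap.convMul_apply, comul_eq]
  generalize τ.comulHom a = s
  induction s using TensorProduct.induction_on with
  | zero => simp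
  | add s s' hs hs' => simp only [map_add, hs, hs']
  | tmul c d => simp [leftSlice_tmul, scalHom_apply, Algebra.smul_def]

theorem mul_scalHom_apply (g : WithConv (τ.H →ₗ[K] K)) (a : τ.H) :
    (toConv ι.toLinearMap * τ.scalHom A g) a = ι (τ.rightSlice g.ofConv (τ.comulHom a)) := by
  rw [LinearMap.convMul_apply, comul_eq]
  generalize τ.comulHom a = s
  induction s using TensorProduct.induction_on with
  | zero => simp
  | add s s' hs hs' => simp only [map_add, hs, hs']
  | tmul c d => simp [rightSlice_tmul, scalHom_apply, Algebra.smul_def, Algebra.commutes]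

/-- The map `b ⊗ b' ↦ (a ↦ (a, b')_L ω(b))`. -/
def gammaTensorL : D.rootTorus.H ⊗[K] D.rootTorus.H →ₐ[K] WithConv (τ.H →ₗ[K] A) :=
  Algebra.TensorProduct.lift (τ.constHom.comp ω) ((τ.scalHom A).comp (τ.pair ν))
    fun _ _ => τ.constHom_commute_scalHom _ _

/-- The map `b ⊗ b' ↦ (a ↦ (a, b)_L ω(b'))`. -/
def gammaTensorR : D.rootTorus.H ⊗[K] D.rootTorus.H →ₐ[K] WithConv (τ.H →ₗ[K] A) :=
  Algebra.TensorProduct.lift ((τ.scalHom A).comp (τ.pair ν)) (τ.constHom.comp ω)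
    fun _ _ => (τ.constHom_commute_scalHom _ _).symm

theorem gammaTensorL_tmul (b b' : D.rootTorus.H) :
    τ.gammaTensorL ν ω (b ⊗ₜ[K] b') = τ.constHom (ω b) * τ.scalHom A (τ.pair ν b') := rfl

theorem gammaTensorR_tmul (b b' : D.rootTorus.H) :
    τ.gammaTensorR ν ω (b ⊗ₜ[K] b') = τ.scalHom A (τ.pair ν b) * τ.constHom (ω b') := rfl

/-- The left side of the relations of the Drinfeld double,
`a ↦ Σ (a_(1), b_(2))_L ω(b_(1)) ι(a_(2))`, as an element of the convolution algebra. -/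
def doubleL (b : D.rootTorus.H) : WithConv (τ.H →ₗ[K] A) :=
  τ.gammaTensorL ν ω (D.rootTorus.comulHom b) * toConv ι.toLinearMap

/-- The right side of the relations of the Drinfeld double,
`a ↦ Σ (a_(2), b_(1))_L ι(a_(1)) ω(b_(2))`, as an element of the convolution algebra. -/
def doubleR (b : D.rootTorus.H) : WithConv (τ.H →ₗ[K] A) :=
  toConv ι.toLinearMap * τ.gammaTensorR ν ω (D.rootTorus.comulHom b)

theorem doubleL_t (β : I →₀ ℤ) (a : τ.H) :
    τ.doubleL ν ι ω (D.rootTorus.t β) a = ω (D.rootTorus.t β) * ι (τ.lam β a) := by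
  rw [doubleL, comulHom_t, gammaTensorL_tmul, mul_assoc, constHom_mul_apply, scalHom_mul_apply,
    pair_t, leftSlice_chi]

theorem doubleR_t (β : I →₀ ℤ) (a : τ.H) :
    τ.doubleR ν ι ω (D.rootTorus.t β) a = ι (τ.kap β a) * ω (D.rootTorus.t β) := by
  rw [doubleR, comulHom_t, gammaTensorR_tmul, ← mul_assoc, mul_constHom_apply, mul_scalHom_apply,
    pair_t, rightSlice_chi]

/-- For primitive `z` the left side of the relation of the Drinfeld double, as
`Δ(z) = z ⊗ 1 + K_γ ⊗ z`. -/
theorem doubleL_prim {γ : I →₀ ℤ} {z : D.F} (hz : D.rootTorus.IsPrim γ z) (a : τ.H) :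
    τ.doubleL ν ι ω (D.rootTorus.incl z) a =
      ω (D.rootTorus.incl z) * ι a + ω (D.rootTorus.t γ) * ι (τ.derivL ν z a) := by
  rw [doubleL, hz, map_add, gammaTensorL_tmul, gammaTensorL_tmul, add_mul, ofConv_add,
    LinearMap.add_apply, mul_assoc, mul_assoc, constHom_mul_apply, constHom_mul_apply,
    scalHom_mul_apply, scalHom_mul_apply, map_one (τ.pair ν)]
  exact congrArg (fun c => ω (D.rootTorus.incl z) * ι c + _) (τ.leftSlice_counit a)

/-- For primitive `z` the right side of the relation of the Drinfeld double, as
`Δ(z) = z ⊗ 1 + K_γ ⊗ z`. -/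
theorem doubleR_prim {γ : I →₀ ℤ} {z : D.F} (hz : D.rootTorus.IsPrim γ z) (a : τ.H) :
    τ.doubleR ν ι ω (D.rootTorus.incl z) a =
      ι (τ.derivR ν z a) + ι (τ.kap γ a) * ω (D.rootTorus.incl z) := by
  rw [doubleR, hz, map_add, gammaTensorR_tmul, gammaTensorR_tmul, mul_add, ofConv_add,
    LinearMap.add_apply, ← mul_assoc, ← mul_assoc, mul_constHom_apply, mul_constHom_apply,
    mul_scalHom_apply, mul_scalHom_apply, pair_t, map_one ω, mul_one]
  rfl

/-- The commutation relations in an algebra `A` between the images of the two halves, for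
primitive generators `p`. -/
structure DoubleRel (p : D.Iinf → D.F) : Prop where
  torus : ∀ β h, ω (D.rootTorus.t β) * ι (τ.t h) = ι (τ.t h) * ω (D.rootTorus.t β)
  torus_neg : ∀ β x, q ^ (D.rootForm β (D.wt [x])) • (ω (D.rootTorus.t β) * ι (τ.f x)) =
    ι (τ.f x) * ω (D.rootTorus.t β)
  torus_pos : ∀ x h, ω (D.rootTorus.incl (p x)) * ι (τ.t h) =
    q ^ (-(τ.ev h (-(D.wt [x])))) • (ι (τ.t h) * ω (D.rootTorus.incl (p x)))
  bracket : ∀ x y, ω (D.rootTorus.incl (p x)) * ι (τ.incl (p y)) +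
      D.form ν (p y) (p x) • ω (D.rootTorus.t (-(D.wt [x]))) =
    D.form ν (p y) (p x) • ι (τ.t (τ.k (-(D.wt [y])))) +
      ι (τ.incl (p y)) * ω (D.rootTorus.incl (p x))

variable {ν τ ι ω} in
/-- The relation of the Drinfeld double for `b = K_β` and all `a`. -/
theorem DoubleRel.torus_lam {p : D.Iinf → D.F} (h : τ.DoubleRel ν ι ω p) (β : I →₀ ℤ) (a : τ.H) :
    ω (D.rootTorus.t β) * ι (τ.lam β a) = ι (τ.kap β a) * ω (D.rootTorus.t β) := by
  induction a using τ.H_induction with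
  | hc c => rw [AlgHom.commutes, AlgHom.commutes, AlgHom.commutes, AlgHom.commutes,
      Algebra.commutes]
  | hf x => rw [lam_f, kap_f, map_smul, mul_smul_comm, h.torus_neg]
  | ht s => rw [lam_t, kap_t, map_smul, mul_smul_comm, h.torus, smul_mul_assoc]
  | hmul a b ha hb => rw [map_mul, map_mul, ← mul_assoc, ha, mul_assoc, hb, map_mul, map_mul,
      mul_assoc]
  | hadd a b ha hb => rw [map_add, map_add, mul_add, ha, hb, map_add, map_add, add_mul]

theorem wt_singleton_ne_zero (x : D.Iinf) : D.wt [x] ≠ 0 := by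
  intro h
  have := D.wt_apply_neg (List.mem_singleton_self x)
  rw [h] at this
  exact lt_irrefl _ this

variable {ν τ ι ω} in
/-- The commutation relation of a primitive generator with all of `H`. The set of all `a` for which
it holds is a subalgebra, since `derivL` and `derivR` are skew derivations, so the generators
`p y` and the torus elements suffice. -/
theorem DoubleRel.comm_prim {p : D.Iinf → D.F} (h : τ.DoubleRel ν ι ω p)
    (hw : ∀ x, p x ∈ D.homog (D.wt [x]))
    (hp : ∀ x, τ.IsPrim (-(D.wt [x])) (p x)) (hp₂ : ∀ x, D.rootTorus.IsPrim (-(D.wt [x])) (p x))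
    (hgen : Algebra.adjoin K (Set.range p) = ⊤) (x : D.Iinf) (a : τ.H) :
    ω (D.rootTorus.incl (p x)) * ι a +
      ω (D.rootTorus.t (-(D.wt [x]))) * ι (τ.derivL ν (p x) a) =
    ι (τ.derivR ν (p x) a) + ι (τ.kap (-(D.wt [x])) a) * ω (D.rootTorus.incl (p x)) := by
  have h0 := wt_singleton_ne_zero x
  have hmul : ∀ a b : τ.H, (ω (D.rootTorus.incl (p x)) * ι a +
      ω (D.rootTorus.t (-(D.wt [x]))) * ι (τ.derivL ν (p x) a) =
    ι (τ.derivR ν (p x) a) + ι (τ.kap (-(D.wt [x])) a) * ω (D.rootTorus.incl (p x))) →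
    (ω (D.rootTorus.incl (p x)) * ι b +
      ω (D.rootTorus.t (-(D.wt [x]))) * ι (τ.derivL ν (p x) b) =
    ι (τ.derivR ν (p x) b) + ι (τ.kap (-(D.wt [x])) b) * ω (D.rootTorus.incl (p x))) →
    (ω (D.rootTorus.incl (p x)) * ι (a * b) +
      ω (D.rootTorus.t (-(D.wt [x]))) * ι (τ.derivL ν (p x) (a * b)) =
    ι (τ.derivR ν (p x) (a * b)) +
      ι (τ.kap (-(D.wt [x])) (a * b)) * ω (D.rootTorus.incl (p x))) := by
    intro a b ha hb
    rw [τ.derivL_mul ν (hp₂ x), τ.derivR_mul ν (hp₂ x)]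
    simp only [map_add, map_mul, mul_add]
    have e := h.torus_lam (-(D.wt [x])) a
    calc _ = (ω (D.rootTorus.incl (p x)) * ι a + ω (D.rootTorus.t (-(D.wt [x]))) *
            ι (τ.derivL ν (p x) a)) * ι b +
          (ω (D.rootTorus.t (-(D.wt [x]))) * ι (τ.lam (-(D.wt [x])) a)) *
            ι (τ.derivL ν (p x) b) := by noncomm_ring
      _ = ι (τ.derivR ν (p x) a) * ι b + ι (τ.kap (-(D.wt [x])) a) *
          (ω (D.rootTorus.incl (p x)) * ι b +
            ω (D.rootTorus.t (-(D.wt [x]))) * ι (τ.derivL ν (p x) b)) := by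
          rw [ha, e]; noncomm_ring
      _ = _ := by rw [hb]; noncomm_ring
  have hadd : ∀ a b : τ.H, (ω (D.rootTorus.incl (p x)) * ι a +
      ω (D.rootTorus.t (-(D.wt [x]))) * ι (τ.derivL ν (p x) a) =
    ι (τ.derivR ν (p x) a) + ι (τ.kap (-(D.wt [x])) a) * ω (D.rootTorus.incl (p x))) →
    (ω (D.rootTorus.incl (p x)) * ι b +
      ω (D.rootTorus.t (-(D.wt [x]))) * ι (τ.derivL ν (p x) b) =
    ι (τ.derivR ν (p x) b) + ι (τ.kap (-(D.wt [x])) b) * ω (D.rootTorus.incl (p x))) →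
    (ω (D.rootTorus.incl (p x)) * ι (a + b) +
      ω (D.rootTorus.t (-(D.wt [x]))) * ι (τ.derivL ν (p x) (a + b)) =
    ι (τ.derivR ν (p x) (a + b)) +
      ι (τ.kap (-(D.wt [x])) (a + b)) * ω (D.rootTorus.incl (p x))) := by
    intro a b ha hb
    rw [derivL_add, derivR_add]
    simp only [map_add, mul_add, add_mul]
    rw [add_add_add_comm, ha, hb]
    abel
  have hc : ∀ c : K, ω (D.rootTorus.incl (p x)) * ι (algebraMap K τ.H c) +
      ω (D.rootTorus.t (-(D.wt [x]))) * ι (τ.derivL ν (p x) (algebraMap K τ.H c)) =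
    ι (τ.derivR ν (p x) (algebraMap K τ.H c)) +
      ι (τ.kap (-(D.wt [x])) (algebraMap K τ.H c)) * ω (D.rootTorus.incl (p x)) := by
    intro c
    rw [τ.derivL_algebraMap ν h0 (hw x), τ.derivR_algebraMap ν h0 (hw x), map_zero, mul_zero,
      add_zero, zero_add, AlgHom.commutes, AlgHom.commutes, AlgHom.commutes, Algebra.commutes]
  have hincl : ∀ z : D.F, ω (D.rootTorus.incl (p x)) * ι (τ.incl z) +
      ω (D.rootTorus.t (-(D.wt [x]))) * ι (τ.derivL ν (p x) (τ.incl z)) =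
    ι (τ.derivR ν (p x) (τ.incl z)) +
      ι (τ.kap (-(D.wt [x])) (τ.incl z)) * ω (D.rootTorus.incl (p x)) := by
    intro z
    have hz : z ∈ Algebra.adjoin K (Set.range p) := by rw [hgen]; trivial
    induction hz using Algebra.adjoin_induction with
    | mem z hz =>
      obtain ⟨y, rfl⟩ := hz
      rw [τ.derivL_prim ν h0 (hw x) (hp y), τ.derivR_prim ν h0 (hw x) (hp y), kap_incl, map_smul,
        map_smul, map_one, mul_smul_comm, mul_one, h.bracket]
    | algebraMap c => rw [AlgHom.commutes]; exact hc c
    | add a b _ _ ha hb => rw [map_add]; exact hadd _ _ ha hb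
    | mul a b _ _ ha hb => rw [map_mul]; exact hmul _ _ ha hb
  induction a using τ.H_induction with
  | hc c => exact hc c
  | hf y => rw [← incl_ι]; exact hincl _
  | ht s =>
    rw [τ.derivL_t ν h0 (hw x), τ.derivR_t ν h0 (hw x), map_zero, mul_zero, add_zero, zero_add,
      h.torus_pos, kap_t, map_smul, smul_mul_assoc]
  | hmul a b ha hb => exact hmul a b ha hb
  | hadd a b ha hb => exact hadd a b ha hb

variable {ν τ ι ω} in
/-- The relations of the Drinfeld double follow from those between primitive generators. Both sides
have the form `γ(b) * ι` and `ι * γ'(b)` in the convolution algebra for algebra maps `γ` and `γ'`,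
so the elements `b` for which they agree form a subalgebra. -/
theorem DoubleRel.doubleL_eq_doubleR {p : D.Iinf → D.F} (h : τ.DoubleRel ν ι ω p)
    (hw : ∀ x, p x ∈ D.homog (D.wt [x]))
    (hp : ∀ x, τ.IsPrim (-(D.wt [x])) (p x)) (hp₂ : ∀ x, D.rootTorus.IsPrim (-(D.wt [x])) (p x))
    (hgen : Algebra.adjoin K (Set.range p) = ⊤) (b : D.rootTorus.H) :
    τ.doubleL ν ι ω b = τ.doubleR ν ι ω b := by
  have hc : ∀ c : K, τ.doubleL ν ι ω (algebraMap K _ c) = τ.doubleR ν ι ω (algebraMap K _ c) := by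
    intro c
    rw [doubleL, doubleR, AlgHom.commutes, AlgHom.commutes, AlgHom.commutes, Algebra.commutes]
  have hmul : ∀ b b', τ.doubleL ν ι ω b = τ.doubleR ν ι ω b →
      τ.doubleL ν ι ω b' = τ.doubleR ν ι ω b' →
      τ.doubleL ν ι ω (b * b') = τ.doubleR ν ι ω (b * b') := by
    intro b b' hb hb'
    unfold doubleL doubleR at *
    rw [map_mul, map_mul, map_mul, mul_assoc, hb', ← mul_assoc, hb, mul_assoc]
  have hadd : ∀ b b', τ.doubleL ν ι ω b = τ.doubleR ν ι ω b →
      τ.doubleL ν ι ω b' = τ.doubleR ν ι ω b' →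
      τ.doubleL ν ι ω (b + b') = τ.doubleR ν ι ω (b + b') := by
    intro b b' hb hb'
    unfold doubleL doubleR at *
    rw [map_add, map_add, map_add, add_mul, hb, hb', mul_add]
  induction b using D.rootTorus.H_induction with
  | hc c => exact hc c
  | hf y =>
    rw [← incl_ι]
    generalize FreeAlgebra.ι K y = z
    have hz : z ∈ Algebra.adjoin K (Set.range p) := by rw [hgen]; trivial
    induction hz using Algebra.adjoin_induction with
    | mem z hz =>
      obtain ⟨y, rfl⟩ := hz
      refine WithConv.ext (LinearMap.ext fun a => ?_)
      rw [τ.doubleL_prim ν ι ω (hp₂ y), τ.doubleR_prim ν ι ω (hp₂ y)]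
      exact h.comm_prim hw hp hp₂ hgen y a
    | algebraMap c => rw [AlgHom.commutes]; exact hc c
    | add a b _ _ ha hb => rw [map_add]; exact hadd _ _ ha hb
    | mul a b _ _ ha hb => rw [map_mul]; exact hmul _ _ ha hb
  | ht β =>
    refine WithConv.ext (LinearMap.ext fun a => ?_)
    rw [doubleL_t, doubleR_t]
    exact h.torus_lam β a
  | hmul a b ha hb => exact hmul a b ha hb
  | hadd a b ha hb => exact hadd a b ha hb

/-- The commutation relation between primitive elements, as a relation of the Drinfeld double. -/
theorem bracket_of_double {γ γ' δ : I →₀ ℤ} {z y : D.F} (hδ : δ ≠ 0) (hz' : z ∈ D.homog δ)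
    (hz : D.rootTorus.IsPrim γ z) (hy : τ.IsPrim γ' y)
    (h : τ.doubleL ν ι ω (D.rootTorus.incl z) (τ.incl y) =
      τ.doubleR ν ι ω (D.rootTorus.incl z) (τ.incl y)) :
    ω (D.rootTorus.incl z) * ι (τ.incl y) + D.form ν y z • ω (D.rootTorus.t γ) =
    D.form ν y z • ι (τ.t (τ.k γ')) + ι (τ.incl y) * ω (D.rootTorus.incl z) := by
  rw [τ.doubleL_prim ν ι ω hz, τ.doubleR_prim ν ι ω hz, τ.derivL_prim ν hδ hz' hy,
    τ.derivR_prim ν hδ hz' hy, kap_incl, map_smul, map_smul, map_one, mul_smul_comm, mul_one] at h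
  exact h

end Convolution

end Torus

end Double

/-! ### The Drinfeld relations in terms of the bialgebras -/

section Link

variable {I : Type*} {P : Type*} [AddCommGroup P] (D : Datum I P) (ν : D.Iinf → K)

open WithConv

/-- The inclusion of `F` into the free algebra on the `f_il` and `K_β`. -/
def FtoB₂ : D.F →ₐ[K] D.B₂ := FreeAlgebra.lift K fun x => FreeAlgebra.ι K (Sum.inl x)

/-- The comultiplication, lifted to the free algebra on the `f_il` and `K_β`. -/
def comul₂ : D.B₂ →ₐ[K] D.B₂ ⊗[K] D.B₂ :=
  FreeAlgebra.lift K <| Sum.elim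
    (fun x => ∑ p ∈ Finset.HasAntidiagonal.antidiagonal x.deg,
      D.qpar x.idx ^ (-((p.1 * p.2 : ℕ) : ℤ)) •
        ((D.FtoB₂ (D.fgen x.idx p.1) *
          FreeAlgebra.ι K (Sum.inr (Finsupp.single x.idx (p.2 : ℤ)))) ⊗ₜ[K]
        D.FtoB₂ (D.fgen x.idx p.2)))
    (fun β => FreeAlgebra.ι K (Sum.inr β) ⊗ₜ[K] FreeAlgebra.ι K (Sum.inr β))

theorem B₂toB_FtoB₂ (z : D.F) : D.B₂toB (D.FtoB₂ z) = D.FtoB z := by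
  suffices D.B₂toB.comp D.FtoB₂ = D.FtoB from DFunLike.congr_fun this z
  exact FreeAlgebra.hom_ext (funext fun x => by simp [B₂toB, FtoB, FtoB₂])

theorem proj_FtoB₂ (z : D.F) : D.rootTorus.proj (D.FtoB₂ z) = D.rootTorus.incl z := by
  suffices D.rootTorus.proj.comp D.FtoB₂ = D.rootTorus.incl from DFunLike.congr_fun this z
  exact FreeAlgebra.hom_ext (funext fun x => by simp [FtoB₂, Torus.incl, Torus.f])

theorem proj_FtoB (z : D.F) : D.coTorus.proj (D.FtoB z) = D.coTorus.incl z := by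
  suffices D.coTorus.proj.comp D.FtoB = D.coTorus.incl from DFunLike.congr_fun this z
  exact FreeAlgebra.hom_ext (funext fun x => by simp [FtoB, Torus.incl, Torus.f])

theorem proj_torB (h : Module.Dual ℤ P) : D.coTorus.proj (D.torB h) = D.coTorus.t h := rfl

theorem B₂toB_inl (x : D.Iinf) :
    D.B₂toB (FreeAlgebra.ι K (Sum.inl x)) = FreeAlgebra.ι K (Sum.inl x) :=
  FreeAlgebra.lift_ι_apply _ _

theorem B₂toB_inr (β : I →₀ ℤ) : D.B₂toB (FreeAlgebra.ι K (Sum.inr β)) = D.torB (D.kExp β) :=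
  FreeAlgebra.lift_ι_apply _ _

theorem comul_B₂toB (b : D.B₂) :
    D.comul (D.B₂toB b) = Algebra.TensorProduct.map D.B₂toB D.B₂toB (D.comul₂ b) := by
  suffices D.comul.comp D.B₂toB =
      (Algebra.TensorProduct.map D.B₂toB D.B₂toB).comp D.comul₂ from DFunLike.congr_fun this b
  refine FreeAlgebra.hom_ext (funext fun x => ?_)
  cases x with
  | inl x =>
    simp only [Function.comp_apply, AlgHom.coe_comp, B₂toB_inl, FreeAlgebra.lift_ι_apply,
      comul, comul₂, Sum.elim_inl, map_sum, map_smul, Algebra.TensorProduct.map_tmul, map_mul,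
      B₂toB_FtoB₂, B₂toB_inr]
  | inr β =>
    simp [B₂toB_inr, comul, comul₂, torB]

theorem comulHom_proj (a : D.B) :
    D.coTorus.comulHom (D.coTorus.proj a) =
      Algebra.TensorProduct.map D.coTorus.proj D.coTorus.proj (D.comul a) := by
  suffices D.coTorus.comulHom.comp D.coTorus.proj =
      (Algebra.TensorProduct.map D.coTorus.proj D.coTorus.proj).comp D.comul from
    DFunLike.congr_fun this a
  refine FreeAlgebra.hom_ext (funext fun x => ?_)
  cases x with
  | inl x =>
    refine (D.coTorus.comulHom_f x).trans ?_
    simp only [Function.comp_apply, AlgHom.coe_comp, FreeAlgebra.lift_ι_apply, comul,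
      Sum.elim_inl, map_sum, map_smul, Algebra.TensorProduct.map_tmul, map_mul, proj_FtoB,
      proj_torB, Torus.comulGen, Torus.kpow, coTorus_k]
  | inr h =>
    refine (D.coTorus.comulHom_t h).trans ?_
    simp [comul, proj_torB]

theorem comulHom_proj₂ (b : D.B₂) :
    D.rootTorus.comulHom (D.rootTorus.proj b) =
      Algebra.TensorProduct.map D.rootTorus.proj D.rootTorus.proj (D.comul₂ b) := by
  suffices D.rootTorus.comulHom.comp D.rootTorus.proj =
      (Algebra.TensorProduct.map D.rootTorus.proj D.rootTorus.proj).comp D.comul₂ from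
    DFunLike.congr_fun this b
  refine FreeAlgebra.hom_ext (funext fun x => ?_)
  cases x with
  | inl x =>
    refine (D.rootTorus.comulHom_f x).trans ?_
    simp only [Function.comp_apply, AlgHom.coe_comp, FreeAlgebra.lift_ι_apply, comul₂,
      Sum.elim_inl, map_sum, map_smul, Algebra.TensorProduct.map_tmul, map_mul, proj_FtoB₂,
      Torus.comulGen, Torus.kpow]
    rfl
  | inr h =>
    refine (D.rootTorus.comulHom_t h).trans ?_
    simp [comul₂, Torus.t]

/-- The bilinear form `(a₁ ⊗ a₂, b₁ ⊗ b₂) ↦ (a₁, b₂)_L ω(b₁) a₂`. -/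
def crossL (s u : D.B ⊗[K] D.B) : D.UHat :=
  D.contract ν D.omegaB D.piB
    ((TensorProduct.map LinearMap.id (TensorProduct.comm K D.B D.B).toLinearMap)
      (TensorProduct.tensorTensorTensorComm K D.B D.B D.B D.B
        (s ⊗ₜ[K] TensorProduct.comm K D.B D.B u)))

/-- The bilinear form `(a₁ ⊗ a₂, b₁ ⊗ b₂) ↦ (a₂, b₁)_L a₁ ω(b₂)`. -/
def crossR (s u : D.B ⊗[K] D.B) : D.UHat :=
  D.contract ν D.piB D.omegaB
    (TensorProduct.tensorTensorTensorComm K D.B D.B D.B D.B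
      (TensorProduct.comm K D.B D.B s ⊗ₜ[K] u))

theorem crossL_tmul (a a' b b' : D.B) : D.crossL ν (a ⊗ₜ[K] a') (b ⊗ₜ[K] b') =
    D.formB ν a b' • (D.omegaB b * D.piB a') := rfl

theorem crossR_tmul (a a' b b' : D.B) : D.crossR ν (a ⊗ₜ[K] a') (b ⊗ₜ[K] b') =
    D.formB ν a' b • (D.piB a * D.omegaB b') := rfl

theorem crossL_add_left (s s' u) : D.crossL ν (s + s') u = D.crossL ν s u + D.crossL ν s' u := by
  simp [crossL, TensorProduct.add_tmul]

theorem crossL_add_right (s u u') : D.crossL ν s (u + u') = D.crossL ν s u + D.crossL ν s u' := by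
  simp [crossL, TensorProduct.tmul_add]

theorem crossR_add_left (s s' u) : D.crossR ν (s + s') u = D.crossR ν s u + D.crossR ν s' u := by
  simp [crossR, TensorProduct.add_tmul]

theorem crossR_add_right (s u u') : D.crossR ν s (u + u') = D.crossR ν s u + D.crossR ν s u' := by
  simp [crossR, TensorProduct.tmul_add]

theorem crossL_zero_left (u) : D.crossL ν 0 u = 0 := by simp [crossL]

theorem crossL_zero_right (s) : D.crossL ν s 0 = 0 := by simp [crossL]

theorem crossR_zero_left (u) : D.crossR ν 0 u = 0 := by simp [crossR]

theorem crossR_zero_right (s) : D.crossR ν s 0 = 0 := by simp [crossR]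

variable {A : Type*} [Ring A] [Algebra K A] (θ : D.UHat →ₐ[K] A) (ι : D.coTorus.H →ₐ[K] A)
  (ω : D.rootTorus.H →ₐ[K] A)

variable {θ ι ω}

/-- The left side of the Drinfeld relations, in an algebra `A` under `Û`. -/
theorem drinfeldLHS_eq_doubleL (hι : ∀ a, ι (D.coTorus.proj a) = θ (D.piB a))
    (hω : ∀ b, ω (D.rootTorus.proj b) = θ (D.omegaB (D.B₂toB b))) (a : D.B) (b : D.B₂) :
    θ (D.drinfeldLHS ν a (D.B₂toB b)) =
      D.coTorus.doubleL ν ι ω (D.rootTorus.proj b) (D.coTorus.proj a) := by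
  rw [Torus.doubleL, LinearMap.convMul_apply, Torus.comul_eq, comulHom_proj, comulHom_proj₂]
  change θ (D.crossL ν (D.comul a) (D.comul (D.B₂toB b))) = _
  rw [comul_B₂toB]
  generalize D.comul a = s
  generalize D.comul₂ b = u
  induction u using TensorProduct.induction_on with
  | zero => simp [crossL_zero_right]
  | add u u' hu hu' =>
    rw [map_add, crossL_add_right, map_add, hu, hu', map_add, map_add, ofConv_add,
      TensorProduct.map_add_left, LinearMap.add_apply, map_add]
  | tmul b b' =>
    induction s using TensorProduct.induction_on with
    | zero => simp [crossL_zero_left]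
    | add s s' hs hs' => rw [crossL_add_left, map_add, hs, hs', map_add, map_add, map_add]
    | tmul a a' =>
      rw [Algebra.TensorProduct.map_tmul, Algebra.TensorProduct.map_tmul,
        Algebra.TensorProduct.map_tmul, crossL_tmul, Torus.gammaTensorL_tmul,
        TensorProduct.map_tmul, LinearMap.mul'_apply, Torus.constHom_mul_apply,
        Torus.scalHom_apply, (D.formB_eq_pair_and ν a b').1, map_smul, map_mul, ← hω, ← hι,
        Algebra.smul_def, ← mul_assoc, Algebra.commutes]
      rfl

/-- The right side of the Drinfeld relations, in an algebra `A` under `Û`. -/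
theorem drinfeldRHS_eq_doubleR (hι : ∀ a, ι (D.coTorus.proj a) = θ (D.piB a))
    (hω : ∀ b, ω (D.rootTorus.proj b) = θ (D.omegaB (D.B₂toB b))) (a : D.B) (b : D.B₂) :
    θ (D.drinfeldRHS ν a (D.B₂toB b)) =
      D.coTorus.doubleR ν ι ω (D.rootTorus.proj b) (D.coTorus.proj a) := by
  rw [Torus.doubleR, LinearMap.convMul_apply, Torus.comul_eq, comulHom_proj, comulHom_proj₂]
  change θ (D.crossR ν (D.comul a) (D.comul (D.B₂toB b))) = _
  rw [comul_B₂toB]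
  generalize D.comul a = s
  generalize D.comul₂ b = u
  induction u using TensorProduct.induction_on with
  | zero => simp [crossR_zero_right]
  | add u u' hu hu' =>
    rw [map_add, crossR_add_right, map_add, hu, hu', map_add, map_add, ofConv_add,
      TensorProduct.map_add_right, LinearMap.add_apply, map_add]
  | tmul b b' =>
    induction s using TensorProduct.induction_on with
    | zero => simp [crossR_zero_left]
    | add s s' hs hs' => rw [crossR_add_left, map_add, hs, hs', map_add, map_add, map_add]
    | tmul a a' =>
      rw [Algebra.TensorProduct.map_tmul, Algebra.TensorProduct.map_tmul,
        Algebra.TensorProduct.map_tmul, crossR_tmul, Torus.gammaTensorR_tmul,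
        TensorProduct.map_tmul, LinearMap.mul'_apply, Torus.mul_constHom_apply,
        Torus.scalHom_apply, (D.formB_eq_pair_and ν a' b).1, map_smul, map_mul, ← hω, ← hι,
        Algebra.smul_def, ← mul_assoc, ← mul_assoc, Algebra.commutes]
      rfl

/-- The involution exchanges the two sides of the relations of the Drinfeld double. -/
theorem map_drinfeldLHS {σ : A →ₐ[K] A} (hπ : ∀ a, σ (θ (D.piB a)) = θ (D.omegaB a))
    (hω : ∀ a, σ (θ (D.omegaB a)) = θ (D.piB a)) (a : D.B₂) (b : D.B) :
    σ (θ (D.drinfeldLHS ν (D.B₂toB a) b)) = θ (D.drinfeldRHS ν b (D.B₂toB a)) := by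
  change σ (θ (D.crossL ν (D.comul (D.B₂toB a)) (D.comul b))) =
    θ (D.crossR ν (D.comul b) (D.comul (D.B₂toB a)))
  rw [comul_B₂toB]
  generalize D.comul b = s
  generalize D.comul₂ a = u
  induction u using TensorProduct.induction_on with
  | zero => simp [crossL_zero_left, crossR_zero_right]
  | add u u' hu hu' => rw [map_add, crossL_add_left, map_add, map_add, hu, hu', crossR_add_right,
      map_add]
  | tmul a a' =>
    induction s using TensorProduct.induction_on with
    | zero => simp [crossL_zero_right, crossR_zero_left]
    | add s s' hs hs' => rw [crossL_add_right, map_add, map_add, hs, hs', crossR_add_left, map_add]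
    | tmul b b' =>
      rw [Algebra.TensorProduct.map_tmul, crossL_tmul, crossR_tmul, map_smul, map_smul, map_smul,
        map_mul, map_mul, map_mul, hπ, hω, (D.formB_eq_pair_and ν b' a).1,
        (D.formB_eq_pair_and ν b' a).2]

theorem map_drinfeldRHS {σ : A →ₐ[K] A} (hπ : ∀ a, σ (θ (D.piB a)) = θ (D.omegaB a))
    (hω : ∀ a, σ (θ (D.omegaB a)) = θ (D.piB a)) (a : D.B₂) (b : D.B) :
    σ (θ (D.drinfeldRHS ν (D.B₂toB a) b)) = θ (D.drinfeldLHS ν b (D.B₂toB a)) := by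
  change σ (θ (D.crossR ν (D.comul (D.B₂toB a)) (D.comul b))) =
    θ (D.crossL ν (D.comul b) (D.comul (D.B₂toB a)))
  rw [comul_B₂toB]
  generalize D.comul b = s
  generalize D.comul₂ a = u
  induction u using TensorProduct.induction_on with
  | zero => simp [crossR_zero_left, crossL_zero_right]
  | add u u' hu hu' => rw [map_add, crossR_add_left, map_add, map_add, hu, hu', crossL_add_right,
      map_add]
  | tmul a a' =>
    induction s using TensorProduct.induction_on with
    | zero => simp [crossR_zero_right, crossL_zero_left]
    | add s s' hs hs' => rw [crossR_add_right, map_add, map_add, hs, hs', crossL_add_left, map_add]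
    | tmul b b' =>
      rw [Algebra.TensorProduct.map_tmul, crossL_tmul, crossR_tmul, map_smul, map_smul, map_smul,
        map_mul, map_mul, map_mul, hπ, hω, (D.formB_eq_pair_and ν b a').1,
        (D.formB_eq_pair_and ν b a').2]

/-- All relations of the Drinfeld double hold in an algebra `A` with an involution as soon as they
hold for `b` in the subalgebra generated by the `f_il` and `K_β`. -/
theorem drinfeld_eq_of_double (hι : ∀ a, ι (D.coTorus.proj a) = θ (D.piB a))
    (hω : ∀ b, ω (D.rootTorus.proj b) = θ (D.omegaB (D.B₂toB b)))
    {σ : A →ₐ[K] A} (hσ : Function.Injective σ) (hσπ : ∀ a, σ (θ (D.piB a)) = θ (D.omegaB a))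
    (hσω : ∀ a, σ (θ (D.omegaB a)) = θ (D.piB a))
    (hd : ∀ b, D.coTorus.doubleL ν ι ω b = D.coTorus.doubleR ν ι ω b)
    (a b : D.B) (hab : a ∈ D.BK ∨ b ∈ D.BK) :
    θ (D.drinfeldLHS ν a b) = θ (D.drinfeldRHS ν a b) := by
  have key : ∀ (a : D.B) (b : D.B₂),
      θ (D.drinfeldLHS ν a (D.B₂toB b)) = θ (D.drinfeldRHS ν a (D.B₂toB b)) := by
    intro a b
    rw [D.drinfeldLHS_eq_doubleL ν hι hω, D.drinfeldRHS_eq_doubleR ν hι hω, hd]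
  rcases hab with h | h
  · -- the involution exchanges the roles of `a` and `b`
    obtain ⟨a, rfl⟩ := D.BK_le_range h
    apply hσ
    change σ (θ (D.drinfeldLHS ν (D.B₂toB a) b)) = σ (θ (D.drinfeldRHS ν (D.B₂toB a) b))
    rw [D.map_drinfeldLHS ν hσπ hσω, D.map_drinfeldRHS ν hσπ hσω]
    exact (key b a).symm
  · obtain ⟨b, rfl⟩ := D.BK_le_range h
    exact key a b

end Link

end Datum

/-! ### Values at `q = 0` -/

/-- The rational function `c` is regular at `q = 0`, with value `v`. -/
def HasValue (c : K) (v : ℚ) : Prop :=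
  ∃ φ : PowerSeries ℚ, (c : LaurentSeries ℚ) = (φ : LaurentSeries ℚ) ∧
    PowerSeries.constantCoeff φ = v

namespace HasValue

theorem add {c c' : K} {v v' : ℚ} (h : HasValue c v) (h' : HasValue c' v') :
    HasValue (c + c') (v + v') := by
  obtain ⟨φ, h1, h2⟩ := h
  obtain ⟨φ', h1', h2'⟩ := h'
  exact ⟨φ + φ', by rw [map_add, h1, h1', PowerSeries.coe_add], by rw [map_add, h2, h2']⟩

theorem mul {c c' : K} {v v' : ℚ} (h : HasValue c v) (h' : HasValue c' v') :
    HasValue (c * c') (v * v') := by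
  obtain ⟨φ, h1, h2⟩ := h
  obtain ⟨φ', h1', h2'⟩ := h'
  exact ⟨φ * φ', by rw [map_mul, h1, h1', PowerSeries.coe_mul], by rw [map_mul, h2, h2']⟩

theorem zero : HasValue 0 0 := ⟨0, by rw [map_zero, PowerSeries.coe_zero], map_zero _⟩

theorem one : HasValue 1 1 := ⟨1, by rw [map_one, PowerSeries.coe_one], map_one _⟩

theorem neg {c : K} {v : ℚ} (h : HasValue c v) : HasValue (-c) (-v) := by
  obtain ⟨φ, h1, h2⟩ := h
  exact ⟨-φ, by rw [map_neg, h1, PowerSeries.coe_neg], by rw [map_neg, h2]⟩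

theorem natCast (n : ℕ) : HasValue n n := by
  induction n with
  | zero => simpa using zero
  | succ n ih => simpa using ih.add one

theorem intCast (n : ℤ) : HasValue n n := by
  cases n with
  | ofNat n => simpa using natCast n
  | negSucc n => simpa using (natCast (n + 1)).neg

theorem sum {ι : Type*} {s : Finset ι} {c : ι → K} {v : ι → ℚ}
    (h : ∀ i ∈ s, HasValue (c i) (v i)) : HasValue (∑ i ∈ s, c i) (∑ i ∈ s, v i) := by
  classical
  induction s using Finset.induction_on with
  | empty => simpa using zero
  | insert i s hi ih =>
    rw [Finset.sum_insert hi, Finset.sum_insert hi]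
    exact (h i (Finset.mem_insert_self i s)).add (ih fun j hj => h j (Finset.mem_insert_of_mem hj))

theorem prod {ι : Type*} {s : Finset ι} {c : ι → K} {v : ι → ℚ}
    (h : ∀ i ∈ s, HasValue (c i) (v i)) : HasValue (∏ i ∈ s, c i) (∏ i ∈ s, v i) := by
  classical
  induction s using Finset.induction_on with
  | empty => simpa using one
  | insert i s hi ih =>
    rw [Finset.prod_insert hi, Finset.prod_insert hi]
    exact (h i (Finset.mem_insert_self i s)).mul (ih fun j hj => h j (Finset.mem_insert_of_mem hj))

theorem det {ι : Type*} [Fintype ι] [DecidableEq ι] {M : Matrix ι ι K} {V : Matrix ι ι ℚ}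
    (h : ∀ i j, HasValue (M i j) (V i j)) : HasValue M.det V.det := by
  rw [Matrix.det_apply', Matrix.det_apply']
  exact sum fun σ _ => (intCast _).mul (prod fun i _ => h _ _)

theorem eq_zero {v : ℚ} (h : HasValue 0 v) : v = 0 := by
  obtain ⟨φ, h1, h2⟩ := h
  rw [map_zero] at h1
  have : φ = 0 := HahnSeries.ofPowerSeries_injective (Γ := ℤ) (h1.symm.trans (map_zero _).symm)
  rw [← h2, this, map_zero]

theorem ne_zero {c : K} (h : HasValue c 1) : c ≠ 0 := by
  rintro rfl
  exact one_ne_zero h.eq_zero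

theorem of_onePlusNat {c : K} (h : OnePlusNat c) : HasValue c 1 := by
  obtain ⟨φ, h1, h2⟩ := h
  refine ⟨_, h2, ?_⟩
  rw [← PowerSeries.coeff_zero_eq_constantCoeff_apply, PowerSeries.coeff_map,
    PowerSeries.coeff_zero_eq_constantCoeff_apply, h1, map_one]

theorem q_zpow {n : ℤ} (hn : 0 < n) : HasValue (q ^ n) 0 := by
  obtain ⟨m, rfl⟩ := Int.eq_ofNat_of_zero_le hn.le
  have hm : m ≠ 0 := by rintro rfl; exact lt_irrefl _ hn
  refine ⟨PowerSeries.X ^ m, ?_, by rw [map_pow, PowerSeries.constantCoeff_X, zero_pow hm]⟩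
  rw [zpow_natCast, map_pow, PowerSeries.coe_pow, PowerSeries.coe_X, RatFunc.coe_X]

end HasValue

/-- A matrix that specializes to the identity matrix at `q = 0` is invertible. -/
theorem det_ne_zero_of_hasValue {ι : Type*} [Fintype ι] [DecidableEq ι] {M : Matrix ι ι K}
    (h : ∀ i j, HasValue (M i j) (if i = j then 1 else 0)) : M.det ≠ 0 := by
  have := HasValue.det (V := (1 : Matrix ι ι ℚ)) fun i j => by rw [Matrix.one_apply]; exact h i j
  rw [Matrix.det_one] at this
  exact this.ne_zero

/-- A family whose Gram matrices specialize to identity matrices at `q = 0` admits no relation that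
is orthogonal to its own members. -/
theorem finsupp_eq_zero_of_hasValue {ι : Type*} [DecidableEq ι] {G : ι → ι → K} {c : ι →₀ K}
    (h : ∀ i ∈ c.support, ∀ j ∈ c.support, HasValue (G i j) (if i = j then 1 else 0))
    (h0 : ∀ j ∈ c.support, c.sum (fun i a => a * G i j) = 0) : c = 0 := by
  let M : Matrix c.support c.support K := fun i j => G i j
  have hM : M.det ≠ 0 := det_ne_zero_of_hasValue fun i j => by
    have := h i i.2 j j.2
    simpa only [Subtype.ext_iff] using this
  have hv : (fun i : c.support => c i) = 0 := by
    refine Matrix.eq_zero_of_vecMul_eq_zero hM (funext fun j => ?_)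
    have := h0 j j.2
    rw [Finsupp.sum, ← Finset.sum_coe_sort] at this
    exact this
  ext i
  by_cases hi : i ∈ c.support
  · exact congrFun hv ⟨i, hi⟩
  · simpa using hi

/-- The sum of `g u' * g' u''` over the decompositions `u = u' ++ u''`. -/
def decon {X : Type*} (g g' : List X → ℚ) : List X → ℚ
  | [] => g [] * g' []
  | x :: u => g [] * g' (x :: u) + decon (fun w => g (x :: w)) g' u

open Classical in
theorem decon_ite_nil {X : Type*} (c : ℚ) (g' : List X → ℚ) (u : List X) :
    decon (fun w => if w = [] then c else 0) g' u = c * g' u := by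
  have h0 : ∀ u : List X, decon (fun _ => 0) g' u = 0 := by
    intro u
    induction u with
    | nil => simp [decon]
    | cons x u ih => simp [decon, ih]
  cases u with
  | nil => simp [decon]
  | cons x u => simp [decon, h0]

open Classical in
theorem decon_ite {X : Type*} (x : X) (w u : List X) :
    decon (fun v => if v = [x] then 1 else 0) (fun v => if v = w then 1 else 0) u =
      if u = x :: w then 1 else 0 := by
  cases u with
  | nil => simp [decon]
  | cons y u =>
    by_cases h : y = x
    · subst h
      simp [decon, decon_ite_nil]
    · have := decon_ite_nil 0 (fun v => if v = w then 1 else 0) u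
      simp only [ite_self, zero_mul] at this
      simp [decon, h, this]

namespace Datum

section Hyperbolic

variable {I : Type*} {P : Type*} [AddCommGroup P] {D : Datum I P} (ν : D.Iinf → K)

/-- The twist in the multiplication of `F ⊗ F` can be moved to the functionals. -/
theorem mul'_map_twistMul_mon (g g' : List D.Iinf → K) (w w' : List D.Iinf)
    (s : D.F ⊗[K] D.F) :
    LinearMap.mul' K K (TensorProduct.map (linExt g) (linExt g')
      (D.twistMul (mon w ⊗ₜ[K] mon w') s)) =
    LinearMap.mul' K K (TensorProduct.map
      (linExt fun v => q ^ (-D.rootForm (D.wt w') (D.wt v)) * g (w ++ v))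
      (linExt fun v => g' (w' ++ v)) s) := by
  suffices h : LinearMap.mul' K K ∘ₗ TensorProduct.map (linExt g) (linExt g') ∘ₗ
      D.twistMul (mon w ⊗ₜ[K] mon w') =
    LinearMap.mul' K K ∘ₗ TensorProduct.map
      (linExt fun v => q ^ (-D.rootForm (D.wt w') (D.wt v)) * g (w ++ v))
      (linExt fun v => g' (w' ++ v)) from DFunLike.congr_fun h s
  refine linearMap_ext_mon_tmul fun u v => ?_
  simp [twistMul_mon, linExt_mon, mul_assoc]

/-- If `a_ii < 0`, the twists in the multiplication of `F ⊗ F` between nonempty words in the `f_il`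
are positive powers of `q`. -/
theorem rootForm_single_wt_neg {i : I} (hi : D.A i i < 0) {x : D.Iinf} (hx : x.idx = i)
    {v : List D.Iinf} (hv : ∀ y ∈ v, y.idx = i) (h0 : v ≠ []) :
    0 < -D.rootForm (D.wt [x]) (D.wt v) := by
  rw [wt_cons, wt_nil, add_zero, hx, D.wt_eq_single hv, rootForm_single]
  have h1 : 0 < wdeg v := by
    cases v with
    | nil => exact absurd rfl h0
    | cons y v => rw [wdeg_cons]; have := y.deg_pos; omega
  have h2 := x.deg_pos
  have h3 := D.r_pos i
  have h4 : (D.r i : ℤ) * D.A i i < 0 := mul_neg_of_pos_of_neg (by exact_mod_cast h3) hi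
  have h5 : 0 < (x.deg : ℤ) * wdeg v := by positivity
  have := mul_neg_of_pos_of_neg h5 h4
  linarith

/-- If `a_ii < 0`, the coefficients `q_(i)^(-mn)` with `m, n > 0` vanish at `q = 0`. -/
theorem hasValue_qpar {i : I} (hi : D.A i i < 0) {m n : ℕ} (hm : 0 < m) (hn : 0 < n) :
    HasValue (D.qpar i ^ (-((m * n : ℕ) : ℤ))) 0 := by
  rw [qpar, ← zpow_mul]
  refine HasValue.q_zpow ?_
  have h3 : (0 : ℤ) < D.r i := by exact_mod_cast D.r_pos i
  have h4 : D.A i i / 2 < 0 := by omega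
  have h5 : (0 : ℤ) < ((m * n : ℕ) : ℤ) := by positivity
  have := mul_pos (neg_pos.2 (mul_neg_of_pos_of_neg h3 h4)) h5
  linarith

open Classical in
/-- If `a_ii < 0`, then at `q = 0` the comultiplication of a word in the `f_il` becomes the
deconcatenation of words. -/
theorem hasValue_rhoWord {i : I} (hi : D.A i i < 0) (u : List D.Iinf) (hu : ∀ x ∈ u, x.idx = i)
    {g g' : List D.Iinf → K} {v v' : List D.Iinf → ℚ}
    (hg : ∀ w, (∀ x ∈ w, x.idx = i) → HasValue (g w) (v w))
    (hg' : ∀ w, (∀ x ∈ w, x.idx = i) → HasValue (g' w) (v' w)) :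
    HasValue (LinearMap.mul' K K (TensorProduct.map (linExt g) (linExt g') (D.rhoWord u)))
      (decon v v' u) := by
  induction u generalizing g g' v v' with
  | nil =>
    rw [rhoWord, ← mon_nil, TensorProduct.map_tmul, LinearMap.mul'_apply, linExt_mon, linExt_mon]
    exact (hg [] (by simp)).mul (hg' [] (by simp))
  | cons x u ih =>
    have hx : x.idx = i := hu x List.mem_cons_self
    have hu' : ∀ y ∈ u, y.idx = i := fun y hy => hu y (List.mem_cons_of_mem x hy)
    have hcons : ∀ {y : D.Iinf} {w : List D.Iinf}, y.idx = i → (∀ x ∈ w, x.idx = i) →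
        ∀ x ∈ y :: w, x.idx = i := by
      intro y w hy hw z hz
      rcases List.mem_cons.1 hz with rfl | h
      · exact hy
      · exact hw z h
    -- the twist makes the factor `1 ⊗ f_y` pick out the empty word on the left
    have h2 : ∀ (y : D.Iinf), y.idx = i → ∀ (w : List D.Iinf), (∀ x ∈ w, x.idx = i) →
        ∀ w', (∀ x ∈ w', x.idx = i) →
        HasValue (q ^ (-D.rootForm (D.wt [y]) (D.wt w')) * g (w ++ w'))
          (if w' = [] then v w else 0) := by
      intro y hy w hw w' hw'
      split_ifs with h
      · subst h
        rw [wt_nil, ← rootFormHom_apply, map_zero, neg_zero, zpow_zero, one_mul, List.append_nil]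
        exact hg w hw
      · have := (HasValue.q_zpow (rootForm_single_wt_neg hi hy hw' h)).mul
          (hg (w ++ w') fun z hz => (List.mem_append.1 hz).elim (hw z) (hw' z))
        rwa [zero_mul] at this
    have hne : (x.deg, 0) ≠ (0, x.deg) := by
      have := x.deg_pos
      simp; omega
    have hsum : decon v v' (x :: u) = ∑ p ∈ Finset.HasAntidiagonal.antidiagonal x.deg,
        if p = (x.deg, 0) then decon (fun w => v (x :: w)) v' u
        else if p = (0, x.deg) then v [] * v' (x :: u) else 0 := by
      rw [Finset.sum_eq_add (x.deg, 0) (0, x.deg) hne]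
      · rw [if_pos rfl, if_neg hne.symm, if_pos rfl, decon, add_comm]
      · rintro p - ⟨h1, h2⟩
        rw [if_neg h1, if_neg h2]
      · simp
      · simp
    -- of `ϱ(f_x) = Σ q_(i)^(-mn) f_im ⊗ f_in` only `f_x ⊗ 1` and `1 ⊗ f_x` survive at `q = 0`
    rw [hsum, rhoWord, rhoGen, map_sum, LinearMap.sum_apply, map_sum, map_sum]
    refine HasValue.sum fun p hp => ?_
    have hp' : p.1 + p.2 = x.deg := Finset.HasAntidiagonal.mem_antidiagonal.1 hp
    rw [map_smul, LinearMap.smul_apply, map_smul, map_smul, smul_eq_mul]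
    by_cases h20 : p.2 = 0
    · have hp0 : p = (x.deg, 0) := Prod.ext (by dsimp only; omega) h20
      rw [if_pos hp0, hp0]
      dsimp only
      rw [mul_zero, Nat.cast_zero, neg_zero, zpow_zero, one_mul, fgen_self, fgen_zero,
        ← mon_singleton, ← mon_nil, mul'_map_twistMul_mon]
      refine ih hu' (fun w hw => ?_) hg'
      rw [wt_nil, ← rootFormHom_apply, map_zero, AddMonoidHom.zero_apply, neg_zero, zpow_zero,
        one_mul]
      exact hg _ (hcons hx hw)
    · rw [if_neg (fun h => h20 (by rw [h]))]
      by_cases h10 : p.1 = 0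
      · have hp0 : p = (0, x.deg) := Prod.ext h10 (by dsimp only; omega)
        rw [if_pos hp0, hp0]
        dsimp only
        rw [zero_mul, Nat.cast_zero, neg_zero, zpow_zero, one_mul, fgen_self, fgen_zero,
          ← mon_singleton, ← mon_nil, mul'_map_twistMul_mon]
        change HasValue _ (v [] * (fun w => v' (x :: w)) u)
        rw [← decon_ite_nil (v []) (fun w => v' (x :: w)) u]
        exact ih hu' (h2 x hx [] (by simp)) fun w hw => hg' _ (hcons hx hw)
      · rw [if_neg (fun h => h10 (by rw [h]))]
        have e1 := x.valid_of_le h10 (by omega)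
        have e2 := x.valid_of_le h20 (by omega)
        rw [fgen_of_valid e1, fgen_of_valid e2, ← mon_singleton, ← mon_singleton,
          mul'_map_twistMul_mon]
        have := (hasValue_qpar (D := D) (i := x.idx) (hx ▸ hi) (Nat.pos_of_ne_zero h10)
          (Nat.pos_of_ne_zero h20)).mul (ih hu'
            (h2 (Iinf.of e2) hx [Iinf.of e1] (fun y hy => (List.mem_singleton.1 hy).symm ▸ hx))
            (fun w hw => hg' (Iinf.of e2 :: w) (hcons hx hw)))
        rwa [zero_mul] at this

open Classical in
/-- If `a_ii < 0`, the generator `f_il` is orthogonal at `q = 0` to all words other than itself. -/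
theorem hasValue_pairGenWord (hν : ∀ x, HasValue (ν x) 1) {x : D.Iinf} (hx : D.A x.idx x.idx < 0)
    (u : List D.Iinf) : HasValue (D.pairGenWord ν x.idx x.deg u) (if u = [x] then 1 else 0) := by
  suffices h : ∀ (l : ℕ) (u : List D.Iinf), l ≠ 0 → ∃ c, HasValue (D.pairGenWord ν x.idx l u) c ∧
      (l = x.deg → c = if u = [x] then 1 else 0) by
    obtain ⟨c, h1, h2⟩ := h x.deg u x.deg_pos.ne'
    rwa [h2 rfl] at h1
  intro l u
  induction u generalizing l with
  | nil =>
    intro hl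
    exact ⟨0, by rw [pairGenWord_nil, if_neg hl]; exact .zero, by simp⟩
  | cons y u ih =>
    intro hl
    rw [pairGenWord_cons]
    by_cases hy : y.idx = x.idx ∧ y.deg ≤ l
    · rw [if_pos hy]
      by_cases h : y.deg = l
      · rw [h, Nat.sub_self, mul_zero, Nat.cast_zero, neg_zero, zpow_zero, one_mul,
          pairGenWord_zero]
        refine ⟨if u = [] then 1 else 0, ?_, ?_⟩
        · have := (hν y).mul (c' := if u = [] then 1 else 0) (v' := if u = [] then 1 else 0)
            (by split_ifs; exacts [.one, .zero])
          rwa [one_mul] at this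
        · intro hlx
          have : y = x := Iinf.ext hy.1 (by omega)
          simp [this]
      · obtain ⟨c, hc, -⟩ := ih (l - y.deg) (by omega)
        refine ⟨0, ?_, fun hlx => ?_⟩
        · have := ((hasValue_qpar (D := D) hx y.deg_pos (n := l - y.deg) (by omega)).mul
            (hν y)).mul hc
          rwa [zero_mul, zero_mul] at this
        · rw [if_neg]
          intro e
          simp only [List.cons.injEq] at e
          exact h (by rw [e.1, hlx])
    · rw [if_neg hy]
      refine ⟨0, .zero, fun hlx => ?_⟩
      rw [if_neg]
      intro e
      simp only [List.cons.injEq] at e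
      exact hy ⟨by rw [e.1], by rw [e.1, hlx]⟩

open Classical in
/-- If `a_ii < 0`, then the words in the `f_il` are orthonormal at `q = 0`. -/
theorem hasValue_form (hν : ∀ x, HasValue (ν x) 1) {i : I} (hi : D.A i i < 0) (u w : List D.Iinf)
    (hu : ∀ x ∈ u, x.idx = i) (hw : ∀ x ∈ w, x.idx = i) :
    HasValue (D.form ν (mon u) (mon w)) (if u = w then 1 else 0) := by
  rw [Torus.form_mon_right]
  induction w generalizing u with
  | nil => rw [pairWord, linExt_mon]; split_ifs; exacts [.one, .zero]
  | cons x w ih =>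
    have hx : x.idx = i := hw x List.mem_cons_self
    have e : D.pairWord ν w = linExt fun v => D.pairWord ν w (mon v) :=
      linearMap_ext_mon fun v => by rw [linExt_mon]
    rw [pairWord, LinearMap.comp_apply, LinearMap.comp_apply, rho_mon, e, ← decon_ite]
    exact hasValue_rhoWord hi u hu (fun v _ => hasValue_pairGenWord ν hν (hx ▸ hi) v)
      fun v hv => ih v hv fun y hy => hw y (List.mem_cons_of_mem x hy)

end Hyperbolic

/-! ### Construction of the primitive generators -/

section Canonical

variable {I : Type*} {P : Type*} [AddCommGroup P] {D : Datum I P}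

theorem homog_mul_mem {β γ : I →₀ ℤ} {z y : D.F} (hz : z ∈ D.homog β) (hy : y ∈ D.homog γ) :
    z * y ∈ D.homog (β + γ) := by
  refine homog_induction (p := fun z => z * y ∈ D.homog (β + γ)) (by simp)
    (fun a b ha hb => ?_) (fun c a ha => ?_) (fun w hw => ?_) hz
  · rw [add_mul]; exact add_mem ha hb
  · rw [smul_mul_assoc]; exact Submodule.smul_mem _ _ ha
  refine homog_induction (p := fun y => mon w * y ∈ D.homog (β + γ)) (by simp)
    (fun a b ha hb => ?_) (fun c a ha => ?_) (fun w' hw' => ?_) hy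
  · rw [mul_add]; exact add_mem ha hb
  · rw [mul_smul_comm]; exact Submodule.smul_mem _ _ ha
  rw [← mon_append]
  exact mon_mem_homog (by rw [wt_append, hw, hw'])

theorem wt_ne_zero {w : List D.Iinf} (hw : w ≠ []) : D.wt w ≠ 0 := by
  obtain ⟨x, hx⟩ := List.exists_mem_of_ne_nil w hw
  intro h
  have := D.wt_apply_neg hx
  rw [h] at this
  exact lt_irrefl _ this

theorem wt_singleton (x : D.Iinf) : D.wt [x] = Finsupp.single x.idx (-(x.deg : ℤ)) := by
  rw [wt_cons, wt_nil, add_zero]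

theorem mon_mem_lower {x : D.Iinf} {w : List D.Iinf}
    (hw : ∀ y ∈ w, y.idx = x.idx ∧ y.deg < x.deg) : mon w ∈ D.lower x := by
  refine Subalgebra.list_prod_mem _ fun z hz => ?_
  obtain ⟨y, hy, rfl⟩ := List.mem_map.1 hz
  exact Algebra.subset_adjoin ⟨y, (hw y hy).1, (hw y hy).2, rfl⟩

/-- The subalgebra of `F` generated by the `f_ik`, `k < l`, is spanned by the words in them. -/
theorem lower_le_span (x : D.Iinf) {z : D.F} (hz : z ∈ D.lower x) :
    z ∈ Submodule.span K {m | ∃ w, (∀ y ∈ w, y.idx = x.idx ∧ y.deg < x.deg) ∧ m = mon w} := by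
  induction hz using Algebra.adjoin_induction with
  | mem z hz =>
    obtain ⟨y, h1, h2, rfl⟩ := hz
    exact Submodule.subset_span ⟨[y], by simp [h1, h2], (mon_singleton y).symm⟩
  | algebraMap c =>
    rw [Algebra.algebraMap_eq_smul_one, ← mon_nil]
    exact Submodule.smul_mem _ _ (Submodule.subset_span ⟨[], by simp, rfl⟩)
  | add a b _ _ ha hb => exact add_mem ha hb
  | mul a b _ _ ha hb =>
    have := Submodule.mul_mem_mul ha hb
    rw [Submodule.span_mul_span] at this
    refine Submodule.span_mono ?_ this
    rintro _ ⟨_, ⟨u, hu, rfl⟩, _, ⟨w, hw, rfl⟩, rfl⟩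
    exact ⟨u ++ w, fun y hy => (List.mem_append.1 hy).elim (hu y) (hw y), (mon_append u w).symm⟩

/-- A word with the weight of the generator `x`, other than `x`, has letters of smaller degree. -/
theorem lower_of_wt_eq {x : D.Iinf} {w : List D.Iinf} (hw : D.wt w = D.wt [x]) (hne : w ≠ [x]) :
    ∀ y ∈ w, y.idx = x.idx ∧ y.deg < x.deg := by
  rw [wt_singleton] at hw
  have hidx := D.idx_of_wt_eq_single hw
  have hdeg := D.wdeg_of_wt_eq_single hw
  intro y hy
  refine ⟨hidx y hy, ?_⟩
  by_contra hlt
  obtain ⟨u, v, rfl⟩ := List.append_of_mem hy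
  have hpos : ∀ u : List D.Iinf, u ≠ [] → 0 < wdeg u := by
    intro u hu
    cases u with
    | nil => exact absurd rfl hu
    | cons z u => rw [wdeg_cons]; have := z.deg_pos; omega
  have e : wdeg (u ++ y :: v) = wdeg u + (y.deg + wdeg v) := by simp [wdeg]
  have hu : u = [] := by
    by_contra h
    have := hpos u h
    omega
  have hv : v = [] := by
    by_contra h
    have := hpos v h
    omega
  subst hu hv
  refine hne ?_
  rw [List.nil_append, Iinf.ext (hidx y hy) (by simp [wdeg] at hdeg; exact hdeg)]

variable (ν : D.Iinf → K)

namespace Torus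

variable {T : Type*} [AddCommGroup T] (τ : D.Torus T)

theorem untwist_tmul_one (z : D.F) : τ.untwist (z ⊗ₜ[K] 1) = τ.incl z ⊗ₜ[K] 1 := by
  refine mon_induction (p := fun z => τ.untwist (z ⊗ₜ[K] 1) = τ.incl z ⊗ₜ[K] 1) (by simp)
    (fun a b ha hb => ?_) (fun c a ha => ?_) (fun w => ?_) z
  · rw [TensorProduct.add_tmul, map_add, ha, hb, map_add, TensorProduct.add_tmul]
  · rw [← TensorProduct.smul_tmul', map_smul, ha, map_smul, TensorProduct.smul_tmul']
  · rw [← mon_nil, untwist_mon, wt_nil, neg_zero, map_zero, t_zero, mul_one, mon_nil, map_one]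

theorem untwist_one_tmul {β : I →₀ ℤ} {z : D.F} (hz : z ∈ D.homog β) :
    τ.untwist (1 ⊗ₜ[K] z) = τ.t (τ.k (-β)) ⊗ₜ[K] τ.incl z := by
  refine homog_induction
    (p := fun z => τ.untwist (1 ⊗ₜ[K] z) = τ.t (τ.k (-β)) ⊗ₜ[K] τ.incl z) (by simp)
    (fun a b ha hb => ?_) (fun c a ha => ?_) (fun w hw => ?_) hz
  · rw [TensorProduct.tmul_add, map_add, ha, hb, map_add, TensorProduct.tmul_add]
  · rw [TensorProduct.tmul_smul, map_smul, ha, map_smul, TensorProduct.tmul_smul]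
  · rw [← mon_nil, untwist_mon, hw, mon_nil, map_one, one_mul]

/-- An element that is primitive for the twisted comultiplication of `F` is primitive in `H`. -/
theorem isPrim_of_rho {β : I →₀ ℤ} {z : D.F} (hz : z ∈ D.homog β)
    (h : D.rho z = z ⊗ₜ[K] 1 + 1 ⊗ₜ[K] z) : τ.IsPrim (-β) z := by
  rw [IsPrim, comulHom_incl, h, map_add, untwist_tmul_one, untwist_one_tmul τ hz]

variable {τ} in
theorem IsPrim.smul {γ : I →₀ ℤ} {z : D.F} (h : τ.IsPrim γ z) (c : K) : τ.IsPrim γ (c • z) := by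
  rw [IsPrim] at *
  rw [map_smul, map_smul, h, smul_add, TensorProduct.smul_tmul', TensorProduct.tmul_smul]

variable {ν τ} in
/-- A primitive element is orthogonal to products. -/
theorem IsPrim.form_mul_eq_zero {γ β β' : I →₀ ℤ} {z y y' : D.F} (h : τ.IsPrim γ z)
    (hβ : β ≠ 0) (hβ' : β' ≠ 0) (hy : y ∈ D.homog β) (hy' : y' ∈ D.homog β') :
    D.form ν z (y * y') = 0 := by
  rw [← τ.pair_incl', map_mul, map_mul, LinearMap.convMul_apply, comul_eq, h, map_add, map_add,
    TensorProduct.map_tmul, TensorProduct.map_tmul, LinearMap.mul'_apply, LinearMap.mul'_apply,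
    ← t_zero]
  have h1 := τ.pairF_t ν hβ' hy' 0
  have h2 := τ.pairF_t ν hβ hy (τ.k γ)
  rw [pairF] at h1 h2
  rw [h1, h2, mul_zero, zero_mul, add_zero]

end Torus

/-- `z` is a primitive generator `b_x` for which the comultiplication takes the form
`Δ(z) = z ⊗ 1 + K ⊗ z`. -/
structure IsCanonical (x : D.Iinf) (z : D.F) : Prop where
  weight : z ∈ D.homog (D.wt [x])
  leading : z - FreeAlgebra.ι K x ∈ D.lower x
  prim : D.coTorus.IsPrim (-(D.wt [x])) z
  prim₂ : D.rootTorus.IsPrim (-(D.wt [x])) z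
  real : D.IsReal x.idx → z = FreeAlgebra.ι K x

/-- Primitivity implies the orthogonality to all polynomials in generators of smaller degree. -/
theorem IsCanonical.orthogonal {x : D.Iinf} {z : D.F} (h : IsCanonical x z) {y : D.F}
    (hy : y ∈ D.lower x) : D.form ν z y = 0 := by
  have hy' := D.lower_le_span x hy
  induction hy' using Submodule.span_induction with
  | mem y hy' =>
    obtain ⟨w, hw, rfl⟩ := hy'
    match w with
    | [] =>
      exact form_homog_eq_zero ν (wt_ne_zero (List.cons_ne_nil x [])) h.weight (mon_mem_homog rfl)
    | [y] =>
      refine form_homog_eq_zero ν (fun e => ?_) h.weight (mon_mem_homog rfl)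
      have := hw y (by simp)
      rw [wt_singleton, wt_singleton, this.1] at e
      have := Finsupp.single_injective _ e
      omega
    | y :: y' :: w =>
      rw [mon_cons, ← mon_singleton]
      exact h.prim.form_mul_eq_zero (wt_ne_zero (List.cons_ne_nil y []))
        (wt_ne_zero (List.cons_ne_nil y' w)) (mon_mem_homog rfl) (mon_mem_homog rfl)
  | zero => exact map_zero _
  | add a b ha' hb' ha hb =>
    have hsub : ∀ c ∈ Submodule.span K
        {m | ∃ w, (∀ y ∈ w, y.idx = x.idx ∧ y.deg < x.deg) ∧ m = mon w}, c ∈ D.lower x := by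
      intro c hc
      refine (Submodule.span_le (p := Subalgebra.toSubmodule (D.lower x))).2 ?_ hc
      rintro _ ⟨w, hw, rfl⟩
      exact mon_mem_lower hw
    rw [map_add, ha (hsub a ha'), hb (hsub b hb'), add_zero]
  | smul c a ha' ha =>
    have hsub : a ∈ D.lower x := by
      refine (Submodule.span_le (p := Subalgebra.toSubmodule (D.lower x))).2 ?_ ha'
      rintro _ ⟨w, hw, rfl⟩
      exact mon_mem_lower hw
    rw [map_smul, ha hsub, smul_zero]

theorem isCanonical_real {x : D.Iinf} (hx : D.IsReal x.idx) :
    IsCanonical x (FreeAlgebra.ι K x) := by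
  have hdeg := x.deg_of_real hx
  have hw : FreeAlgebra.ι K x ∈ D.homog (D.wt [x]) := mon_singleton x ▸ mon_mem_homog rfl
  have hρ : D.rho (FreeAlgebra.ι K x) = FreeAlgebra.ι K x ⊗ₜ[K] 1 + 1 ⊗ₜ[K] FreeAlgebra.ι K x := by
    have e := D.fgen_self x
    rw [hdeg] at e
    rw [rho_ι, rhoGen, hdeg, Finset.Nat.antidiagonal_succ]
    simp [fgen_zero, e, add_comm]
  exact ⟨hw, by rw [sub_self]; exact zero_mem _, D.coTorus.isPrim_of_rho hw hρ,
    D.rootTorus.isPrim_of_rho hw hρ, fun _ => rfl⟩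

section Hyperbolic

/-- There are finitely many words with the weight of `f_x`: their letters and lengths are bounded.
-/
theorem finite_words (x : D.Iinf) : {w : List D.Iinf | D.wt w = D.wt [x] ∧ w ≠ [x]}.Finite := by
  have hdeg : ∀ w : List D.Iinf, D.wt w = D.wt [x] → (w.map Iinf.deg).sum = x.deg := by
    intro w hw
    rw [wt_singleton] at hw
    exact D.wdeg_of_wt_eq_single hw
  let φ : {w : List D.Iinf | D.wt w = D.wt [x] ∧ w ≠ [x]} → Composition x.deg := fun w =>
    ⟨w.1.map Iinf.deg, fun {i} hi => by
      obtain ⟨y, -, rfl⟩ := List.mem_map.1 hi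
      exact y.deg_pos, hdeg w.1 w.2.1⟩
  refine Set.finite_coe_iff.1 (Finite.of_injective φ fun u w h => Subtype.ext ?_)
  have hd : u.1.map Iinf.deg = w.1.map Iinf.deg := congrArg Composition.blocks h
  have hidx : ∀ v : List D.Iinf, D.wt v = D.wt [x] → ∀ y ∈ v, y.idx = x.idx := by
    intro v hv
    rw [wt_singleton] at hv
    exact D.idx_of_wt_eq_single hv
  have key : ∀ u w : List D.Iinf, (∀ y ∈ u, y.idx = x.idx) → (∀ y ∈ w, y.idx = x.idx) →
      u.map Iinf.deg = w.map Iinf.deg → u = w := by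
    intro u
    induction u with
    | nil =>
      intro w _ _ h
      exact (List.map_eq_nil_iff.1 h.symm).symm
    | cons y u ih =>
      intro w hu hw h
      cases w with
      | nil => simp at h
      | cons z w =>
        simp only [List.map_cons, List.cons.injEq] at h
        rw [Iinf.ext ((hu y List.mem_cons_self).trans (hw z List.mem_cons_self).symm) h.1,
          ih w (fun a ha => hu a (List.mem_cons_of_mem _ ha))
            (fun a ha => hw a (List.mem_cons_of_mem _ ha)) h.2]
  exact key _ _ (hidx u.1 u.2.1) (hidx w.1 w.2.1) hd

open Classical in
/-- If `a_ii < 0`, the Gram matrix of the words of weight `-l α_i` other than `f_il` is invertible,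
so `f_il` can be corrected to be orthogonal to these words. -/
theorem exists_orthogonal (hν : ∀ x, HasValue (ν x) 1) {x : D.Iinf} (hx : D.A x.idx x.idx < 0) :
    ∃ z, z ∈ D.homog (D.wt [x]) ∧ z - FreeAlgebra.ι K x ∈ D.lower x ∧
      ∀ w, D.wt w = D.wt [x] → w ≠ [x] → D.form ν z (mon w) = 0 := by
  let S := (finite_words x).toFinset
  have hS : ∀ w, w ∈ S ↔ D.wt w = D.wt [x] ∧ w ≠ [x] := fun w => Set.Finite.mem_toFinset _
  let M : Matrix S S K := fun u w => D.form ν (mon u) (mon w)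
  have hM : M.det ≠ 0 := det_ne_zero_of_hasValue fun u w => by
    have := hasValue_form ν hν hx u w
      (fun y hy => (lower_of_wt_eq ((hS u).1 u.2).1 ((hS u).1 u.2).2 y hy).1)
      (fun y hy => (lower_of_wt_eq ((hS w).1 w.2).1 ((hS w).1 w.2).2 y hy).1)
    simpa only [Subtype.ext_iff] using this
  let c : S → K := Matrix.vecMul (fun w : S => -D.form ν (FreeAlgebra.ι K x) (mon w)) M⁻¹
  have hc : Matrix.vecMul c M = fun w : S => -D.form ν (FreeAlgebra.ι K x) (mon w) := by
    rw [Matrix.vecMul_vecMul, Matrix.nonsing_inv_mul _ (isUnit_iff_ne_zero.2 hM), Matrix.vecMul_one]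
  refine ⟨FreeAlgebra.ι K x + ∑ w : S, c w • mon w, ?_, ?_, fun w hw hne => ?_⟩
  · refine add_mem (mon_singleton x ▸ mon_mem_homog rfl) (sum_mem fun w _ => ?_)
    exact Submodule.smul_mem _ _ (mon_mem_homog ((hS w).1 w.2).1)
  · rw [add_sub_cancel_left]
    refine sum_mem fun w _ => Subalgebra.smul_mem _ (mon_mem_lower ?_) _
    exact lower_of_wt_eq ((hS w).1 w.2).1 ((hS w).1 w.2).2
  · have := congrFun hc ⟨w, (hS w).2 ⟨hw, hne⟩⟩
    rw [Matrix.vecMul, dotProduct] at this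
    rw [map_add, LinearMap.add_apply, map_sum, LinearMap.sum_apply, add_comm, ← eq_neg_iff_add_eq_zero,
      ← this]
    exact Finset.sum_congr rfl fun u _ => by rw [map_smul, LinearMap.smul_apply, smul_eq_mul]

open Classical in
/-- The form on `F ⊗ F` is nondegenerate on words in the `f_il`, if `a_ii < 0`. -/
theorem tensor_eq_zero (hν : ∀ x, HasValue (ν x) 1) {i : I} (hi : D.A i i < 0) {c : ℤ}
    {s : D.F ⊗[K] D.F} (hs : s ∈ homogTensor (D := D) (Finsupp.single i c))
    (h : ∀ u v, D.wt u + D.wt v = Finsupp.single i c → LinearMap.mul' K K (TensorProduct.map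
      ((D.form ν).flip (mon u)) ((D.form ν).flip (mon v)) s) = 0) : s = 0 := by
  have hset : {s : D.F ⊗[K] D.F | ∃ u v, D.wt u + D.wt v = Finsupp.single i c ∧
      s = mon u ⊗ₜ[K] mon v} = (fun p : List D.Iinf × List D.Iinf => mon p.1 ⊗ₜ[K] mon p.2) ''
      {p | D.wt p.1 + D.wt p.2 = Finsupp.single i c} := by
    ext s
    constructor
    · rintro ⟨u, v, h, rfl⟩
      exact ⟨(u, v), h, rfl⟩
    · rintro ⟨⟨u, v⟩, h, rfl⟩
      exact ⟨u, v, h, rfl⟩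
  rw [homogTensor, hset, Finsupp.mem_span_image_iff_linearCombination] at hs
  obtain ⟨a, ha, rfl⟩ := hs
  have ha' : ∀ p ∈ a.support, D.wt p.1 + D.wt p.2 = Finsupp.single i c := fun p hp => ha hp
  have hidx : ∀ p ∈ a.support, (∀ y ∈ p.1, y.idx = i) ∧ ∀ y ∈ p.2, y.idx = i := by
    intro p hp
    have := D.idx_of_wt_eq_single ((D.wt_append p.1 p.2).trans (ha' p hp))
    exact ⟨fun y hy => this y (List.mem_append_left _ hy),
      fun y hy => this y (List.mem_append_right _ hy)⟩
  suffices a = 0 by rw [this, map_zero]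
  refine finsupp_eq_zero_of_hasValue
    (G := fun p p' => D.form ν (mon p.1) (mon p'.1) * D.form ν (mon p.2) (mon p'.2))
    (fun p hp p' hp' => ?_) fun p' hp' => ?_
  · have := (hasValue_form ν hν hi p.1 p'.1 (hidx p hp).1 (hidx p' hp').1).mul
      (hasValue_form ν hν hi p.2 p'.2 (hidx p hp).2 (hidx p' hp').2)
    convert this using 1
    rw [ite_mul, one_mul, zero_mul, ← ite_and]
    simp only [Prod.ext_iff]
  · have := h p'.1 p'.2 (ha' p' hp')
    rw [Finsupp.linearCombination_apply, Finsupp.sum, map_sum, map_sum] at this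
    rw [← this, Finsupp.sum]
    refine Finset.sum_congr rfl fun p _ => ?_
    rw [map_smul, map_smul, TensorProduct.map_tmul, LinearMap.mul'_apply, smul_eq_mul]
    rfl

/-- If `a_ii < 0`, an element orthogonal to all products is primitive, because the form on `F ⊗ F`
is nondegenerate and `(ϱ(z), u ⊗ v)_L = (z, u v)_L`. -/
theorem exists_isCanonical_hyperbolic (hν : ∀ x, HasValue (ν x) 1) {x : D.Iinf}
    (hx : D.A x.idx x.idx < 0) : ∃ z, IsCanonical x z := by
  obtain ⟨z, hw, hl, ho⟩ := exists_orthogonal ν hν hx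
  have hρ : D.rho z = z ⊗ₜ[K] 1 + 1 ⊗ₜ[K] z := by
    rw [← sub_eq_zero]
    refine tensor_eq_zero ν hν hx (c := -(x.deg : ℤ)) ?_ fun u v huv => ?_
    · rw [← wt_singleton]
      refine sub_mem (rho_mem hw) (add_mem ?_ ?_)
      · refine homog_induction
          (p := fun z => z ⊗ₜ[K] 1 ∈ homogTensor (D := D) (D.wt [x])) (by simp)
          (fun a b ha hb => ?_) (fun c a ha => ?_) (fun w hw => ?_) hw
        · rw [TensorProduct.add_tmul]; exact add_mem ha hb
        · rw [← TensorProduct.smul_tmul']; exact Submodule.smul_mem _ _ ha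
        · exact Submodule.subset_span ⟨w, [], by rw [hw, wt_nil, add_zero], rfl⟩
      · refine homog_induction
          (p := fun z => 1 ⊗ₜ[K] z ∈ homogTensor (D := D) (D.wt [x])) (by simp)
          (fun a b ha hb => ?_) (fun c a ha => ?_) (fun w hw => ?_) hw
        · rw [TensorProduct.tmul_add]; exact add_mem ha hb
        · rw [TensorProduct.tmul_smul]; exact Submodule.smul_mem _ _ ha
        · exact Submodule.subset_span ⟨[], w, by rw [hw, wt_nil, zero_add], rfl⟩
    · rw [← wt_singleton] at huv
      rw [map_sub, map_sub, ← form_mul_right, map_add, map_add, TensorProduct.map_tmul,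
        TensorProduct.map_tmul, LinearMap.mul'_apply, LinearMap.mul'_apply]
      simp only [LinearMap.flip_apply]
      have h1 : ∀ w : List D.Iinf, D.form ν 1 (mon w) = if w = [] then 1 else 0 :=
        fun w => form_one_left ν w
      by_cases hu : u = []
      · subst hu
        have hz : D.form ν z (mon []) = 0 := form_homog_eq_zero ν
          (wt_ne_zero (List.cons_ne_nil x [])) hw (mon_mem_homog rfl)
        rw [hz, h1 [], if_pos rfl, mon_nil, zero_mul, one_mul, one_mul, zero_add, sub_self]
      · by_cases hv : v = []
        · subst hv
          rw [h1 [], h1 u, if_pos rfl, if_neg hu, mon_nil, mul_one, mul_one, zero_mul, add_zero,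
            sub_self]
        · rw [h1, h1, if_neg hu, if_neg hv, ← mon_append, ho (u ++ v) (by rw [wt_append, huv])]
          · ring
          · intro e
            have := congrArg List.length e
            have h2 := List.length_pos_iff.2 hu
            have h3 := List.length_pos_iff.2 hv
            simp at this
            omega
  refine ⟨z, hw, hl, D.coTorus.isPrim_of_rho hw hρ, D.rootTorus.isPrim_of_rho hw hρ, fun h => ?_⟩
  rw [IsReal] at h
  omega

end Hyperbolic

end Canonical

/-! ### Primitive generators for `a_ii = 0` -/

section Isotropic

variable {I : Type*} {P : Type*} [AddCommGroup P] {D : Datum I P} (ν : D.Iinf → K)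

variable (D) in
/-- The noncommutative power sums `Ψ_l` in the `f_il`, defined by
`l f_il = Σ_{k=1}^l Ψ_k f_{i,l-k}`; they are primitive if `a_ii = 0`. -/
def psi (i : I) (l : ℕ) : D.F :=
  (l : K) • D.fgen i l - ∑ k : Fin l, psi i k * D.fgen i (l - k)
decreasing_by exact k.2

theorem psi_zero (i : I) : D.psi i 0 = 0 := by rw [psi]; simp

theorem smul_fgen_eq_sum (i : I) (l : ℕ) : (l : K) • D.fgen i l =
    ∑ p ∈ Finset.HasAntidiagonal.antidiagonal l, D.psi i p.1 * D.fgen i p.2 := by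
  rw [Finset.Nat.sum_antidiagonal_eq_sum_range_succ (fun m n => D.psi i m * D.fgen i n),
    Finset.sum_range_succ, Nat.sub_self, fgen_zero, mul_one]
  conv_rhs => rw [add_comm, psi]
  rw [Finset.sum_range (fun k => D.psi i k * D.fgen i (l - k)), sub_add_cancel]

theorem psi_mem_homog (i : I) (l : ℕ) : D.psi i l ∈ D.homog (Finsupp.single i (-(l : ℤ))) := by
  induction l using Nat.strong_induction_on with
  | _ l ih =>
    rw [psi]
    refine sub_mem (Submodule.smul_mem _ _ (fgen_mem_homog i l)) (sum_mem fun k _ => ?_)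
    have := homog_mul_mem (ih k k.2) (fgen_mem_homog i (l - k))
    rw [← Finsupp.single_add] at this
    convert this using 2
    have := k.2
    congr 1
    omega

theorem fgen_mem_lower {x : D.Iinf} {m : ℕ} (hm : m < x.deg) : D.fgen x.idx m ∈ D.lower x := by
  by_cases h : m = 0
  · rw [h, fgen_zero]; exact one_mem _
  · rw [fgen_of_valid (x.valid_of_le h hm.le)]
    exact Algebra.subset_adjoin ⟨Iinf.of (x.valid_of_le h hm.le), rfl, hm, rfl⟩

theorem psi_mem_lower {x : D.Iinf} {m : ℕ} (hm : m < x.deg) : D.psi x.idx m ∈ D.lower x := by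
  induction m using Nat.strong_induction_on with
  | _ l ih =>
    rw [psi]
    refine sub_mem (Subalgebra.smul_mem _ (fgen_mem_lower hm) _) (sum_mem fun k _ => ?_)
    exact mul_mem (ih k k.2 (k.2.trans hm)) (fgen_mem_lower (by omega))

theorem psi_sub_mem_lower (x : D.Iinf) :
    D.psi x.idx x.deg - (x.deg : K) • FreeAlgebra.ι K x ∈ D.lower x := by
  rw [psi, fgen_self, sub_sub_cancel_left]
  refine neg_mem (sum_mem fun k _ => ?_)
  by_cases h : (k : ℕ) = 0
  · rw [h, psi_zero, zero_mul]; exact zero_mem _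
  · exact mul_mem (psi_mem_lower k.2) (fgen_mem_lower (by omega))

theorem qpar_eq_one {i : I} (hi : D.A i i = 0) : D.qpar i = 1 := by simp [qpar, hi]

theorem not_isReal_of_isotropic {i : I} (hi : D.A i i = 0) : ¬ D.IsReal i := by
  rw [IsReal, hi]; norm_num

namespace Torus

variable {T : Type*} [AddCommGroup T] (τ : D.Torus T)

/-- If `a_ii = 0`, then `q_(i) = 1`, and the powers of `q_(i)` disappear from the comultiplication.
-/
theorem comulGen_isotropic {i : I} (hi : D.A i i = 0) (l : ℕ) : τ.comulGen i l =
    ∑ p ∈ Finset.HasAntidiagonal.antidiagonal l,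
      (τ.incl (D.fgen i p.1) * τ.t (τ.kpow i p.2)) ⊗ₜ[K] τ.incl (D.fgen i p.2) := by
  rw [comulGen, qpar_eq_one hi]
  simp

theorem comulHom_fgen_isotropic {i : I} (hi : D.A i i = 0) (l : ℕ) :
    τ.comulHom (τ.incl (D.fgen i l)) = τ.comulGen i l :=
  τ.comulHom_fgen (Iinf.of (D := D) (i := i) (l := l + 1)
    ⟨l.succ_pos, fun h => absurd h (not_isReal_of_isotropic hi)⟩) (Nat.le_succ l)

theorem t_mul_fgen_isotropic {i : I} (hi : D.A i i = 0) (n m : ℕ) :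
    τ.t (τ.kpow i n) * τ.incl (D.fgen i m) = τ.incl (D.fgen i m) * τ.t (τ.kpow i n) := by
  rw [t_mul_fgen, kpow, τ.ev_k, rootForm_single, hi, mul_zero, mul_zero, zpow_zero, one_smul]

/-- The generating function identity `z (d/dz) Δ(f(z)) = (Ψ(z) ⊗ 1 + K(z) ⊗ Ψ(z)) Δ(f(z))`, where
`f(z) = Σ f_il z^l`, `Ψ(z) = Σ Ψ_l z^l` and the factor `K_i^l` belongs to `Ψ_l`. -/
theorem smul_comulGen {i : I} (hi : D.A i i = 0) (l : ℕ) : (l : K) • τ.comulGen i l =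
    ∑ p ∈ Finset.HasAntidiagonal.antidiagonal l,
      (τ.incl (D.psi i p.1) ⊗ₜ[K] 1 + τ.t (τ.kpow i p.1) ⊗ₜ[K] τ.incl (D.psi i p.1)) *
        τ.comulGen i p.2 := by
  let F : D.F → ℕ → D.F → τ.H ⊗[K] τ.H := fun a n b =>
    (τ.incl a * τ.t (τ.kpow i n)) ⊗ₜ[K] τ.incl b
  have h1 : ∑ p ∈ Finset.HasAntidiagonal.antidiagonal l,
      ∑ r ∈ Finset.HasAntidiagonal.antidiagonal p.2,
        F (D.psi i p.1 * D.fgen i r.1) r.2 (D.fgen i r.2) =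
      ∑ p ∈ Finset.HasAntidiagonal.antidiagonal l,
        (p.1 : K) • F (D.fgen i p.1) p.2 (D.fgen i p.2) := by
    rw [← sum_antidiagonal_assoc l fun a b c => F (D.psi i a * D.fgen i b) c (D.fgen i c)]
    refine Finset.sum_congr rfl fun p _ => ?_
    simp only [F, ← TensorProduct.sum_tmul, ← Finset.sum_mul, ← map_sum, ← smul_fgen_eq_sum]
    rw [map_smul, smul_mul_assoc, TensorProduct.smul_tmul']
  have h2 : ∑ p ∈ Finset.HasAntidiagonal.antidiagonal l,
      ∑ r ∈ Finset.HasAntidiagonal.antidiagonal p.2,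
        F (D.fgen i r.1) (p.1 + r.2) (D.psi i p.1 * D.fgen i r.2) =
      ∑ p ∈ Finset.HasAntidiagonal.antidiagonal l,
        (p.2 : K) • F (D.fgen i p.1) p.2 (D.fgen i p.2) := by
    rw [← sum_antidiagonal_assoc l fun a b c => F (D.fgen i b) (a + c) (D.psi i a * D.fgen i c)]
    have : ∀ p : ℕ × ℕ, ∑ r ∈ Finset.HasAntidiagonal.antidiagonal p.1,
        F (D.fgen i r.2) (r.1 + p.2) (D.psi i r.1 * D.fgen i p.2) =
        ∑ r ∈ Finset.HasAntidiagonal.antidiagonal p.1,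
        F (D.fgen i r.1) (r.2 + p.2) (D.psi i r.2 * D.fgen i p.2) := fun p =>
      (Finset.Nat.sum_antidiagonal_swap (n := p.1) (f := fun r =>
        F (D.fgen i r.2) (r.1 + p.2) (D.psi i r.1 * D.fgen i p.2))).symm
    simp only [this]
    rw [sum_antidiagonal_assoc l fun a b c => F (D.fgen i a) (b + c) (D.psi i b * D.fgen i c)]
    refine Finset.sum_congr rfl fun p _ => ?_
    rw [Finset.sum_congr rfl (g := fun r : ℕ × ℕ =>
      F (D.fgen i p.1) p.2 (D.psi i r.1 * D.fgen i r.2)) fun r hr => by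
        rw [Finset.HasAntidiagonal.mem_antidiagonal.1 hr]]
    simp only [F, ← TensorProduct.tmul_sum, ← map_sum, ← smul_fgen_eq_sum]
    rw [map_smul, TensorProduct.tmul_smul]
  have h3 : ∀ p : ℕ × ℕ,
      (τ.incl (D.psi i p.1) ⊗ₜ[K] 1 + τ.t (τ.kpow i p.1) ⊗ₜ[K] τ.incl (D.psi i p.1)) *
        τ.comulGen i p.2 =
      ∑ r ∈ Finset.HasAntidiagonal.antidiagonal p.2,
        F (D.psi i p.1 * D.fgen i r.1) r.2 (D.fgen i r.2) +
      ∑ r ∈ Finset.HasAntidiagonal.antidiagonal p.2,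
        F (D.fgen i r.1) (p.1 + r.2) (D.psi i p.1 * D.fgen i r.2) := by
    intro p
    rw [comulGen_isotropic τ hi, Finset.mul_sum, ← Finset.sum_add_distrib]
    refine Finset.sum_congr rfl fun r _ => ?_
    rw [add_mul, Algebra.TensorProduct.tmul_mul_tmul, Algebra.TensorProduct.tmul_mul_tmul,
      ← mul_assoc, ← mul_assoc, one_mul, t_mul_fgen_isotropic τ hi, mul_assoc (τ.incl (D.fgen i r.1)),
      ← t_add, ← kpow_add, ← map_mul, ← map_mul]
  simp only [h3]
  rw [Finset.sum_add_distrib, h1, h2, ← Finset.sum_add_distrib, comulGen_isotropic τ hi,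
    Finset.smul_sum]
  refine Finset.sum_congr rfl fun p hp => ?_
  rw [← add_smul, ← Nat.cast_add, Finset.HasAntidiagonal.mem_antidiagonal.1 hp]

/-- Compare the comultiplications of both sides of `l f_il = Σ Ψ_k f_{i,l-k}`. -/
theorem isPrim_psi {i : I} (hi : D.A i i = 0) (l : ℕ) :
    τ.IsPrim (Finsupp.single i (l : ℤ)) (D.psi i l) := by
  induction l using Nat.strong_induction_on with
  | _ l ih =>
    have h1 := congrArg (fun z => τ.comulHom (τ.incl z)) (smul_fgen_eq_sum (D := D) i l)
    simp only [map_smul, map_sum, map_mul, comulHom_fgen_isotropic τ hi] at h1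
    rw [smul_comulGen τ hi,
      Finset.Nat.sum_antidiagonal_eq_sum_range_succ (fun m n => (τ.incl (D.psi i m) ⊗ₜ[K] 1 +
        τ.t (τ.kpow i m) ⊗ₜ[K] τ.incl (D.psi i m)) * τ.comulGen i n),
      Finset.Nat.sum_antidiagonal_eq_sum_range_succ (fun m n =>
        τ.comulHom (τ.incl (D.psi i m)) * τ.comulGen i n), Finset.sum_range_succ,
      Finset.sum_range_succ, Nat.sub_self, Finset.sum_congr rfl (g := fun k =>
        τ.comulHom (τ.incl (D.psi i k)) * τ.comulGen i (l - k)) fun k hk => by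
          rw [ih k (Finset.mem_range.1 hk)]; rfl, add_right_inj,
      ← comulHom_fgen_isotropic τ hi, fgen_zero, map_one, map_one, mul_one, mul_one] at h1
    exact h1.symm

end Torus

theorem isCanonical_isotropic {x : D.Iinf} (hx : D.A x.idx x.idx = 0) :
    IsCanonical x ((x.deg : K)⁻¹ • D.psi x.idx x.deg) := by
  have hd : (x.deg : K) ≠ 0 := Nat.cast_ne_zero.2 x.deg_pos.ne'
  have e : -(D.wt [x]) = Finsupp.single x.idx (x.deg : ℤ) := by
    rw [wt_singleton, ← Finsupp.single_neg, neg_neg]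
  refine ⟨?_, ?_, ?_, ?_, fun h => absurd h (not_isReal_of_isotropic hx)⟩
  · rw [wt_singleton]
    exact Submodule.smul_mem _ _ (psi_mem_homog _ _)
  · have := Subalgebra.smul_mem _ (psi_sub_mem_lower x) (x.deg : K)⁻¹
    rwa [smul_sub, smul_smul, inv_mul_cancel₀ hd, one_smul] at this
  · rw [e]; exact (D.coTorus.isPrim_psi hx _).smul _
  · rw [e]; exact (D.rootTorus.isPrim_psi hx _).smul _

/-- `(x y, f_il)_L = Σ_{m+n=l} (x, f_im)_L (y, f_in)_L` if `a_ii = 0`. -/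
theorem form_mul_fgen {i : I} (hi : D.A i i = 0) (z z' : D.F) {x : D.Iinf} (hx : x.idx = i) :
    D.form ν (z * z') (D.fgen i x.deg) =
      ∑ p ∈ Finset.HasAntidiagonal.antidiagonal x.deg,
        D.form ν z (D.fgen i p.1) * D.form ν z' (D.fgen i p.2) := by
  subst hx
  rw [form_mul_left, fgen_self, rho_ι, rhoGen, map_sum, map_sum, qpar_eq_one hi]
  simp

/-- If `a_ii = 0`, then `(Ψ_l, f_il)_L = l ν_il - Σ_{0<k<l} (Ψ_k, f_ik)_L ν_{i,l-k}`, which is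
`l - (l - 1) = 1` at `q = 0` by induction. -/
theorem hasValue_form_psi (hν : ∀ x, HasValue (ν x) 1) {i : I} (hi : D.A i i = 0) (l : ℕ)
    (hl : 0 < l) : HasValue (D.form ν (D.psi i l) (D.fgen i l)) 1 := by
  induction l using Nat.strong_induction_on with
  | _ l ih =>
    have hval : ∀ l : ℕ, 0 < l → 0 < l ∧ (D.IsReal i → l = 1) := fun l hl =>
      ⟨hl, fun h => absurd h (not_isReal_of_isotropic hi)⟩
    have hff : ∀ l : ℕ, 0 < l → HasValue (D.form ν (D.fgen i l) (D.fgen i l)) 1 := by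
      classical
      intro l hl
      rw [fgen_of_valid (hval l hl), form_ι_ι, if_pos rfl]
      exact hν _
    -- only the splitting of `f_il` into degrees `k` and `l - k` contributes
    have hterm : ∀ k : Fin l, HasValue (D.form ν (D.psi i k * D.fgen i (l - k)) (D.fgen i l))
        (if (k : ℕ) = 0 then 0 else 1) := by
      intro k
      have e := form_mul_fgen ν hi (D.psi i k) (D.fgen i (l - k)) (x := Iinf.of (hval l hl)) rfl
      rw [Iinf.deg_of] at e
      rw [e, Finset.sum_eq_single ((k : ℕ), l - k)]
      · split_ifs with h0
        · rw [h0, psi_zero, map_zero, LinearMap.zero_apply, zero_mul]; exact .zero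
        · have := (ih k k.2 (Nat.pos_of_ne_zero h0)).mul (hff (l - k) (by omega))
          rwa [one_mul] at this
      · intro p hp hne
        have hp' := Finset.HasAntidiagonal.mem_antidiagonal.1 hp
        have hk : (k : ℕ) ≠ p.1 := fun h => hne (Prod.ext h.symm (by dsimp only; omega))
        rw [form_homog_eq_zero ν _ (psi_mem_homog i k) (fgen_mem_homog i p.1), zero_mul]
        intro h
        have := Finsupp.single_injective _ h
        omega
      · intro h
        exact absurd (Finset.HasAntidiagonal.mem_antidiagonal.2 (by dsimp only; omega)) h
    rw [psi, map_sub, LinearMap.sub_apply, map_sum, LinearMap.sum_apply, map_smul,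
      LinearMap.smul_apply, smul_eq_mul, sub_eq_add_neg]
    have h1 := ((HasValue.natCast l).mul (hff l hl)).add
      (HasValue.sum (s := Finset.univ) fun k _ => hterm k).neg
    convert h1 using 1
    rw [← Finset.sum_range (fun k => if k = 0 then (0 : ℚ) else 1)]
    obtain ⟨n, rfl⟩ := Nat.exists_eq_succ_of_ne_zero hl.ne'
    rw [Finset.sum_range_succ']
    simp

/-- If `a_ii = 0`, then `τ_il = (b_il, f_il)_L = l⁻¹ (Ψ_l, f_il)_L` does not vanish. -/
theorem form_canonical_ne_zero (hν : ∀ x, HasValue (ν x) 1) {x : D.Iinf}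
    (hx : D.A x.idx x.idx = 0) : D.form ν ((x.deg : K)⁻¹ • D.psi x.idx x.deg)
      ((x.deg : K)⁻¹ • D.psi x.idx x.deg) ≠ 0 := by
  have hd : (x.deg : K) ≠ 0 := Nat.cast_ne_zero.2 x.deg_pos.ne'
  have hc := isCanonical_isotropic (D := D) hx
  have h1 := hc.orthogonal ν hc.leading
  rw [map_sub, sub_eq_zero] at h1
  rw [h1, map_smul, LinearMap.smul_apply, ← fgen_self]
  exact smul_ne_zero (inv_ne_zero hd) (hasValue_form_psi ν hν hx _ x.deg_pos).ne_zero

/-- Primitive generators with the additional property used to treat the case `a_ii = 0`. -/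
theorem exists_canonical (hν : ∀ x, HasValue (ν x) 1) : ∃ p : D.Iinf → D.F,
    (∀ x, IsCanonical x (p x)) ∧ ∀ x, D.A x.idx x.idx = 0 → D.form ν (p x) (p x) ≠ 0 := by
  have : ∀ x : D.Iinf, ∃ z, IsCanonical x z ∧ (D.A x.idx x.idx = 0 → D.form ν z z ≠ 0) := by
    intro x
    rcases D.diag x.idx with h | ⟨h, -⟩
    · exact ⟨_, isCanonical_real h, fun h' => absurd h (not_isReal_of_isotropic h')⟩
    · rcases h.lt_or_eq with h | h
      · obtain ⟨z, hz⟩ := exists_isCanonical_hyperbolic ν hν h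
        exact ⟨z, hz, fun h' => absurd h' h.ne⟩
      · exact ⟨_, isCanonical_isotropic h, fun _ => form_canonical_ne_zero ν hν h⟩
  choose p h1 h2 using this
  exact ⟨p, h1, h2⟩

theorem isPrimitive_of_canonical {p : D.Iinf → D.F} (hp : ∀ x, IsCanonical x (p x)) :
    D.IsPrimitive ν p where
  real x hx := (hp x).real hx
  weight x _ := wt_singleton x ▸ (hp x).weight
  leading x _ := (hp x).leading
  orthogonal x _ _ hz := (hp x).orthogonal ν hz

end Isotropic

/-! ### Triangular changes of generators -/

section Triangular

variable {I : Type*} {P : Type*} [AddCommGroup P] {D : Datum I P}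

/-- A family in `F` that differs from the family of generators by homogeneous elements in
generators of smaller degree. -/
structure Triangular (p : D.Iinf → D.F) : Prop where
  weight : ∀ x, p x ∈ D.homog (D.wt [x])
  leading : ∀ x, p x - FreeAlgebra.ι K x ∈ D.lower x
  real : ∀ x, D.IsReal x.idx → p x = FreeAlgebra.ι K x

theorem lower_mono {x y : D.Iinf} (h : y.idx = x.idx) (h' : y.deg < x.deg) :
    D.lower y ≤ D.lower x := by
  refine Algebra.adjoin_mono ?_
  rintro _ ⟨z, h1, h2, rfl⟩
  exact ⟨z, h1.trans h, h2.trans h', rfl⟩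

theorem ι_mem_homog (x : D.Iinf) : FreeAlgebra.ι K x ∈ D.homog (D.wt [x]) :=
  mon_singleton x ▸ mon_mem_homog rfl

theorem lift_mem_homog {h : D.Iinf → D.F} (hh : ∀ x, h x ∈ D.homog (D.wt [x])) {β : I →₀ ℤ}
    {z : D.F} (hz : z ∈ D.homog β) : FreeAlgebra.lift K h z ∈ D.homog β := by
  refine homog_induction (p := fun z => FreeAlgebra.lift K h z ∈ D.homog β) (by simp)
    (fun a b ha hb => ?_) (fun c a ha => ?_) (fun w hw => ?_) hz
  · rw [map_add]; exact add_mem ha hb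
  · rw [map_smul]; exact Submodule.smul_mem _ _ ha
  subst hw
  clear hz
  induction w with
  | nil => rw [mon_nil, map_one, ← mon_nil]; exact mon_mem_homog rfl
  | cons x w ih =>
    rw [mon_cons, map_mul, FreeAlgebra.lift_ι_apply,
      show x :: w = [x] ++ w from rfl, wt_append]
    exact homog_mul_mem (hh x) ih

/-- A triangular change of generators has a triangular right inverse. -/
theorem Triangular.exists_rightInverse {p : D.Iinf → D.F} (hp : Triangular p) :
    ∃ g : D.Iinf → D.F, Triangular g ∧ ∀ x, FreeAlgebra.lift K p (g x) = FreeAlgebra.ι K x := by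
  suffices h : ∀ (n : ℕ) (x : D.Iinf), x.deg = n → ∃ z, z ∈ D.homog (D.wt [x]) ∧
      z - FreeAlgebra.ι K x ∈ D.lower x ∧ (D.IsReal x.idx → z = FreeAlgebra.ι K x) ∧
      FreeAlgebra.lift K p z = FreeAlgebra.ι K x by
    choose g h1 h2 h3 h4 using fun x => h _ x rfl
    exact ⟨g, ⟨h1, h2, h3⟩, h4⟩
  intro n
  induction n using Nat.strong_induction_on with
  | _ n ih =>
    intro x hx
    have : ∀ y : D.Iinf, ∃ z, z ∈ D.homog (D.wt [y]) ∧ (y.deg < x.deg →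
        z - FreeAlgebra.ι K y ∈ D.lower y ∧ FreeAlgebra.lift K p z = FreeAlgebra.ι K y) := by
      intro y
      by_cases hy : y.deg < n
      · obtain ⟨z, h1, h2, -, h4⟩ := ih _ hy y rfl
        exact ⟨z, h1, fun _ => ⟨h2, h4⟩⟩
      · exact ⟨0, zero_mem _, fun h => absurd (hx ▸ h) hy⟩
    choose h h1 h2 using this
    have hinv : ∀ u ∈ D.lower x, FreeAlgebra.lift K p (FreeAlgebra.lift K h u) = u := by
      intro u hu
      induction hu using Algebra.adjoin_induction with
      | mem z hz =>
        obtain ⟨y, -, hy, rfl⟩ := hz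
        rw [FreeAlgebra.lift_ι_apply, (h2 y hy).2]
      | algebraMap c => rw [AlgHom.commutes, AlgHom.commutes]
      | add a b _ _ ha hb => rw [map_add, map_add, ha, hb]
      | mul a b _ _ ha hb => rw [map_mul, map_mul, ha, hb]
    have hlow : ∀ u ∈ D.lower x, FreeAlgebra.lift K h u ∈ D.lower x := by
      intro u hu
      induction hu using Algebra.adjoin_induction with
      | mem z hz =>
        obtain ⟨y, hi, hy, rfl⟩ := hz
        rw [FreeAlgebra.lift_ι_apply, ← sub_add_cancel (h y) (FreeAlgebra.ι K y)]
        exact add_mem (lower_mono hi hy (h2 y hy).1) (Algebra.subset_adjoin ⟨y, hi, hy, rfl⟩)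
      | algebraMap c => rw [AlgHom.commutes]; exact Subalgebra.algebraMap_mem _ _
      | add a b _ _ ha hb => rw [map_add]; exact add_mem ha hb
      | mul a b _ _ ha hb => rw [map_mul]; exact mul_mem ha hb
    -- solve `p x = f_x + r` for `f_x`, rewriting the lower term `r` by the induction hypothesis
    refine ⟨FreeAlgebra.ι K x - FreeAlgebra.lift K h (p x - FreeAlgebra.ι K x), ?_, ?_, ?_, ?_⟩
    · exact sub_mem (ι_mem_homog x) (lift_mem_homog h1 (sub_mem (hp.weight x) (ι_mem_homog x)))
    · rw [sub_sub_cancel_left]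
      exact neg_mem (hlow _ (hp.leading x))
    · intro hr
      rw [hp.real x hr, sub_self, map_zero, sub_zero]
    · rw [map_sub, hinv _ (hp.leading x), FreeAlgebra.lift_ι_apply, sub_sub_cancel]

/-- A triangular change of generators is invertible. -/
theorem Triangular.exists_inverse {p : D.Iinf → D.F} (hp : Triangular p) :
    ∃ g : D.Iinf → D.F, Triangular g ∧ (∀ x, FreeAlgebra.lift K p (g x) = FreeAlgebra.ι K x) ∧
      ∀ x, FreeAlgebra.lift K g (p x) = FreeAlgebra.ι K x := by
  obtain ⟨g, hg, h1⟩ := hp.exists_rightInverse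
  obtain ⟨g', -, h2⟩ := hg.exists_rightInverse
  refine ⟨g, hg, h1, fun x => ?_⟩
  have e1 : (FreeAlgebra.lift K p).comp (FreeAlgebra.lift K g) = AlgHom.id K D.F :=
    FreeAlgebra.hom_ext (funext fun y => by simp [h1])
  -- a right inverse of the right inverse `g` is the original family `p`
  have e2 : p x = g' x := by
    have := DFunLike.congr_fun e1 (g' x)
    rw [AlgHom.comp_apply, h2, FreeAlgebra.lift_ι_apply] at this
    exact this
  rw [e2, h2]

variable (D) in
/-- The subalgebra `ℚ(q)⟨f_il | l ≥ 1⟩` of `F`. -/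
def idxAlg (i : I) : Subalgebra K D.F :=
  Algebra.adjoin K {z | ∃ y : D.Iinf, y.idx = i ∧ z = FreeAlgebra.ι K y}

theorem lower_le_idxAlg (x : D.Iinf) : D.lower x ≤ D.idxAlg x.idx := by
  refine Algebra.adjoin_mono ?_
  rintro _ ⟨z, h1, -, rfl⟩
  exact ⟨z, h1, rfl⟩

theorem Triangular.mem_idxAlg {p : D.Iinf → D.F} (hp : Triangular p) (x : D.Iinf) :
    p x ∈ D.idxAlg x.idx := by
  rw [← sub_add_cancel (p x) (FreeAlgebra.ι K x)]
  exact add_mem (lower_le_idxAlg x (hp.leading x)) (Algebra.subset_adjoin ⟨x, rfl, rfl⟩)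

/-- The new generators with index `i` generate the same subalgebra as the `f_il`. -/
theorem Triangular.idxAlg_le {p : D.Iinf → D.F} (hp : Triangular p) (i : I) :
    D.idxAlg i ≤ Algebra.adjoin K {z | ∃ y : D.Iinf, y.idx = i ∧ z = p y} := by
  obtain ⟨g, hg, h1, -⟩ := hp.exists_inverse
  refine Algebra.adjoin_le ?_
  rintro _ ⟨x, rfl, rfl⟩
  rw [← h1 x]
  have : FreeAlgebra.lift K p (g x) ∈ (D.idxAlg x.idx).map (FreeAlgebra.lift K p) :=
    ⟨_, hg.mem_idxAlg x, rfl⟩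
  rw [idxAlg, AlgHom.map_adjoin] at this
  refine Algebra.adjoin_mono ?_ this
  rintro _ ⟨_, ⟨y, hy, rfl⟩, rfl⟩
  exact ⟨y, hy, FreeAlgebra.lift_ι_apply _ _⟩

theorem Triangular.adjoin_eq_top {p : D.Iinf → D.F} (hp : Triangular p) :
    Algebra.adjoin K (Set.range p) = ⊤ := by
  rw [eq_top_iff, ← FreeAlgebra.adjoin_range_ι, Algebra.adjoin_le_iff]
  rintro _ ⟨x, rfl⟩
  have := hp.idxAlg_le x.idx (Algebra.subset_adjoin ⟨x, rfl, rfl⟩)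
  refine Algebra.adjoin_mono ?_ this
  rintro _ ⟨y, -, rfl⟩
  exact ⟨y, rfl⟩

variable {ν : D.Iinf → K}

theorem IsPrimitive.triangular {b : D.Iinf → D.F} (hb : D.IsPrimitive ν b) : Triangular b where
  weight x := by
    by_cases h : D.IsReal x.idx
    · rw [hb.real x h]; exact ι_mem_homog x
    · rw [wt_singleton]; exact hb.weight x h
  leading x := by
    by_cases h : D.IsReal x.idx
    · rw [hb.real x h, sub_self]; exact zero_mem _
    · exact hb.leading x h
  real := hb.real

theorem triangular_of_canonical {p : D.Iinf → D.F} (hp : ∀ x, IsCanonical x (p x)) :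
    Triangular p :=
  ⟨fun x => (hp x).weight, fun x => (hp x).leading, fun x => (hp x).real⟩

end Triangular

/-! ### Uniqueness of the primitive generators -/

section Unique

variable {I : Type*} {P : Type*} [AddCommGroup P] {D : Datum I P} {ν : D.Iinf → K}

theorem wt_singleton_injective {x y : D.Iinf} (h : D.wt [x] = D.wt [y]) : x = y := by
  rw [wt_singleton, wt_singleton] at h
  have hx := x.deg_pos
  rcases Finsupp.single_eq_single_iff _ _ _ _ |>.1 h with h | h
  · exact Iinf.ext h.1 (by omega)
  · omega

theorem form_prim_eq_zero {b : D.Iinf → D.F} (hb : Triangular b) {x y : D.Iinf} (h : x ≠ y) :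
    D.form ν (b x) (b y) = 0 :=
  form_homog_eq_zero ν (fun e => h (wt_singleton_injective e)) (hb.weight x) (hb.weight y)

/-- Two choices of a primitive generator differ by an element of the radical of the form. -/
theorem form_sub_eq_zero {b p : D.Iinf → D.F} (hb : D.IsPrimitive ν b)
    (hp : ∀ x, IsCanonical x (p x)) (x : D.Iinf) (y : D.F) : D.form ν (b x - p x) y = 0 := by
  by_cases hr : D.IsReal x.idx
  · rw [hb.real x hr, (hp x).real hr, sub_self, map_zero, LinearMap.zero_apply]
  have hlow : ∀ u ∈ D.lower x, D.form ν (b x - p x) u = 0 := fun u hu => by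
    rw [map_sub, LinearMap.sub_apply, hb.orthogonal x hr u hu, (hp x).orthogonal ν hu, sub_zero]
  have hz : b x - p x ∈ D.lower x := by
    have := sub_mem (hb.leading x hr) (hp x).leading
    rwa [sub_sub_sub_cancel_right] at this
  refine mon_induction (p := fun y => D.form ν (b x - p x) y = 0) (map_zero _)
    (fun a b ha hb => by rw [map_add, ha, hb, add_zero])
    (fun c a ha => by rw [map_smul, ha, smul_zero]) (fun w => ?_) y
  by_cases hw : D.wt w = D.wt [x]
  · by_cases hwx : w = [x]
    · rw [hwx, mon_singleton, ← sub_sub_cancel (p x) (FreeAlgebra.ι K x), map_sub,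
        hlow _ (hp x).leading, form_comm, (hp x).orthogonal ν hz, sub_zero]
    · exact hlow _ (mon_mem_lower (lower_of_wt_eq hw hwx))
  · exact form_homog_eq_zero ν (Ne.symm hw) (sub_mem (hb.triangular.weight x) (hp x).weight)
      (mon_mem_homog rfl)

/-- The norm `τ_il` does not depend on the choice of the primitive generator. -/
theorem form_self_eq {b p : D.Iinf → D.F} (hb : D.IsPrimitive ν b)
    (hp : ∀ x, IsCanonical x (p x)) (x : D.Iinf) :
    D.form ν (b x) (b x) = D.form ν (p x) (p x) := by
  have h1 := form_sub_eq_zero hb hp x (b x)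
  have h2 := form_sub_eq_zero hb hp x (p x)
  rw [map_sub, LinearMap.sub_apply, sub_eq_zero] at h1 h2
  rw [h1, ← h2, form_comm]

/-- If `a_ii < 0`, the form is nondegenerate on words in the `f_il`. -/
theorem eq_zero_of_radical (hν : ∀ x, HasValue (ν x) 1) {x : D.Iinf} (hx : D.A x.idx x.idx < 0)
    {z : D.F} (hz : z ∈ D.homog (D.wt [x])) (h : ∀ y, D.form ν z y = 0) : z = 0 := by
  -- nondegeneracy of the form on `F ⊗ F`, applied to `z ⊗ 1`
  have e : z ⊗ₜ[K] (1 : D.F) = 0 := by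
    refine tensor_eq_zero ν hν hx (c := -(x.deg : ℤ)) ?_ fun u v _ => ?_
    · rw [← wt_singleton]
      refine homog_induction
        (p := fun z => z ⊗ₜ[K] 1 ∈ homogTensor (D := D) (D.wt [x])) (by simp)
        (fun a b ha hb => ?_) (fun c a ha => ?_) (fun w hw => ?_) hz
      · rw [TensorProduct.add_tmul]; exact add_mem ha hb
      · rw [← TensorProduct.smul_tmul']; exact Submodule.smul_mem _ _ ha
      · exact Submodule.subset_span ⟨w, [], by rw [hw, wt_nil, add_zero], rfl⟩
    · rw [TensorProduct.map_tmul, LinearMap.mul'_apply, LinearMap.flip_apply, h, zero_mul]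
  have := congrArg (fun s => TensorProduct.rid K D.F
    (TensorProduct.map LinearMap.id (FreeAlgebra.algebraMapInv (R := K)).toLinearMap s)) e
  simpa using this

section Isotropic

variable (ν) in
/-- The skew derivation defined by `z` is adjoint to the left multiplication by `z`. -/
theorem pair_leftSlice {T : Type*} [AddCommGroup T] (τ : D.Torus T) (z w : D.F)
    (a : τ.H) : τ.pair ν (D.rootTorus.incl w) (τ.derivL ν z a) =
      τ.pair ν (D.rootTorus.incl (z * w)) a := by
  rw [map_mul, map_mul, LinearMap.convMul_apply, Torus.comul_eq, Torus.derivL]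
  generalize τ.comulHom a = s
  induction s using TensorProduct.induction_on with
  | zero => simp
  | add s s' hs hs' => rw [map_add, map_add, hs, hs', map_add, map_add]
  | tmul c d =>
    rw [Torus.leftSlice_tmul, map_smul, TensorProduct.map_tmul, LinearMap.mul'_apply, smul_eq_mul]
    rfl

variable {p : D.Iinf → D.F}

/-- If `a_ii = 0`, the twist in the skew derivation is trivial. -/
theorem lam_incl_isotropic (hp : ∀ x, IsCanonical x (p x)) {i : I} (hi : D.A i i = 0)
    {x y : D.Iinf} (hx : x.idx = i) (hy : y.idx = i) :
    D.rootTorus.lam (-(D.wt [x])) (D.rootTorus.incl (p y)) = D.rootTorus.incl (p y) := by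
  refine homog_induction (p := fun z => D.rootTorus.lam (-(D.wt [x])) (D.rootTorus.incl z) =
    D.rootTorus.incl z) (by simp) (fun a b ha hb => ?_) (fun c a ha => ?_) (fun w hw => ?_)
    (hp y).weight
  · rw [map_add, map_add, ha, hb]
  · rw [map_smul, map_smul, ha]
  · rw [Torus.lam_incl_mon, hw, wt_singleton, wt_singleton, hx, hy, rootForm_neg_left,
      rootForm_single, hi, mul_zero, mul_zero, neg_zero, zpow_zero, one_smul]

open Classical in
/-- On the subalgebra generated by the `b_il` for fixed `i` with `a_ii = 0`, the skew derivation
defined by `b_x` becomes a multiple of the partial derivative with respect to `b_x`, after passing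
to the polynomial ring. -/
theorem derivL_isotropic (hp : ∀ x, IsCanonical x (p x)) {i : I} (hi : D.A i i = 0)
    {π : D.F →ₐ[K] MvPolynomial {y : D.Iinf // y.idx = i} K}
    (hπ : ∀ y : {y : D.Iinf // y.idx = i}, π (p y) = MvPolynomial.X y)
    (x : {y : D.Iinf // y.idx = i}) {u : D.F}
    (hu : u ∈ Algebra.adjoin K {z | ∃ y : D.Iinf, y.idx = i ∧ z = p y}) :
    D.rootTorus.lam (-(D.wt [x.1])) (D.rootTorus.incl u) = D.rootTorus.incl u ∧
    ∃ u' ∈ Algebra.adjoin K {z | ∃ y : D.Iinf, y.idx = i ∧ z = p y},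
      D.rootTorus.derivL ν (p x) (D.rootTorus.incl u) = D.rootTorus.incl u' ∧
      π u' = D.form ν (p x) (p x) • MvPolynomial.pderiv x (π u) := by
  have h0 := Torus.wt_singleton_ne_zero x.1
  induction hu using Algebra.adjoin_induction with
  | mem z hz =>
    obtain ⟨y, hy, rfl⟩ := hz
    refine ⟨lam_incl_isotropic hp hi x.2 hy, D.form ν (p y) (p x) • 1,
      Subalgebra.smul_mem _ (one_mem _) _, ?_, ?_⟩
    · rw [D.rootTorus.derivL_prim ν h0 (hp x).weight (hp y).prim₂, map_smul, map_one]
    · rw [map_smul, map_one, hπ ⟨y, hy⟩]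
      by_cases h : y = x
      · have : (⟨y, hy⟩ : {y : D.Iinf // y.idx = i}) = x := Subtype.ext h
        rw [this, MvPolynomial.pderiv_X_self, h]
      · rw [form_prim_eq_zero (triangular_of_canonical hp) h, zero_smul,
          MvPolynomial.pderiv_X_of_ne (fun e => h (congrArg Subtype.val e)), smul_zero]
  | algebraMap c =>
    refine ⟨by rw [AlgHom.commutes, AlgHom.commutes], 0, zero_mem _, ?_, ?_⟩
    · rw [AlgHom.commutes, D.rootTorus.derivL_algebraMap ν h0 (hp x).weight, map_zero]
    · rw [AlgHom.commutes, MvPolynomial.algebraMap_eq, MvPolynomial.pderiv_C, smul_zero, map_zero]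
  | add a b _ _ ha hb =>
    obtain ⟨ha0, a', ha1, ha2, ha3⟩ := ha
    obtain ⟨hb0, b', hb1, hb2, hb3⟩ := hb
    refine ⟨by rw [map_add, map_add, ha0, hb0], a' + b', add_mem ha1 hb1, ?_, ?_⟩
    · rw [map_add, Torus.derivL_add, ha2, hb2, map_add]
    · rw [map_add, ha3, hb3, map_add, map_add, smul_add]
  | mul a b ha' hb' ha hb =>
    obtain ⟨ha0, a', ha1, ha2, ha3⟩ := ha
    obtain ⟨hb0, b', hb1, hb2, hb3⟩ := hb
    refine ⟨by rw [map_mul, map_mul, ha0, hb0], a' * b + a * b',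
      add_mem (mul_mem ha1 hb') (mul_mem ha' hb1), ?_, ?_⟩
    · rw [map_mul, D.rootTorus.derivL_mul ν (hp x).prim₂, ha2, hb2, ha0, map_add, map_mul, map_mul]
    · rw [map_add, map_mul, map_mul, map_mul, ha3, hb3, MvPolynomial.pderiv_mul, smul_add,
        smul_mul_assoc, mul_smul_comm]

/-- The functional `(·, 1)_L` is the constant term in the primitive generators. -/
theorem form_one_eq_constantCoeff (hp : ∀ x, IsCanonical x (p x)) {i : I}
    {π : D.F →ₐ[K] MvPolynomial {y : D.Iinf // y.idx = i} K}
    (hπ : ∀ y : {y : D.Iinf // y.idx = i}, π (p y) = MvPolynomial.X y) {u : D.F}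
    (hu : u ∈ Algebra.adjoin K {z | ∃ y : D.Iinf, y.idx = i ∧ z = p y}) :
    D.form ν u 1 = MvPolynomial.constantCoeff (π u) := by
  have h1 : ∀ u : D.F, D.form ν u 1 = D.rootTorus.counitHom (D.rootTorus.incl u) := by
    intro u
    rw [← D.rootTorus.pair_incl', map_one, map_one]
    rfl
  rw [h1]
  induction hu using Algebra.adjoin_induction with
  | mem z hz =>
    obtain ⟨y, hy, rfl⟩ := hz
    rw [← h1, hπ ⟨y, hy⟩, MvPolynomial.constantCoeff_X]
    exact form_homog_eq_zero ν (Torus.wt_singleton_ne_zero y) (hp y).weight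
      (mon_nil ▸ mon_mem_homog rfl)
  | algebraMap c =>
    rw [AlgHom.commutes, AlgHom.commutes, AlgHom.commutes, MvPolynomial.algebraMap_eq,
      MvPolynomial.constantCoeff_C]; rfl
  | add a b _ _ ha hb => simp only [map_add, ha, hb]
  | mul a b _ _ ha hb => simp only [map_mul, ha, hb]

/-- If `a_ii = 0`, an element of the radical in the `f_il` has image zero in the polynomial ring in
the primitive generators: the radical is stable under the skew derivations, which become multiples
of the partial derivatives, so all derivatives have constant term zero. -/
theorem coeff_eq_zero_of_radical (hp : ∀ x, IsCanonical x (p x)) {i : I} (hi : D.A i i = 0)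
    (hτ : ∀ x : D.Iinf, x.idx = i → D.form ν (p x) (p x) ≠ 0)
    {π : D.F →ₐ[K] MvPolynomial {y : D.Iinf // y.idx = i} K}
    (hπ : ∀ y : {y : D.Iinf // y.idx = i}, π (p y) = MvPolynomial.X y)
    (s : {y : D.Iinf // y.idx = i} →₀ ℕ) (u : D.F)
    (hu : u ∈ Algebra.adjoin K {z | ∃ y : D.Iinf, y.idx = i ∧ z = p y})
    (h : ∀ w, D.form ν u w = 0) : MvPolynomial.coeff s (π u) = 0 := by
  classical
  induction hn : s.degree generalizing s u with
  | zero =>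
    rw [(Finsupp.degree_eq_zero_iff s).1 hn]
    exact (form_one_eq_constantCoeff hp hπ hu).symm.trans (h 1)
  | succ n ih =>
    have hs : s ≠ 0 := by
      rintro rfl
      simp at hn
    obtain ⟨x, hx⟩ := Finsupp.ne_iff.1 hs
    rw [Finsupp.zero_apply] at hx
    have es : s = (s - Finsupp.single x 1) + Finsupp.single x 1 :=
      (tsub_add_cancel_of_le (Finsupp.single_le_iff.2 (Nat.one_le_iff_ne_zero.2 hx))).symm
    obtain ⟨-, u', hu', h1, h2⟩ := derivL_isotropic (ν := ν) hp hi hπ x hu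
    have h3 : ∀ w, D.form ν u' w = 0 := by
      intro w
      rw [← D.rootTorus.pair_incl', ← h1, pair_leftSlice, Torus.pair_incl', h]
    have h4 := ih (s - Finsupp.single x 1) u' hu' h3 (by
      have := congrArg Finsupp.degree es
      rw [map_add, Finsupp.degree_single] at this
      omega)
    rw [h2, MvPolynomial.coeff_smul, MvPolynomial.coeff_pderiv, ← es] at h4
    have h5 := (smul_eq_zero.1 h4).resolve_left (hτ x x.2)
    exact (mul_eq_zero.1 h5).resolve_right (Nat.cast_add_one_ne_zero _)

/-- If `a_ii = 0`, then the elements of the radical in the `f_il` become zero as soon as the `f_il`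
commute. -/
theorem map_eq_zero_of_radical (hp : ∀ x, IsCanonical x (p x)) {i : I} (hi : D.A i i = 0)
    (hτ : ∀ x : D.Iinf, x.idx = i → D.form ν (p x) (p x) ≠ 0) {R : Type*} [Ring R] [Algebra K R]
    (n : D.F →ₐ[K] R) (hn : ∀ x y : D.Iinf, x.idx = i → y.idx = i →
      n (FreeAlgebra.ι K x) * n (FreeAlgebra.ι K y) = n (FreeAlgebra.ι K y) * n (FreeAlgebra.ι K x))
    {u : D.F} (hu : u ∈ D.idxAlg i) (h : ∀ w, D.form ν u w = 0) : n u = 0 := by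
  classical
  have ht := triangular_of_canonical hp
  obtain ⟨g, -, -, hg⟩ := ht.exists_inverse
  -- the abelianization of the algebra of the `f_il`, in the coordinates `b_il`
  let π : D.F →ₐ[K] MvPolynomial {y : D.Iinf // y.idx = i} K :=
    (FreeAlgebra.lift K fun y => if hy : y.idx = i then MvPolynomial.X ⟨y, hy⟩ else 0).comp
      (FreeAlgebra.lift K g)
  have hπ : ∀ y : {y : D.Iinf // y.idx = i}, π (p y) = MvPolynomial.X y := by
    intro y
    rw [AlgHom.comp_apply, hg, FreeAlgebra.lift_ι_apply, dif_pos y.2]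
  have hu' := ht.idxAlg_le i hu
  have hπu : π u = 0 := MvPolynomial.ext _ _ fun s => by
    rw [coeff_eq_zero_of_radical hp hi hτ hπ s u hu' h, MvPolynomial.coeff_zero]
  -- on the algebra of the `f_il` the map `n` factors through `π`
  have hS : ∀ a ∈ n '' {z | ∃ y : D.Iinf, y.idx = i ∧ z = FreeAlgebra.ι K y},
      ∀ b ∈ n '' {z | ∃ y : D.Iinf, y.idx = i ∧ z = FreeAlgebra.ι K y}, a * b = b * a := by
    rintro _ ⟨_, ⟨x, hx, rfl⟩, rfl⟩ _ ⟨_, ⟨y, hy, rfl⟩, rfl⟩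
    exact hn x y hx hy
  have hcomm := Algebra.isMulCommutative_adjoin K hS
  let : CommRing (Algebra.adjoin K (n '' {z | ∃ y : D.Iinf, y.idx = i ∧ z = FreeAlgebra.ι K y})) :=
    { (Algebra.adjoin K (n '' {z | ∃ y : D.Iinf, y.idx = i ∧ z = FreeAlgebra.ι K y})).toRing with
      mul_comm := hcomm.is_comm.comm }
  have hmem : ∀ y : {y : D.Iinf // y.idx = i},
      n (p y) ∈ Algebra.adjoin K (n '' {z | ∃ y : D.Iinf, y.idx = i ∧ z = FreeAlgebra.ι K y}) := by
    intro y
    have : n (p y) ∈ (D.idxAlg y.1.idx).map n := ⟨_, ht.mem_idxAlg y.1, rfl⟩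
    rwa [idxAlg, AlgHom.map_adjoin, y.2] at this
  let e : MvPolynomial {y : D.Iinf // y.idx = i} K →ₐ[K]
      Algebra.adjoin K (n '' {z | ∃ y : D.Iinf, y.idx = i ∧ z = FreeAlgebra.ι K y}) :=
    MvPolynomial.aeval fun y => ⟨n (p y), hmem y⟩
  have key : ∀ v ∈ Algebra.adjoin K {z | ∃ y : D.Iinf, y.idx = i ∧ z = p y},
      (e (π v) : R) = n v := by
    intro v hv
    induction hv using Algebra.adjoin_induction with
    | mem z hz =>
      obtain ⟨y, hy, rfl⟩ := hz
      rw [hπ ⟨y, hy⟩, MvPolynomial.aeval_X]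
    | algebraMap c => rw [AlgHom.commutes, AlgHom.commutes, AlgHom.commutes]; rfl
    | add a b _ _ ha hb => rw [map_add, map_add, map_add, ← ha, ← hb]; rfl
    | mul a b _ _ ha hb => rw [map_mul, map_mul, map_mul, ← ha, ← hb]; rfl
  rw [← key u hu', hπu, map_zero]
  rfl

end Isotropic

/-- All choices of primitive generators agree in every algebra in which the relations
`f_ik f_il = f_il f_ik` for `a_ii = 0` hold. -/
theorem map_primitive_eq (hν : ∀ x, HasValue (ν x) 1) {b p : D.Iinf → D.F}
    (hb : D.IsPrimitive ν b) (hp : ∀ x, IsCanonical x (p x))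
    (hτ : ∀ x, D.A x.idx x.idx = 0 → D.form ν (p x) (p x) ≠ 0) {R : Type*} [Ring R] [Algebra K R]
    (n : D.F →ₐ[K] R) (hn : ∀ x y : D.Iinf, D.A x.idx y.idx = 0 →
      n (FreeAlgebra.ι K x) * n (FreeAlgebra.ι K y) = n (FreeAlgebra.ι K y) * n (FreeAlgebra.ι K x))
    (x : D.Iinf) : n (b x) = n (p x) := by
  have hrad := form_sub_eq_zero hb hp x
  rw [← sub_eq_zero, ← map_sub]
  -- the three cases `a_ii = 2`, `a_ii < 0` and `a_ii = 0`
  rcases D.diag x.idx with h | ⟨h, -⟩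
  · rw [hb.real x h, (hp x).real h, sub_self, map_zero]
  · rcases h.lt_or_eq with h | h
    · rw [eq_zero_of_radical hν h (sub_mem (hb.triangular.weight x) (hp x).weight) hrad, map_zero]
    · exact map_eq_zero_of_radical hp h (fun y hy => hτ y (hy ▸ h)) n
        (fun y z hy hz => hn y z (by rw [hy, hz, h]))
        (sub_mem (hb.triangular.mem_idxAlg x) ((triangular_of_canonical hp).mem_idxAlg x)) hrad

end Unique

/-! ### The halves of the algebra and the change of generators -/

section Halves

variable {I : Type*} {P : Type*} [AddCommGroup P] (D : Datum I P)

theorem toUHat_rel {u v : D.Free} (h : D.BaseRel u v) : D.toUHat u = D.toUHat v :=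
  RingQuot.mkAlgHom_rel K h

theorem toUHat_ft_mul (h h' : Module.Dual ℤ P) :
    D.toUHat (D.ft h) * D.toUHat (D.ft h') = D.toUHat (D.ft (h + h')) := by
  rw [← map_mul, D.toUHat_rel (.tor_add h h')]

theorem toUHat_ft_zero : D.toUHat (D.ft 0) = 1 := by rw [D.toUHat_rel .tor_zero, map_one]

theorem toUHat_ft_mul_fn (h : Module.Dual ℤ P) (x : D.Iinf) :
    D.toUHat (D.ft h) * D.toUHat (D.fn x) =
      q ^ (h (D.root (D.wt [x]))) • (D.toUHat (D.fn x) * D.toUHat (D.ft h)) := by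
  have h1 := congrArg (· * D.toUHat (D.ft h)) (D.toUHat_rel (.weight_neg h x))
  simp only [map_mul, map_smul] at h1
  rw [mul_assoc, toUHat_ft_mul, neg_add_cancel, toUHat_ft_zero, mul_one, smul_mul_assoc] at h1
  rw [h1, wt_singleton, root_single, map_smul, smul_eq_mul, neg_mul]

theorem toUHat_ft_mul_fp (h : Module.Dual ℤ P) (x : D.Iinf) :
    D.toUHat (D.ft h) * D.toUHat (D.fp x) =
      q ^ (-(h (D.root (D.wt [x])))) • (D.toUHat (D.fp x) * D.toUHat (D.ft h)) := by
  have h1 := congrArg (· * D.toUHat (D.ft h)) (D.toUHat_rel (.weight_pos h x))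
  simp only [map_mul, map_smul] at h1
  rw [mul_assoc, toUHat_ft_mul, neg_add_cancel, toUHat_ft_zero, mul_one, smul_mul_assoc] at h1
  rw [h1, wt_singleton, root_single, map_smul, smul_eq_mul, neg_mul, neg_neg]

/-- The map from the bialgebra `H` of the torus `P^∨` to the non-positive half of `Û`. -/
def iotaHat : D.coTorus.H →ₐ[K] D.UHat :=
  D.coTorus.lift (fun x => D.toUHat (D.fn x)) (fun h => D.toUHat (D.ft h)) D.toUHat_ft_zero
    (fun h h' => (D.toUHat_ft_mul h h').symm) D.toUHat_ft_mul_fn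

/-- The composite of `ω` and the map from the bialgebra `H` of the root lattice to `Û`. -/
def omegaHat : D.rootTorus.H →ₐ[K] D.UHat :=
  D.rootTorus.lift (fun x => D.toUHat (D.fp x)) (fun β => D.toUHat (D.ft (-(D.kExp β))))
    (by rw [← D.coTorus_k, map_zero, neg_zero, toUHat_ft_zero])
    (fun β β' => by
      rw [toUHat_ft_mul, ← neg_add, ← D.coTorus_k, ← D.coTorus_k, ← D.coTorus_k, ← map_add])
    (fun β x => by
      rw [toUHat_ft_mul_fp, LinearMap.neg_apply, neg_neg, kExp_root]; rfl)

theorem iotaHat_t (h : Module.Dual ℤ P) : D.iotaHat (D.coTorus.t h) = D.toUHat (D.ft h) :=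
  Torus.lift_t _ _ _ _

theorem omegaHat_t (β : I →₀ ℤ) :
    D.omegaHat (D.rootTorus.t β) = D.toUHat (D.ft (-(D.kExp β))) := Torus.lift_t _ _ _ _

theorem iotaHat_incl (z : D.F) : D.iotaHat (D.coTorus.incl z) =
    FreeAlgebra.lift K (fun x => D.toUHat (D.fn x)) z := by
  suffices D.iotaHat.comp D.coTorus.incl = FreeAlgebra.lift K (fun x => D.toUHat (D.fn x)) from
    DFunLike.congr_fun this z
  exact FreeAlgebra.hom_ext (funext fun x => by
    rw [Function.comp_apply, Function.comp_apply, FreeAlgebra.lift_ι_apply]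
    exact (congrArg D.iotaHat (D.coTorus.incl_ι x)).trans (Torus.lift_f _ _ _ x))

theorem omegaHat_incl (z : D.F) : D.omegaHat (D.rootTorus.incl z) =
    FreeAlgebra.lift K (fun x => D.toUHat (D.fp x)) z := by
  suffices D.omegaHat.comp D.rootTorus.incl = FreeAlgebra.lift K (fun x => D.toUHat (D.fp x)) from
    DFunLike.congr_fun this z
  exact FreeAlgebra.hom_ext (funext fun x => by simp [Torus.incl_ι, omegaHat, Torus.lift_f])

theorem iotaHat_proj (a : D.B) : D.iotaHat (D.coTorus.proj a) = D.piB a := Torus.lift_proj _ _ _ _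

theorem omegaHat_proj (b : D.B₂) : D.omegaHat (D.rootTorus.proj b) = D.omegaB (D.B₂toB b) := by
  refine (Torus.lift_proj _ _ _ _).trans ?_
  suffices FreeAlgebra.lift K (Sum.elim (fun x => D.toUHat (D.fp x))
      fun β => D.toUHat (D.ft (-(D.kExp β)))) = D.omegaB.comp D.B₂toB from
    DFunLike.congr_fun this b
  refine FreeAlgebra.hom_ext (funext fun x => ?_)
  cases x with
  | inl x => simp [B₂toB_inl, omegaB]
  | inr β => simp [B₂toB_inr, omegaB, torB]

/-- A torus element commutes with a homogeneous element of the positive half up to a scalar. -/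
theorem omegaHat_incl_mul (h : Module.Dual ℤ P) {β : I →₀ ℤ} {z : D.F} (hz : z ∈ D.homog β) :
    D.omegaHat (D.rootTorus.incl z) * D.toUHat (D.ft h) =
      q ^ (h (D.root β)) • (D.toUHat (D.ft h) * D.omegaHat (D.rootTorus.incl z)) := by
  rw [omegaHat_incl]
  refine homog_induction (p := fun z => FreeAlgebra.lift K (fun x => D.toUHat (D.fp x)) z *
    D.toUHat (D.ft h) = q ^ (h (D.root β)) • (D.toUHat (D.ft h) *
      FreeAlgebra.lift K (fun x => D.toUHat (D.fp x)) z)) (by simp)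
    (fun a b ha hb => ?_) (fun c a ha => ?_) (fun w hw => ?_) hz
  · rw [map_add, add_mul, ha, hb, mul_add, smul_add]
  · rw [map_smul, smul_mul_assoc, ha, mul_smul_comm, smul_comm]
  subst hw
  clear hz
  induction w with
  | nil => rw [mon_nil, map_one, one_mul, mul_one, wt_nil, ← rootHom_apply, map_zero, map_zero,
      zpow_zero, one_smul]
  | cons x w ih =>
    have e : D.root (D.wt (x :: w)) = D.root (D.wt [x]) + D.root (D.wt w) := by
      rw [show x :: w = [x] ++ w from rfl, wt_append, ← rootHom_apply, map_add]; rfl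
    have h1 := D.toUHat_ft_mul_fp h x
    rw [mon_cons, map_mul, FreeAlgebra.lift_ι_apply, mul_assoc, ih, mul_smul_comm, ← mul_assoc,
      ← mul_assoc, h1, smul_mul_assoc, smul_smul, e, map_add, ← zpow_add₀ q_ne_zero]
    congr 2
    ring

end Halves

section Change

variable {I : Type*} {P : Type*} [AddCommGroup P] {D : Datum I P}
  {A : Type*} [Ring A] [Algebra K A]

theorem map_serre {R S : Type*} [Ring R] [Algebra K R] [Ring S] [Algebra K S] (f : R →ₐ[K] S)
    (i j : I) (l : ℕ) (x y : R) : f (D.serre i j l x y) = D.serre i j l (f x) (f y) := by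
  simp [serre, divPow]

/-- The change of generators `e_x ↦ g(x)(e)`, `f_x ↦ g(x)(f)`, for polynomials `g(x) ∈ F`. -/
def changeGen (j : D.Free →ₐ[K] A) (g : D.Iinf → D.F) : D.Free →ₐ[K] A :=
  FreeAlgebra.lift K fun
    | .pos x => FreeAlgebra.lift K (fun y => j (D.fp y)) (g x)
    | .neg x => FreeAlgebra.lift K (fun y => j (D.fn y)) (g x)
    | .tor h => j (D.ft h)

/-- Algebra maps commute with the evaluation of noncommutative polynomials. -/
theorem map_lift {X R S : Type*} [Semiring R] [Algebra K R] [Semiring S] [Algebra K S]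
    (f : R →ₐ[K] S) (n : X → R) (z : FreeAlgebra K X) :
    f (FreeAlgebra.lift K n z) = FreeAlgebra.lift K (fun x => f (n x)) z := by
  suffices f.comp (FreeAlgebra.lift K n) = FreeAlgebra.lift K (fun x => f (n x)) from
    DFunLike.congr_fun this z
  exact FreeAlgebra.hom_ext (funext fun x => by simp)

variable (j : D.Free →ₐ[K] A) (g : D.Iinf → D.F)

theorem changeGen_fp (x : D.Iinf) :
    changeGen j g (D.fp x) = FreeAlgebra.lift K (fun y => j (D.fp y)) (g x) :=
  FreeAlgebra.lift_ι_apply _ _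

theorem changeGen_fn (x : D.Iinf) :
    changeGen j g (D.fn x) = FreeAlgebra.lift K (fun y => j (D.fn y)) (g x) :=
  FreeAlgebra.lift_ι_apply _ _

theorem changeGen_ft (h : Module.Dual ℤ P) : changeGen j g (D.ft h) = j (D.ft h) :=
  FreeAlgebra.lift_ι_apply _ _

variable {j g}

/-- Conjugation by a torus element scales homogeneous elements according to their weight. -/
theorem conj_homog {s s' : A} (hs : s * s' = 1) (hs' : s' * s = 1) {n : D.Iinf → A}
    {h : Module.Dual ℤ P} (hn : ∀ x, s * n x * s' = q ^ (h (D.root (D.wt [x]))) • n x)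
    {β : I →₀ ℤ} {z : D.F} (hz : z ∈ D.homog β) :
    s * FreeAlgebra.lift K n z * s' = q ^ (h (D.root β)) • FreeAlgebra.lift K n z := by
  refine homog_induction (p := fun z => s * FreeAlgebra.lift K n z * s' =
    q ^ (h (D.root β)) • FreeAlgebra.lift K n z) (by simp)
    (fun a b ha hb => ?_) (fun c a ha => ?_) (fun w hw => ?_) hz
  · rw [map_add, mul_add, add_mul, ha, hb, smul_add]
  · rw [map_smul, mul_smul_comm, smul_mul_assoc, ha, smul_comm]
  subst hw
  clear hz
  induction w with
  | nil => rw [mon_nil, map_one, mul_one, hs, wt_nil, ← rootHom_apply, map_zero, map_zero,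
      zpow_zero, one_smul]
  | cons x w ih =>
    have e : D.root (D.wt (x :: w)) = D.root (D.wt [x]) + D.root (D.wt w) := by
      rw [show x :: w = [x] ++ w from rfl, wt_append, ← rootHom_apply, map_add]; rfl
    rw [mon_cons, map_mul, FreeAlgebra.lift_ι_apply]
    calc s * (n x * FreeAlgebra.lift K n (mon w)) * s'
        = (s * n x * s') * (s * FreeAlgebra.lift K n (mon w) * s') := by
          simp only [mul_assoc]
          rw [← mul_assoc s' s, hs', one_mul]
      _ = _ := by
          rw [hn, ih, smul_mul_smul_comm, e, map_add, zpow_add₀ q_ne_zero]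

theorem halfRel_fp (hj : ∀ u v, D.BaseRel u v → j u = j v) : D.HalfRel fun x => j (D.fp x) where
  serre x y hx hxy := by rw [← map_serre, hj _ _ (.serre_pos x y hx hxy), map_zero]
  comm x y hxy := by
    rw [← sub_eq_zero, ← map_mul, ← map_mul, ← map_sub, hj _ _ (.comm_pos x y hxy), map_zero]

theorem halfRel_fn (hj : ∀ u v, D.BaseRel u v → j u = j v) : D.HalfRel fun x => j (D.fn x) where
  serre x y hx hxy := by rw [← map_serre, hj _ _ (.serre_neg x y hx hxy), map_zero]
  comm x y hxy := by
    rw [← sub_eq_zero, ← map_mul, ← map_mul, ← map_sub, hj _ _ (.comm_neg x y hxy), map_zero]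

/-- A triangular change of generators preserves the relations `BaseRel`. -/
theorem Triangular.changeGen_rel (hg : Triangular g) (hj : ∀ u v, D.BaseRel u v → j u = j v)
    (u v : D.Free) (huv : D.BaseRel u v) : changeGen j g u = changeGen j g v := by
  have hgw : ∀ x, g x ∈ D.homog (Finsupp.single x.idx (-(x.deg : ℤ))) := fun x =>
    wt_singleton x ▸ hg.weight x
  have hp := (halfRel_fp hj).change hg.real hgw
  have hn := (halfRel_fn hj).change hg.real hgw
  have htor : ∀ h h', j (D.ft h) * j (D.ft h') = j (D.ft (h + h')) := fun h h' => by
    rw [← map_mul, hj _ _ (.tor_add h h')]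
  have hzero : j (D.ft 0) = 1 := by rw [hj _ _ .tor_zero, map_one]
  have hinv : ∀ h, j (D.ft h) * j (D.ft (-h)) = 1 ∧ j (D.ft (-h)) * j (D.ft h) = 1 := fun h => by
    rw [htor, htor, add_neg_cancel, neg_add_cancel, hzero]; exact ⟨rfl, rfl⟩
  have hroot : ∀ (h : Module.Dual ℤ P) (x : D.Iinf),
      h (D.root (D.wt [x])) = -((x.deg : ℤ) * h (D.α x.idx)) := fun h x => by
    rw [wt_singleton, root_single, map_smul, smul_eq_mul, neg_mul]
  cases huv with
  | tor_zero => rw [changeGen_ft, hzero, map_one]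
  | tor_add h h' => rw [map_mul, changeGen_ft, changeGen_ft, changeGen_ft, htor]
  | weight_pos h x =>
    rw [map_mul, map_mul, map_smul, changeGen_ft, changeGen_ft, changeGen_fp,
      conj_homog (h := -h) (hinv h).1 (hinv h).2 (fun y => ?_) (hg.weight x),
      hroot, LinearMap.neg_apply, mul_neg, neg_neg]
    rw [hroot, LinearMap.neg_apply, mul_neg, neg_neg, ← map_mul, ← map_mul,
      hj _ _ (.weight_pos h y), map_smul]
  | weight_neg h x =>
    rw [map_mul, map_mul, map_smul, changeGen_ft, changeGen_ft, changeGen_fn,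
      conj_homog (h := h) (hinv h).1 (hinv h).2 (fun y => ?_) (hg.weight x), hroot]
    rw [hroot, ← map_mul, ← map_mul, hj _ _ (.weight_neg h y), map_smul]
  | serre_pos x y hx hxy =>
    rw [map_serre, changeGen_fp, changeGen_fp, map_zero]; exact hp.serre x y hx hxy
  | serre_neg x y hx hxy =>
    rw [map_serre, changeGen_fn, changeGen_fn, map_zero]; exact hn.serre x y hx hxy
  | comm_pos x y hxy =>
    rw [map_sub, map_mul, map_mul, changeGen_fp, changeGen_fp, map_zero, sub_eq_zero]
    exact hp.comm x y hxy
  | comm_neg x y hxy =>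
    rw [map_sub, map_mul, map_mul, changeGen_fn, changeGen_fn, map_zero, sub_eq_zero]
    exact hn.comm x y hxy

end Change

/-! ### The isomorphism -/

section Iso

variable {I : Type*} {P : Type*} [AddCommGroup P] {D : Datum I P} {ν : D.Iinf → K}

theorem toU_rel (u v : D.Free) (h : D.BaseRel u v) : D.toU ν u = D.toU ν v :=
  congrArg (RingQuot.mkAlgHom K (D.DrinfeldRel ν)) (D.toUHat_rel h)

theorem toPrimAlg_rel {τ : D.Iinf → K} {u v : D.Free} (h : D.PrimRel τ u v) :
    D.toPrimAlg τ u = D.toPrimAlg τ v := RingQuot.mkAlgHom_rel K h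

/-- The free algebra on the `f_il` and `K_β` maps to the subalgebra generated by them. -/
theorem B₂toB_mem_BK (b : D.B₂) : D.B₂toB b ∈ D.BK := by
  induction b using FreeAlgebra.induction with
  | grade0 c => rw [AlgHom.commutes]; exact Subalgebra.algebraMap_mem _ _
  | grade1 x =>
    cases x with
    | inl x =>
      refine Algebra.subset_adjoin (Or.inl ⟨FreeAlgebra.ι K x, ?_⟩)
      rw [B₂toB_inl, FtoB, FreeAlgebra.lift_ι_apply]
    | inr β => rw [B₂toB_inr]; exact Algebra.subset_adjoin (Or.inr ⟨β, rfl⟩)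
  | mul a b ha hb => rw [map_mul]; exact mul_mem ha hb
  | add a b ha hb => rw [map_add]; exact add_mem ha hb

/-- The commutation relations between primitive elements in an algebra in which the relations of
the Drinfeld double hold. -/
theorem bracket_of_drinfeldRel {A : Type*} [Ring A] [Algebra K A] (θ : D.UHat →ₐ[K] A)
    (hθ : ∀ u v, D.DrinfeldRel ν u v → θ u = θ v) {p : D.Iinf → D.F}
    (hp : ∀ x, IsCanonical x (p x)) (x y : D.Iinf) :
    θ (D.omegaHat (D.rootTorus.incl (p x))) * θ (D.iotaHat (D.coTorus.incl (p y))) -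
        θ (D.iotaHat (D.coTorus.incl (p y))) * θ (D.omegaHat (D.rootTorus.incl (p x))) =
      D.form ν (p y) (p x) • (θ (D.toUHat (D.ft (D.kExp (-(D.wt [y]))))) -
        θ (D.toUHat (D.ft (D.kExp (D.wt [x]))))) := by
  have hd : D.coTorus.doubleL ν (θ.comp D.iotaHat) (θ.comp D.omegaHat)
        (D.rootTorus.incl (p x)) (D.coTorus.incl (p y)) =
      D.coTorus.doubleR ν (θ.comp D.iotaHat) (θ.comp D.omegaHat)
        (D.rootTorus.incl (p x)) (D.coTorus.incl (p y)) := by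
    rw [← proj_FtoB₂, ← proj_FtoB,
      ← D.drinfeldLHS_eq_doubleL ν (θ := θ) (ι := θ.comp D.iotaHat)
        (ω := θ.comp D.omegaHat) (fun a => congrArg θ (D.iotaHat_proj a))
        (fun b => congrArg θ (D.omegaHat_proj b)),
      ← D.drinfeldRHS_eq_doubleR ν (θ := θ) (ι := θ.comp D.iotaHat)
        (ω := θ.comp D.omegaHat) (fun a => congrArg θ (D.iotaHat_proj a))
        (fun b => congrArg θ (D.omegaHat_proj b))]
    exact hθ _ _ (.rel _ _ (Or.inr (B₂toB_mem_BK _)))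
  have h := D.coTorus.bracket_of_double ν (θ.comp D.iotaHat) (θ.comp D.omegaHat)
    (Torus.wt_singleton_ne_zero x) (hp x).weight (hp x).prim₂ (hp y).prim hd
  simp only [AlgHom.comp_apply, omegaHat_t, iotaHat_t, coTorus_k] at h
  have e : -(D.kExp (-(D.wt [x]))) = D.kExp (D.wt [x]) := by
    rw [← coTorus_k, ← coTorus_k, map_neg, neg_neg]
  rwa [e, ← sub_eq_sub_iff_add_eq_add, ← smul_sub] at h

/-- The commutation relations between primitive elements in `U_q(𝔤)`. -/
theorem bracket_canonical {p : D.Iinf → D.F} (hp : ∀ x, IsCanonical x (p x)) (x y : D.Iinf) :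
    D.posU ν (p x) * D.negU ν (p y) - D.negU ν (p y) * D.posU ν (p x) =
      D.form ν (p y) (p x) • (D.torU ν (D.kExp (-(D.wt [y]))) - D.torU ν (D.kExp (D.wt [x]))) := by
  let θ : D.UHat →ₐ[K] D.U ν := RingQuot.mkAlgHom K (D.DrinfeldRel ν)
  have hpos : ∀ z, θ (D.omegaHat (D.rootTorus.incl z)) = D.posU ν z := fun z => by
    rw [omegaHat_incl]
    suffices θ.comp (FreeAlgebra.lift K fun x => D.toUHat (D.fp x)) = D.posU ν from
      DFunLike.congr_fun this z
    exact FreeAlgebra.hom_ext (funext fun x => by simp [posU, toU, θ])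
  have hneg : ∀ z, θ (D.iotaHat (D.coTorus.incl z)) = D.negU ν z := fun z => by
    rw [iotaHat_incl]
    suffices θ.comp (FreeAlgebra.lift K fun x => D.toUHat (D.fn x)) = D.negU ν from
      DFunLike.congr_fun this z
    exact FreeAlgebra.hom_ext (funext fun x => by simp [negU, toU, θ])
  have h := bracket_of_drinfeldRel (A := D.U ν) θ
    (fun u v huv => RingQuot.mkAlgHom_rel K huv) hp x y
  rw [hpos, hneg] at h
  exact h

variable (ν) in
/-- The homomorphism from the presented algebra to `U_q(𝔤)`. The bracket relation holds there for
the canonical generators `p`, which have the same images as the `b`. -/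
theorem exists_toU (hν : ∀ x, HasValue (ν x) 1) {b : D.Iinf → D.F} (hb : D.IsPrimitive ν b)
    {p : D.Iinf → D.F} (hp : ∀ x, IsCanonical x (p x))
    (hτ : ∀ x, D.A x.idx x.idx = 0 → D.form ν (p x) (p x) ≠ 0) :
    ∃ Φ : D.PrimAlg (fun x => D.form ν (b x) (b x)) →ₐ[K] D.U ν,
      ∀ u, Φ (D.toPrimAlg _ u) = changeGen (D.toU ν) b u := by
  suffices hrel : ∀ ⦃u v⦄, D.PrimRel (fun x => D.form ν (b x) (b x)) u v →
      changeGen (A := D.U ν) (D.toU ν) b u = changeGen (A := D.U ν) (D.toU ν) b v by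
    let Φ : D.PrimAlg (fun x => D.form ν (b x) (b x)) →ₐ[K] D.U ν :=
      RingQuot.liftAlgHom K ⟨changeGen (A := D.U ν) (D.toU ν) b, hrel⟩
    have hΦ : ∀ u, Φ (D.toPrimAlg _ u) = changeGen (D.toU ν) b u := fun u =>
      RingQuot.liftAlgHom_mkAlgHom_apply K _ _ _
    exact ⟨Φ, hΦ⟩
  intro u v huv
  cases huv with
  | base _ _ h => exact hb.triangular.changeGen_rel toU_rel u v h
  | bracket x y =>
    rw [map_sub, map_mul, map_mul, changeGen_fp, changeGen_fn]
    change D.posU ν (b x) * D.negU ν (b y) - D.negU ν (b y) * D.posU ν (b x) = _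
    have hpos : ∀ x, D.posU ν (b x) = D.posU ν (p x) := map_primitive_eq (R := D.U ν) hν hb hp hτ
      (D.posU ν) fun x y hxy => by
        simpa [posU] using (halfRel_fp (A := D.U ν) (j := D.toU ν) (toU_rel (ν := ν))).comm x y hxy
    have hneg : ∀ x, D.negU ν (b x) = D.negU ν (p x) := map_primitive_eq (R := D.U ν) hν hb hp hτ
      (D.negU ν) fun x y hxy => by
        simpa [negU] using (halfRel_fn (A := D.U ν) (j := D.toU ν) (toU_rel (ν := ν))).comm x y hxy
    rw [hpos, hneg, bracket_canonical hp]
    by_cases h : x = y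
    · subst h
      rw [if_pos rfl, map_smul, map_sub, changeGen_ft, changeGen_ft, form_self_eq hb hp,
        wt_singleton, ← Finsupp.single_neg, neg_neg]
      rfl
    · rw [if_neg h, map_zero, form_prim_eq_zero (triangular_of_canonical hp) (Ne.symm h), zero_smul]

variable (D) in
/-- The involution `a_x ↔ b_x`, `q^h ↦ q^(-h)` of the free algebra. -/
def swapGen : D.Free →ₐ[K] D.Free :=
  FreeAlgebra.lift K fun
    | .pos x => D.fn x
    | .neg x => D.fp x
    | .tor h => D.ft (-h)

theorem swapGen_fp (x : D.Iinf) : D.swapGen (D.fp x) = D.fn x := FreeAlgebra.lift_ι_apply _ _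

theorem swapGen_fn (x : D.Iinf) : D.swapGen (D.fn x) = D.fp x := FreeAlgebra.lift_ι_apply _ _

theorem swapGen_ft (h : Module.Dual ℤ P) : D.swapGen (D.ft h) = D.ft (-h) :=
  FreeAlgebra.lift_ι_apply _ _

/-- The involution `a_x ↔ b_x`, `q^h ↦ q^(-h)` of the presented algebra. -/
theorem exists_involution (τ : D.Iinf → K) : ∃ σ : D.PrimAlg τ →ₐ[K] D.PrimAlg τ,
    Function.Injective σ ∧ ∀ u, σ (D.toPrimAlg τ u) = D.toPrimAlg τ (D.swapGen u) := by
  let σ : D.PrimAlg τ →ₐ[K] D.PrimAlg τ :=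
    RingQuot.liftAlgHom K ⟨(D.toPrimAlg τ).comp D.swapGen, fun u v huv => by
      rw [AlgHom.comp_apply, AlgHom.comp_apply]
      cases huv with
      | base _ _ h =>
        cases h with
        | tor_zero =>
          rw [swapGen_ft, neg_zero, map_one, toPrimAlg_rel (.base _ _ .tor_zero)]
        | tor_add h h' =>
          rw [map_mul, swapGen_ft, swapGen_ft, swapGen_ft, neg_add,
            toPrimAlg_rel (.base _ _ (.tor_add _ _))]
        | weight_pos h x =>
          rw [map_mul D.swapGen, map_mul D.swapGen, map_smul D.swapGen, swapGen_ft, swapGen_ft,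
            swapGen_fp, toPrimAlg_rel (.base _ _ (.weight_neg _ _)), LinearMap.neg_apply, mul_neg, neg_neg]
        | weight_neg h x =>
          rw [map_mul D.swapGen, map_mul D.swapGen, map_smul D.swapGen, swapGen_ft, swapGen_ft,
            swapGen_fn, toPrimAlg_rel (.base _ _ (.weight_pos _ _)), LinearMap.neg_apply, mul_neg]
        | serre_pos x y hx hxy =>
          rw [map_serre, swapGen_fp, swapGen_fp, map_zero,
            toPrimAlg_rel (.base _ _ (.serre_neg x y hx hxy))]
        | serre_neg x y hx hxy =>
          rw [map_serre, swapGen_fn, swapGen_fn, map_zero,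
            toPrimAlg_rel (.base _ _ (.serre_pos x y hx hxy))]
        | comm_pos x y hxy =>
          rw [map_sub, map_mul, map_mul, swapGen_fp, swapGen_fp, map_zero,
            toPrimAlg_rel (.base _ _ (.comm_neg x y hxy))]
        | comm_neg x y hxy =>
          rw [map_sub, map_mul, map_mul, swapGen_fn, swapGen_fn, map_zero,
            toPrimAlg_rel (.base _ _ (.comm_pos x y hxy))]
      | bracket x y =>
        rw [map_sub, map_mul, map_mul, swapGen_fp, swapGen_fn, ← neg_sub, map_neg,
          toPrimAlg_rel (.bracket y x)]
        by_cases h : x = y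
        · subst h
          have e : ∀ n : ℤ, D.kExp (Finsupp.single x.idx (-n)) =
              -(D.kExp (Finsupp.single x.idx n)) := fun n => by
            rw [Finsupp.single_neg, ← coTorus_k, ← coTorus_k, map_neg]
          rw [if_pos rfl, ← map_neg, ← smul_neg, neg_sub, map_smul, map_smul,
            map_sub D.swapGen, swapGen_ft, swapGen_ft, e, neg_neg, map_smul]
        · rw [if_neg h, if_neg (Ne.symm h), map_zero, map_zero, map_zero, neg_zero]⟩
  have hσ : ∀ u, σ (D.toPrimAlg τ u) = D.toPrimAlg τ (D.swapGen u) := fun u =>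
    RingQuot.liftAlgHom_mkAlgHom_apply K _ _ _
  have hswap : ∀ u, D.swapGen (D.swapGen u) = u := fun u => by
    suffices D.swapGen.comp D.swapGen = AlgHom.id K D.Free from DFunLike.congr_fun this u
    refine FreeAlgebra.hom_ext (funext fun x => ?_)
    cases x with
    | pos x => exact (congrArg D.swapGen (swapGen_fp x)).trans (swapGen_fn x)
    | neg x => exact (congrArg D.swapGen (swapGen_fn x)).trans (swapGen_fp x)
    | tor h =>
      refine (congrArg D.swapGen (swapGen_ft h)).trans ((swapGen_ft (-h)).trans ?_)
      rw [neg_neg]; rfl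
  refine ⟨σ, Function.LeftInverse.injective (g := σ) fun a => ?_, hσ⟩
  obtain ⟨u, rfl⟩ := RingQuot.mkAlgHom_surjective K (D.PrimRel τ) a
  change σ (σ (D.toPrimAlg τ u)) = D.toPrimAlg τ u
  rw [hσ, hσ, hswap]

variable (ν) in
/-- The homomorphism from `U_q(𝔤)` to the presented algebra, for the change of generators `g`
inverse to `b`. -/
theorem exists_ofU (hν : ∀ x, HasValue (ν x) 1) {b : D.Iinf → D.F} (hb : D.IsPrimitive ν b)
    {p : D.Iinf → D.F} (hp : ∀ x, IsCanonical x (p x))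
    (hτ : ∀ x, D.A x.idx x.idx = 0 → D.form ν (p x) (p x) ≠ 0)
    {g : D.Iinf → D.F} (hg : Triangular g)
    (hgb : ∀ x, FreeAlgebra.lift K g (b x) = FreeAlgebra.ι K x) :
    ∃ Ψ : D.U ν →ₐ[K] D.PrimAlg (fun x => D.form ν (b x) (b x)),
      ∀ u, Ψ (D.toU ν u) = changeGen (D.toPrimAlg _) g u := by
  set τ : D.Iinf → K := fun x => D.form ν (b x) (b x)
  have hrel := hg.changeGen_rel (j := D.toPrimAlg τ) fun u v h => toPrimAlg_rel (.base u v h)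
  let θ : D.UHat →ₐ[K] D.PrimAlg τ :=
    RingQuot.liftAlgHom K ⟨changeGen (D.toPrimAlg τ) g, fun u v h => hrel u v h⟩
  have hθ : ∀ u, θ (D.toUHat u) = changeGen (D.toPrimAlg τ) g u := fun u =>
    RingQuot.liftAlgHom_mkAlgHom_apply K _ _ _
  obtain ⟨σ, hσ, hσu⟩ := exists_involution τ
  have hσp : ∀ z, σ (FreeAlgebra.lift K (fun y => D.toPrimAlg τ (D.fp y)) z) =
      FreeAlgebra.lift K (fun y => D.toPrimAlg τ (D.fn y)) z := fun z => by
    suffices σ.comp (FreeAlgebra.lift K fun y => D.toPrimAlg τ (D.fp y)) =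
      FreeAlgebra.lift K (fun y => D.toPrimAlg τ (D.fn y)) from DFunLike.congr_fun this z
    exact FreeAlgebra.hom_ext (funext fun x => by simp [hσu, swapGen_fp])
  have hσn : ∀ z, σ (FreeAlgebra.lift K (fun y => D.toPrimAlg τ (D.fn y)) z) =
      FreeAlgebra.lift K (fun y => D.toPrimAlg τ (D.fp y)) z := fun z => by
    suffices σ.comp (FreeAlgebra.lift K fun y => D.toPrimAlg τ (D.fn y)) =
      FreeAlgebra.lift K (fun y => D.toPrimAlg τ (D.fp y)) from DFunLike.congr_fun this z
    exact FreeAlgebra.hom_ext (funext fun x => by simp [hσu, swapGen_fn])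
  have hσπ : ∀ a, σ (θ (D.piB a)) = θ (D.omegaB a) := fun a => by
    suffices (σ.comp θ).comp D.piB = θ.comp D.omegaB from DFunLike.congr_fun this a
    refine FreeAlgebra.hom_ext (funext fun x => ?_)
    cases x with
    | inl x => simp [piB, omegaB, hθ, changeGen_fn, changeGen_fp, hσn]
    | inr h => simp [piB, omegaB, hθ, changeGen_ft, hσu, swapGen_ft]
  have hσω : ∀ a, σ (θ (D.omegaB a)) = θ (D.piB a) := fun a => by
    suffices (σ.comp θ).comp D.omegaB = θ.comp D.piB from DFunLike.congr_fun this a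
    refine FreeAlgebra.hom_ext (funext fun x => ?_)
    cases x with
    | inl x => simp [piB, omegaB, hθ, changeGen_fn, changeGen_fp, hσp]
    | inr h => simp [piB, omegaB, hθ, changeGen_ft, hσu, swapGen_ft]
  -- the images of the primitive generators in the presented algebra
  have hpos' : ∀ z, θ (D.omegaHat (D.rootTorus.incl z)) =
      FreeAlgebra.lift K (fun x => D.toPrimAlg τ (D.fp x)) (FreeAlgebra.lift K g z) := fun z => by
    rw [omegaHat_incl]
    suffices θ.comp (FreeAlgebra.lift K fun x => D.toUHat (D.fp x)) =
      (FreeAlgebra.lift K fun x => D.toPrimAlg τ (D.fp x)).comp (FreeAlgebra.lift K g) from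
      DFunLike.congr_fun this z
    exact FreeAlgebra.hom_ext (funext fun x => by simp [hθ, changeGen_fp])
  have hneg' : ∀ z, θ (D.iotaHat (D.coTorus.incl z)) =
      FreeAlgebra.lift K (fun x => D.toPrimAlg τ (D.fn x)) (FreeAlgebra.lift K g z) := fun z => by
    rw [iotaHat_incl]
    suffices θ.comp (FreeAlgebra.lift K fun x => D.toUHat (D.fn x)) =
      (FreeAlgebra.lift K fun x => D.toPrimAlg τ (D.fn x)).comp (FreeAlgebra.lift K g) from
      DFunLike.congr_fun this z
    exact FreeAlgebra.hom_ext (funext fun x => by simp [hθ, changeGen_fn])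
  have hpos : ∀ x, θ (D.omegaHat (D.rootTorus.incl (p x))) = D.toPrimAlg τ (D.fp x) := fun x => by
    rw [hpos', ← AlgHom.comp_apply, ← map_primitive_eq hν hb hp hτ _ (fun x y hxy => ?_) x,
      AlgHom.comp_apply, hgb, FreeAlgebra.lift_ι_apply]
    simpa [changeGen_fp] using (halfRel_fp (j := changeGen (D.toPrimAlg τ) g) hrel).comm x y hxy
  have hneg : ∀ x, θ (D.iotaHat (D.coTorus.incl (p x))) = D.toPrimAlg τ (D.fn x) := fun x => by
    rw [hneg', ← AlgHom.comp_apply, ← map_primitive_eq hν hb hp hτ _ (fun x y hxy => ?_) x,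
      AlgHom.comp_apply, hgb, FreeAlgebra.lift_ι_apply]
    simpa [changeGen_fn] using (halfRel_fn (j := changeGen (D.toPrimAlg τ) g) hrel).comm x y hxy
  have hkneg : ∀ β, D.kExp (-β) = -(D.kExp β) := fun β => by
    rw [← coTorus_k, ← coTorus_k, map_neg]
  have hdouble : D.coTorus.DoubleRel ν (θ.comp D.iotaHat) (θ.comp D.omegaHat) p :=
    { torus := fun β h => by
        rw [AlgHom.comp_apply, AlgHom.comp_apply, omegaHat_t, iotaHat_t, ← map_mul θ, ← map_mul θ,
          toUHat_ft_mul, toUHat_ft_mul, add_comm]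
      torus_neg := fun β x => by
        rw [AlgHom.comp_apply, AlgHom.comp_apply, omegaHat_t, ← iotaHat_t, ← map_mul, ← map_mul,
          Torus.t_mul_f, map_smul, map_smul, smul_smul, ← zpow_add₀ q_ne_zero, map_neg,
          AddMonoidHom.neg_apply, coTorus_ev, kExp_root, add_neg_cancel, zpow_zero, one_smul,
          map_mul, map_mul]
      torus_pos := fun x h => by
        rw [AlgHom.comp_apply, AlgHom.comp_apply, iotaHat_t, ← map_mul,
          D.omegaHat_incl_mul h (hp x).weight, map_smul, map_mul, map_neg, neg_neg, coTorus_ev]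
      bracket := fun x y => by
        rw [AlgHom.comp_apply, AlgHom.comp_apply, AlgHom.comp_apply, AlgHom.comp_apply,
          omegaHat_t, iotaHat_t, hpos, hneg, coTorus_k, hkneg, neg_neg, hkneg, hθ, hθ,
          changeGen_ft, changeGen_ft, ← sub_eq_sub_iff_add_eq_add, ← map_mul, ← map_mul, ← map_sub,
          toPrimAlg_rel (.bracket x y)]
        by_cases h : x = y
        · subst h
          have e : τ x = D.form ν (p x) (p x) := form_self_eq hb hp x
          rw [if_pos rfl, map_smul, map_sub, e, wt_singleton, ← hkneg, ← Finsupp.single_neg,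
            neg_neg]
          exact smul_sub _ _ _
        · rw [if_neg h, map_zero, form_prim_eq_zero (triangular_of_canonical hp) (Ne.symm h),
            zero_smul, zero_smul, sub_zero] }
  refine ⟨RingQuot.liftAlgHom K ⟨θ, fun u v huv => ?_⟩, fun u => ?_⟩
  · cases huv with
    | rel a b hab =>
      exact D.drinfeld_eq_of_double ν (fun a => congrArg θ (D.iotaHat_proj a))
        (fun b => congrArg θ (D.omegaHat_proj b)) hσ hσπ hσω
        (hdouble.doubleL_eq_doubleR (fun x => (hp x).weight) (fun x => (hp x).prim)
          (fun x => (hp x).prim₂) (triangular_of_canonical hp).adjoin_eq_top) a b hab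
  · exact (RingQuot.liftAlgHom_mkAlgHom_apply K _ _ _).trans (hθ u)

variable (ν) in
/-- The presentation of `U_q(𝔤)` by primitive generators. -/
theorem exists_algEquiv (hν : ∀ x, HasValue (ν x) 1) {b : D.Iinf → D.F} (hb : D.IsPrimitive ν b) :
    ∃ Φ : D.PrimAlg (fun x => D.form ν (b x) (b x)) ≃ₐ[K] D.U ν,
        (∀ x, Φ (D.toPrimAlg _ (D.fp x)) = D.posU ν (b x)) ∧
        (∀ x, Φ (D.toPrimAlg _ (D.fn x)) = D.negU ν (b x)) ∧
        (∀ h, Φ (D.toPrimAlg _ (D.ft h)) = D.torU ν h) := by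
  obtain ⟨p, hp, hτ⟩ := exists_canonical ν hν
  obtain ⟨g, hg, hbg, hgb⟩ := hb.triangular.exists_inverse
  obtain ⟨Φ, hΦ⟩ := exists_toU ν hν hb hp hτ
  obtain ⟨Ψ, hΨ⟩ := exists_ofU ν hν hb hp hτ hg hgb
  have h1 : Φ.comp Ψ = AlgHom.id K (D.U ν) := by
    refine RingQuot.ringQuot_ext' K _ _ (RingQuot.ringQuot_ext' K _ _ (FreeAlgebra.hom_ext
      (funext fun x => ?_)))
    cases x with
    | pos x =>
      change Φ (Ψ (D.toU ν (D.fp x))) = D.toU ν (D.fp x)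
      rw [hΨ, changeGen_fp, map_lift]
      simp only [hΦ, changeGen_fp]
      rw [← map_lift (FreeAlgebra.lift K _), hbg, FreeAlgebra.lift_ι_apply]
    | neg x =>
      change Φ (Ψ (D.toU ν (D.fn x))) = D.toU ν (D.fn x)
      rw [hΨ, changeGen_fn, map_lift]
      simp only [hΦ, changeGen_fn]
      rw [← map_lift (FreeAlgebra.lift K _), hbg, FreeAlgebra.lift_ι_apply]
    | tor h =>
      change Φ (Ψ (D.toU ν (D.ft h))) = D.toU ν (D.ft h)
      rw [hΨ, changeGen_ft, hΦ, changeGen_ft]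
  have h2 : Ψ.comp Φ = AlgHom.id K _ := by
    refine RingQuot.ringQuot_ext' K _ _ (FreeAlgebra.hom_ext (funext fun x => ?_))
    cases x with
    | pos x =>
      change Ψ (Φ (D.toPrimAlg _ (D.fp x))) = D.toPrimAlg _ (D.fp x)
      rw [hΦ, changeGen_fp, map_lift]
      simp only [hΨ, changeGen_fp]
      rw [← map_lift (FreeAlgebra.lift K _), hgb, FreeAlgebra.lift_ι_apply]
    | neg x =>
      change Ψ (Φ (D.toPrimAlg _ (D.fn x))) = D.toPrimAlg _ (D.fn x)
      rw [hΦ, changeGen_fn, map_lift]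
      simp only [hΨ, changeGen_fn]
      rw [← map_lift (FreeAlgebra.lift K _), hgb, FreeAlgebra.lift_ι_apply]
    | tor h =>
      change Ψ (Φ (D.toPrimAlg _ (D.ft h))) = D.toPrimAlg _ (D.ft h)
      rw [hΦ, changeGen_ft, hΨ, changeGen_ft]
  exact ⟨AlgEquiv.ofAlgHom Φ Ψ h1 h2, fun x => (hΦ _).trans (changeGen_fp _ _ x),
    fun x => (hΦ _).trans (changeGen_fn _ _ x), fun h => (hΦ _).trans (changeGen_ft _ _ h)⟩

end Iso

end Datum

end

end BorcherdsBozec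

open BorcherdsBozec in
theorem theorem2 {I : Type*} {P : Type*} [AddCommGroup P] [Module.Free ℤ P] (D : Datum I P)
    (ν : D.Iinf → K) (hν : ∀ x, OnePlusNat (ν x)) :
    (∃ b : D.Iinf → D.F, D.IsPrimitive ν b) ∧
    ∀ b : D.Iinf → D.F, D.IsPrimitive ν b →
      ∃ Φ : D.PrimAlg (fun x => D.form ν (b x) (b x)) ≃ₐ[K] D.U ν,
        (∀ x, Φ (D.toPrimAlg _ (D.fp x)) = D.posU ν (b x)) ∧
        (∀ x, Φ (D.toPrimAlg _ (D.fn x)) = D.negU ν (b x)) ∧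
        (∀ h, Φ (D.toPrimAlg _ (D.ft h)) = D.torU ν h) := by
  have hν' : ∀ x, HasValue (ν x) 1 := fun x => HasValue.of_onePlusNat (hν x)
  obtain ⟨p, hp, -⟩ := Datum.exists_canonical ν hν'
  exact ⟨⟨p, Datum.isPrimitive_of_canonical ν hp⟩, fun b hb => Datum.exists_algEquiv ν hν' hb⟩
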